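/- Let $V$ be a set of $n\ge 2$ vertices with weights $w:V\to[1,W]$, let $0<\varepsilon<1$, and let $G=(V,E)$ be a simple undirected graph that is initially empty and is updated by insertions and deletions of single edges. For a nonempty $S\subseteq V$ let $\rho_G(S)=|E(S)|/\sum_{v\in S}w(v)$, where $E(S)$ is the set of edges with both endpoints in $S$, and let $$\mathsf{OPT}_{\mathsf{LP}}=\max\Big\{\sum_{uv\in E}\min(x_u,x_v)\;:\;x\in\mathbb{R}_{\ge0}^V,\ \sum_{v\in V}w(v)\,x_v\le 1\Big\}.$$ The load of a vertex $v$ in an orientation of $G$ is its in-degree divided by $w(v)$. There are an absolute constant $C$ and a deterministic dynamic algorithm (one program for all $n$, $w$, $\varepsilon$ on a unit-cost real RAM with integer addition, subtraction and comparison, real arithmetic and comparison, and indirect addressing, but no rounding) that works as follows. It is initialized in time at most $C\,n\,A$, and after the initialization and after every update * an orientation of the current graph $G$ is stored explicitly in memory, and all its loads are at most $(1+\varepsilon)\,\mathsf{OPT}_{\mathsf{LP}}+C\log(nW)/\varepsilon$; * a nonempty set $S\subseteq V$ with $\rho_G(S)\ge(1-\varepsilon)\,\mathsf{OPT}_{\mathsf{LP}}-C\log(nW)/\varepsilon$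 is maintained implicitly: a query lists the vertices of such a set in time at most $C|S|$. The total time of any first $m$ updates is at most $C\,m\,A$, and every single update takes time at most $C\,B$, where $$A=\frac{\log^2(nW)\,\log\!\big(2+\log(nW)/\varepsilon\big)}{\varepsilon^2},\qquad B=\frac{\log^3(nW)\,\log\!\big(2+\log(nW)/\varepsilon\big)}{\varepsilon^4}.$$ -/

import Mathlib

/-! ### Vertex-weighted densest subgraph -/

section DensestSubgraph

variable {V : Type*} [Fintype V]

/-- The density `|E(S)| / w(S)`: `E(S)` is the set of edges with both endpoints in `S`,
and `w(S)` is the sum of the vertex weights in `S`. -/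
noncomputable def density (G : SimpleGraph V) (w : V → ℝ) (S : Finset V) : ℝ :=
  ({e ∈ G.edgeSet | ∀ x ∈ e, x ∈ S}.ncard : ℝ) / ∑ v ∈ S, w v

open Classical in
/-- The objective `∑_{uv ∈ E} min (x u) (x v)` of the linear programming relaxation. -/
noncomputable def lpObjective (G : SimpleGraph V) (x : V → ℝ) : ℝ :=
  ∑ e ∈ G.edgeFinset, (e.map x).inf

/-- The feasible region `x ≥ 0`, `∑ w(v) x(v) ≤ 1` of the linear programming relaxation. -/
def LpFeasible (w x : V → ℝ) : Prop :=
  (∀ v, 0 ≤ x v) ∧ ∑ v, w v * x v ≤ 1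

/-- The optimum value of the linear programming relaxation. -/
noncomputable def optLP (G : SimpleGraph V) (w : V → ℝ) : ℝ :=
  sSup (lpObjective G '' {x | LpFeasible w x})

/-- `D` is an (integral) orientation of `G`; `D u v` means that the edge `uv` is present and
directed from `u` to `v`. -/
def IsOrientation (G : SimpleGraph V) (D : V → V → Prop) : Prop :=
  (∀ u v, D u v → G.Adj u v) ∧ ∀ u v, G.Adj u v → Xor (D u v) (D v u)

/-- The load of `v`: its in-degree divided by its weight. -/
noncomputable def load (w : V → ℝ) (D : V → V → Prop) (v : V) : ℝ :=
  ({u | D u v}.ncard : ℝ) / w v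

end DensestSubgraph

/-! ### A real RAM with step counts

The memory holds integer and real scalar variables and integer and real arrays.  Integers can be
added, subtracted, compared and used as array indices; reals can be added, subtracted, multiplied,
divided and compared; there is no rounding from reals to integers.  Every operation costs one. -/

namespace RealRAM

structure State where
  ivar : ℕ → ℤ
  rvar : ℕ → ℝ
  iarr : ℕ → ℤ → ℤ
  rarr : ℕ → ℤ → ℝ

/-- Integer expressions; `get a i` reads the entry `i` of the integer array number `a`. -/
inductive IExpr where
  | const (c : ℤ)
  | var (x : ℕ)
  | get (a : ℕ) (i : IExpr)
  | add (e f : IExpr)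
  | sub (e f : IExpr)

/-- Real expressions; `cast e` converts an integer into a real number. -/
inductive RExpr where
  | const (c : ℚ)
  | var (x : ℕ)
  | get (a : ℕ) (i : IExpr)
  | cast (e : IExpr)
  | add (e f : RExpr)
  | sub (e f : RExpr)
  | mul (e f : RExpr)
  | div (e f : RExpr)

/-- Tests. -/
inductive BExpr where
  | ile (e f : IExpr)
  | ieq (e f : IExpr)
  | rle (e f : RExpr)
  | req (e f : RExpr)
  | not (b : BExpr)
  | and (b c : BExpr)
  | or (b c : BExpr)

/-- Programs. -/
inductive Prog where
  | skip
  | iassign (x : ℕ) (e : IExpr)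
  | rassign (x : ℕ) (e : RExpr)
  | istore (a : ℕ) (i : IExpr) (e : IExpr)
  | rstore (a : ℕ) (i : IExpr) (e : RExpr)
  | seq (p q : Prog)
  | ite (b : BExpr) (p q : Prog)
  | while (b : BExpr) (p : Prog)

def IExpr.eval (s : State) : IExpr → ℤ
  | const c => c
  | var x => s.ivar x
  | get a i => s.iarr a (i.eval s)
  | add e f => e.eval s + f.eval s
  | sub e f => e.eval s - f.eval s

noncomputable def RExpr.eval (s : State) : RExpr → ℝ
  | const c => (c : ℝ)
  | var x => s.rvar x
  | get a i => s.rarr a (i.eval s)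
  | cast e => (e.eval s : ℝ)
  | add e f => e.eval s + f.eval s
  | sub e f => e.eval s - f.eval s
  | mul e f => e.eval s * f.eval s
  | div e f => e.eval s / f.eval s

def BExpr.eval (s : State) : BExpr → Prop
  | ile e f => e.eval s ≤ f.eval s
  | ieq e f => e.eval s = f.eval s
  | rle e f => e.eval s ≤ f.eval s
  | req e f => e.eval s = f.eval s
  | not b => ¬ b.eval s
  | and b c => b.eval s ∧ c.eval s
  | or b c => b.eval s ∨ c.eval s

/-- The cost of evaluating an expression: one for every operation, memory access or constant. -/
def IExpr.cost : IExpr → ℕ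
  | const _ => 1
  | var _ => 1
  | get _ i => i.cost + 1
  | add e f => e.cost + f.cost + 1
  | sub e f => e.cost + f.cost + 1

/-- The cost of evaluating an expression: one for every operation, memory access or constant. -/
def RExpr.cost : RExpr → ℕ
  | const _ => 1
  | var _ => 1
  | get _ i => i.cost + 1
  | cast e => e.cost + 1
  | add e f => e.cost + f.cost + 1
  | sub e f => e.cost + f.cost + 1
  | mul e f => e.cost + f.cost + 1
  | div e f => e.cost + f.cost + 1

/-- The cost of evaluating an expression: one for every operation, memory access or constant. -/
def BExpr.cost : BExpr → ℕ
  | ile e f => e.cost + f.cost + 1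
  | ieq e f => e.cost + f.cost + 1
  | rle e f => e.cost + f.cost + 1
  | req e f => e.cost + f.cost + 1
  | not b => b.cost + 1
  | and b c => b.cost + c.cost + 1
  | or b c => b.cost + c.cost + 1

def State.setIvar (s : State) (x : ℕ) (k : ℤ) : State :=
  { s with ivar := Function.update s.ivar x k }

def State.setRvar (s : State) (x : ℕ) (r : ℝ) : State :=
  { s with rvar := Function.update s.rvar x r }

def State.setIarr (s : State) (a : ℕ) (i : ℤ) (k : ℤ) : State :=
  { s with iarr := Function.update s.iarr a (Function.update (s.iarr a) i k) }

def State.setRarr (s : State) (a : ℕ) (i : ℤ) (r : ℝ) : State :=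
  { s with rarr := Function.update s.rarr a (Function.update (s.rarr a) i r) }

/-- `Exec p s s' t`: the program `p`, started in the memory state `s`, halts in the state `s'`
after exactly `t` steps. -/
inductive Exec : Prog → State → State → ℕ → Prop
  | skip (s : State) : Exec .skip s s 1
  | iassign (x : ℕ) (e : IExpr) (s : State) :
      Exec (.iassign x e) s (s.setIvar x (e.eval s)) (e.cost + 1)
  | rassign (x : ℕ) (e : RExpr) (s : State) :
      Exec (.rassign x e) s (s.setRvar x (e.eval s)) (e.cost + 1)
  | istore (a : ℕ) (i e : IExpr) (s : State) :
      Exec (.istore a i e) s (s.setIarr a (i.eval s) (e.eval s)) (i.cost + e.cost + 1)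
  | rstore (a : ℕ) (i : IExpr) (e : RExpr) (s : State) :
      Exec (.rstore a i e) s (s.setRarr a (i.eval s) (e.eval s)) (i.cost + e.cost + 1)
  | seq {p q : Prog} {s s' s'' : State} {t t' : ℕ} (hp : Exec p s s' t) (hq : Exec q s' s'' t') :
      Exec (.seq p q) s s'' (t + t')
  | ite_true {b : BExpr} {p q : Prog} {s s' : State} {t : ℕ} (hb : b.eval s)
      (hp : Exec p s s' t) : Exec (.ite b p q) s s' (b.cost + t + 1)
  | ite_false {b : BExpr} {p q : Prog} {s s' : State} {t : ℕ} (hb : ¬ b.eval s)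
      (hq : Exec q s s' t) : Exec (.ite b p q) s s' (b.cost + t + 1)
  | while_true {b : BExpr} {p : Prog} {s s' s'' : State} {t t' : ℕ} (hb : b.eval s)
      (hp : Exec p s s' t) (hw : Exec (.while b p) s' s'' t') :
      Exec (.while b p) s s'' (b.cost + t + t' + 1)
  | while_false {b : BExpr} {p : Prog} {s : State} (hb : ¬ b.eval s) :
      Exec (.while b p) s s (b.cost + 1)

/-- The machine is deterministic: the final state and the number of steps are determined by the
program and the initial state. -/
theorem Exec.deterministic {p : Prog} {s s₁ s₂ : State} {t₁ t₂ : ℕ}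
    (h₁ : Exec p s s₁ t₁) (h₂ : Exec p s s₂ t₂) : s₁ = s₂ ∧ t₁ = t₂ := by
  induction h₁ generalizing s₂ t₂ with
  | skip | iassign | rassign | istore | rstore => cases h₂; exact ⟨rfl, rfl⟩
  | seq _ _ ih ih' =>
    cases h₂ with
    | seq hp hq =>
      obtain ⟨rfl, rfl⟩ := ih hp
      obtain ⟨rfl, rfl⟩ := ih' hq
      exact ⟨rfl, rfl⟩
  | ite_true hb _ ih =>
    cases h₂ with
    | ite_true _ hp => obtain ⟨rfl, rfl⟩ := ih hp; exact ⟨rfl, rfl⟩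
    | ite_false hb' _ => exact absurd hb hb'
  | ite_false hb _ ih =>
    cases h₂ with
    | ite_true hb' _ => exact absurd hb' hb
    | ite_false _ hq => obtain ⟨rfl, rfl⟩ := ih hq; exact ⟨rfl, rfl⟩
  | while_true hb _ _ ih ih' =>
    cases h₂ with
    | while_true _ hp hw =>
      obtain ⟨rfl, rfl⟩ := ih hp
      obtain ⟨rfl, rfl⟩ := ih' hw
      exact ⟨rfl, rfl⟩
    | while_false hb' => exact absurd hb hb'
  | while_false hb =>
    cases h₂ with
    | while_true hb' _ _ => exact absurd hb' hb
    | while_false _ => exact ⟨rfl, rfl⟩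

end RealRAM

/-! ### Dynamic graph algorithms -/

open RealRAM in
/-- A dynamic algorithm on the real RAM: one program for the initialization, one for processing
an edge update, and one that lists the vertices of a subgraph. -/
structure DynAlg where
  init : Prog
  update : Prog
  query : Prog

/-- Insertion or deletion of the undirected edge `uv`. -/
inductive EdgeUpdate (n : ℕ) where
  | insert (u v : Fin n)
  | delete (u v : Fin n)

namespace EdgeUpdate

variable {n : ℕ}

/-- Only absent edges may be inserted, and only present edges may be deleted. -/
def Valid (G : SimpleGraph (Fin n)) : EdgeUpdate n → Prop
  | insert u v => u ≠ v ∧ ¬ G.Adj u v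
  | delete u v => G.Adj u v

def apply (G : SimpleGraph (Fin n)) : EdgeUpdate n → SimpleGraph (Fin n)
  | insert u v => G ⊔ SimpleGraph.edge u v
  | delete u v => G.deleteEdges {s(u, v)}

/-- The update is handed to the machine in the integer variables 1 (1 for an insertion, 0 for a
deletion), 2 and 3 (the endpoints). -/
def handOver (s : RealRAM.State) : EdgeUpdate n → RealRAM.State
  | insert u v => ((s.setIvar 1 1).setIvar 2 (u : ℕ)).setIvar 3 (v : ℕ)
  | delete u v => ((s.setIvar 1 0).setIvar 2 (u : ℕ)).setIvar 3 (v : ℕ)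

end EdgeUpdate

namespace DynAlg

/-- The initial memory: the integer variable 0 holds `n`, the real variable 0 holds `ε`, the
first `n` entries of the real array 0 are the vertex weights, and everything else is 0. -/
noncomputable def input {n : ℕ} (ε : ℝ) (w : Fin n → ℝ) : RealRAM.State where
  ivar x := if x = 0 then (n : ℤ) else 0
  rvar x := if x = 0 then ε else 0
  iarr _ _ := 0
  rarr a i := if h : a = 0 ∧ 0 ≤ i ∧ i.toNat < n then w ⟨i.toNat, h.2.2⟩ else 0

/-- `A.Reach ε w G s m T`: after the initialization for the empty graph on `n` vertices with
weights `w`, some sequence of valid edge updates and queries leads to the graph `G` and to the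
memory state `s`; the sequence contains `m` updates, and these took `T` steps in total. -/
inductive Reach (A : DynAlg) {n : ℕ} (ε : ℝ) (w : Fin n → ℝ) :
    SimpleGraph (Fin n) → RealRAM.State → ℕ → ℕ → Prop
  | init {s : RealRAM.State} {t : ℕ} (h : RealRAM.Exec A.init (input ε w) s t) :
      Reach A ε w ⊥ s 0 0
  | update {G : SimpleGraph (Fin n)} {s s' : RealRAM.State} {m T t : ℕ} (hr : Reach A ε w G s m T)
      (x : EdgeUpdate n) (hx : x.Valid G) (h : RealRAM.Exec A.update (x.handOver s) s' t) :
      Reach A ε w (x.apply G) s' (m + 1) (T + t)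
  | query {G : SimpleGraph (Fin n)} {s s' : RealRAM.State} {m T t : ℕ} (hr : Reach A ε w G s m T)
      (h : RealRAM.Exec A.query s s' t) : Reach A ε w G s' m T

/-- The orientation that is stored explicitly in the integer array 0, viewed as an `n × n`
matrix: the entry `(u, v)` is 1 exactly if there is an arc from `u` to `v`. -/
def storedArc {n : ℕ} (s : RealRAM.State) (u v : Fin n) : Prop :=
  s.iarr 0 (((u : ℕ) * n + (v : ℕ) : ℕ) : ℤ) = 1

/-- The first entries of the integer array 1 list the elements of `S`, each of them once; their
number is in the integer variable 1. -/
def Lists {n : ℕ} (s : RealRAM.State) (S : Finset (Fin n)) : Prop :=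
  s.ivar 1 = S.card ∧
    Set.BijOn (fun i : ℕ => s.iarr 1 i) (Set.Iio S.card) ((fun v : Fin n => ((v : ℕ) : ℤ)) '' S)

end DynAlg

/-- `log²(nW) · log(2 + log(nW)/ε) / ε²`; the summand 2 only matters for bounded `log(nW)/ε`. -/
noncomputable def amortizedTime (n : ℕ) (W ε : ℝ) : ℝ :=
  Real.log (n * W) ^ 2 * Real.log (2 + Real.log (n * W) / ε) / ε ^ 2

/-- `log³(nW) · log(2 + log(nW)/ε) / ε⁴`. -/
noncomputable def worstCaseTime (n : ℕ) (W ε : ℝ) : ℝ :=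
  Real.log (n * W) ^ 3 * Real.log (2 + Real.log (n * W) / ε) / ε ^ 4

/-! The algorithm maintains an orientation that is nearly locally optimal. Every vertex has a level
`i`, which means that its in-degree divided by its weight lies between `threshold i` and `threshold
(i + 1)`; the thresholds grow by a factor `1 + η` and an additive 2 per level. The invariant is that
the head of an arc is at most three levels above its tail. Hence all arcs into the vertices of level
at least `i` lie inside the set of vertices of level at least `i - 3`. Descending from the top level
in steps of three, the weight of the level set can grow by a factor `1 + ε / 4` only `O(log(nW) /
ε)` times, so soon there is a level `i` where the weight grows by less. There the set of level at
least `i - 3` has density at least `threshold i / (1 + ε / 4)` (`le_density`), and `threshold i` is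
close to the largest load because the top is few levels away (`threshold_ge_add`). Weak duality puts
`optLP` between this density and the largest load (`density_le_optLP`, `optLP_le`). With `η = ε² /
(64 b)`, where `2 ^ b` is roughly the total weight, the two ends agree up to a factor `1 - ε / 2`
and an additive `O(b / ε)`; this is `Good.quality`.

A vertex that changes its level cannot tell all its neighbours at once. Instead each arc carries a
label, a possibly outdated level of its head that is wrong by at most one, and the test against the
level of the tail uses the label (`Consistent`). Whenever an in-degree changes by one, up to `K`
outdated incoming arcs are refreshed. Since `K * η ≥ 2`, the in-degree must change so often between
two level boundaries that all outdated labels are gone before the next boundary is crossed;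
`old_low` and `old_high` quantify this. Buckets of arcs by label, for each head and for each tail,
give access to the relevant arcs in constant time.

An insertion leaves one vertex with a surplus arc. If refreshing a label would violate the
invariant, that arc is reversed and the surplus moves to a vertex of lower level (`wp_push`). A
deletion leaves a deficit, which moves upwards along outgoing arcs with the largest admissible label
(`wp_pull`). So a surplus costs `O(L * K)` steps in the worst case and a deficit `O(L + K)`, where
`L = O(b² / ε²)` bounds the levels and `K = O(b / ε²)`.

For the amortized bound, each step of `push` raises the sum of the labels minus the level of the
current vertex by one. The potential subtracts the sum of the labels from an upper bound for it,
corrected so that a change of level is paid for in advance; an update raises it by `O(L + K)` only.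
The programs are verified with `Wp`, which treats results and running times together, and
determinism of the machine transfers the conclusions to arbitrary runs (`good_of_reach`). -/

namespace RealRAM

/-! ### Weakest preconditions with running times -/

/-- The program `p` halts when started in `s`, and the final state and the running time
satisfy `Q`. -/
def Wp (p : Prog) (Q : State → ℕ → Prop) (s : State) : Prop :=
  ∃ s' t, Exec p s s' t ∧ Q s' t

theorem Wp.mono {p : Prog} {Q Q' : State → ℕ → Prop} {s : State} (h : Wp p Q s)
    (hQ : ∀ s' t, Q s' t → Q' s' t) : Wp p Q' s := by
  obtain ⟨s', t, h, hq⟩ := h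
  exact ⟨s', t, h, hQ _ _ hq⟩

theorem wp_skip {Q : State → ℕ → Prop} {s : State} : Wp .skip Q s ↔ Q s 1 :=
  ⟨fun ⟨_, _, h, hq⟩ => by cases h; exact hq, fun h => ⟨_, _, .skip s, h⟩⟩

theorem wp_iassign {x : ℕ} {e : IExpr} {Q : State → ℕ → Prop} {s : State} :
    Wp (.iassign x e) Q s ↔ Q (s.setIvar x (e.eval s)) (e.cost + 1) :=
  ⟨fun ⟨_, _, h, hq⟩ => by cases h; exact hq, fun h => ⟨_, _, .iassign x e s, h⟩⟩

theorem wp_rassign {x : ℕ} {e : RExpr} {Q : State → ℕ → Prop} {s : State} :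
    Wp (.rassign x e) Q s ↔ Q (s.setRvar x (e.eval s)) (e.cost + 1) :=
  ⟨fun ⟨_, _, h, hq⟩ => by cases h; exact hq, fun h => ⟨_, _, .rassign x e s, h⟩⟩

theorem wp_istore {a : ℕ} {i e : IExpr} {Q : State → ℕ → Prop} {s : State} :
    Wp (.istore a i e) Q s ↔ Q (s.setIarr a (i.eval s) (e.eval s)) (i.cost + e.cost + 1) :=
  ⟨fun ⟨_, _, h, hq⟩ => by cases h; exact hq, fun h => ⟨_, _, .istore a i e s, h⟩⟩

theorem wp_rstore {a : ℕ} {i : IExpr} {e : RExpr} {Q : State → ℕ → Prop} {s : State} :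
    Wp (.rstore a i e) Q s ↔ Q (s.setRarr a (i.eval s) (e.eval s)) (i.cost + e.cost + 1) :=
  ⟨fun ⟨_, _, h, hq⟩ => by cases h; exact hq, fun h => ⟨_, _, .rstore a i e s, h⟩⟩

theorem wp_seq {p q : Prog} {Q : State → ℕ → Prop} {s : State} :
    Wp (.seq p q) Q s ↔ Wp p (fun s' t => Wp q (fun s'' t' => Q s'' (t + t')) s') s := by
  constructor
  · rintro ⟨_, _, h, hq⟩
    cases h with
    | seq h₁ h₂ => exact ⟨_, _, h₁, _, _, h₂, hq⟩
  · rintro ⟨_, _, h₁, _, _, h₂, hq⟩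
    exact ⟨_, _, .seq h₁ h₂, hq⟩

theorem wp_ite {b : BExpr} {p q : Prog} {Q : State → ℕ → Prop} {s : State} :
    Wp (.ite b p q) Q s ↔ (b.eval s → Wp p (fun s' t => Q s' (b.cost + t + 1)) s) ∧
      (¬ b.eval s → Wp q (fun s' t => Q s' (b.cost + t + 1)) s) := by
  constructor
  · rintro ⟨_, _, h, hq⟩
    cases h with
    | ite_true hb h => exact ⟨fun _ => ⟨_, _, h, hq⟩, fun hb' => absurd hb hb'⟩
    | ite_false hb h => exact ⟨fun hb' => absurd hb' hb, fun _ => ⟨_, _, h, hq⟩⟩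
  · rintro ⟨h₁, h₂⟩
    by_cases hb : b.eval s
    · obtain ⟨_, _, h, hq⟩ := h₁ hb
      exact ⟨_, _, .ite_true hb h, hq⟩
    · obtain ⟨_, _, h, hq⟩ := h₂ hb
      exact ⟨_, _, .ite_false hb h, hq⟩

/-- The rule for loops: the invariant `I k s t` has a decreasing variant `k` and the time `t`
elapsed so far. -/
theorem wp_while {b : BExpr} {p : Prog} {Q : State → ℕ → Prop} (I : ℕ → State → ℕ → Prop)
    (hstep : ∀ k s t, I k s t → b.eval s →
      Wp p (fun s' t' => ∃ k' < k, I k' s' (t + (b.cost + t' + 1))) s)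
    (hend : ∀ k s t, I k s t → ¬ b.eval s → Q s (t + (b.cost + 1)))
    {k : ℕ} {s : State} (h : I k s 0) : Wp (.while b p) Q s := by
  suffices H : ∀ k s t, I k s t → Wp (.while b p) (fun s' t' => Q s' (t + t')) s by
    simpa using H k s 0 h
  intro k
  induction k using Nat.strong_induction_on with
  | _ k ih =>
    intro s t hI
    by_cases hb : b.eval s
    · obtain ⟨s', t', h₁, k', hk, hI'⟩ := hstep k s t hI hb
      obtain ⟨s'', t'', h₂, hq⟩ := ih k' hk s' _ hI'
      refine ⟨s'', _, .while_true hb h₁ h₂, ?_⟩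
      convert hq using 1
      omega
    · exact ⟨s, _, .while_false hb, hend k s t hI hb⟩

/-- Sequential composition of a list of programs. -/
def block : List Prog → Prog
  | [] => .skip
  | p :: ps => .seq p (block ps)

theorem wp_block_nil {Q : State → ℕ → Prop} {s : State} : Wp (block []) Q s ↔ Q s 1 := wp_skip

theorem wp_block_cons {p : Prog} {ps : List Prog} {Q : State → ℕ → Prop} {s : State} :
    Wp (block (p :: ps)) Q s ↔
      Wp p (fun s' t => Wp (block ps) (fun s'' t' => Q s'' (t + t')) s') s := wp_seq

section Projections

variable (s : State) (x a : ℕ) (i k : ℤ) (r : ℝ)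

@[simp] theorem State.setIvar_ivar (y : ℕ) :
    (s.setIvar x k).ivar y = if y = x then k else s.ivar y := Function.update_apply ..
@[simp] theorem State.setIvar_rvar : (s.setIvar x k).rvar = s.rvar := rfl
@[simp] theorem State.setIvar_iarr : (s.setIvar x k).iarr = s.iarr := rfl
@[simp] theorem State.setIvar_rarr : (s.setIvar x k).rarr = s.rarr := rfl
@[simp] theorem State.setRvar_ivar : (s.setRvar x r).ivar = s.ivar := rfl
@[simp] theorem State.setRvar_rvar (y : ℕ) :
    (s.setRvar x r).rvar y = if y = x then r else s.rvar y := Function.update_apply ..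
@[simp] theorem State.setRvar_iarr : (s.setRvar x r).iarr = s.iarr := rfl
@[simp] theorem State.setRvar_rarr : (s.setRvar x r).rarr = s.rarr := rfl
@[simp] theorem State.setIarr_ivar : (s.setIarr a i k).ivar = s.ivar := rfl
@[simp] theorem State.setIarr_rvar : (s.setIarr a i k).rvar = s.rvar := rfl
@[simp] theorem State.setIarr_iarr (b : ℕ) : (s.setIarr a i k).iarr b =
    if b = a then Function.update (s.iarr a) i k else s.iarr b := by
  by_cases h : b = a
  · subst h; simp [State.setIarr]
  · simp [State.setIarr, h]
@[simp] theorem State.setIarr_rarr : (s.setIarr a i k).rarr = s.rarr := rfl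
@[simp] theorem State.setRarr_ivar : (s.setRarr a i r).ivar = s.ivar := rfl
@[simp] theorem State.setRarr_rvar : (s.setRarr a i r).rvar = s.rvar := rfl
@[simp] theorem State.setRarr_iarr : (s.setRarr a i r).iarr = s.iarr := rfl
@[simp] theorem State.setRarr_rarr (b : ℕ) : (s.setRarr a i r).rarr b =
    if b = a then Function.update (s.rarr a) i r else s.rarr b := by
  by_cases h : b = a
  · subst h; simp [State.setRarr]
  · simp [State.setRarr, h]

end Projections

/-! ### Buckets -/

theorem mul_add_inj {n : ℕ} {a a' k k' : ℤ} (h0 : 0 ≤ k) (h1 : k < n) (h0' : 0 ≤ k') (h1' : k' < n)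
    (h : a * n + k = a' * n + k') : a = a' ∧ k = k' := by
  have key : ∀ a k : ℤ, 0 ≤ k → k < n → (a * n + k) / n = a := fun a k h0 h1 => by
    rw [Int.add_comm, Int.add_mul_ediv_right _ _ (by omega), Int.ediv_eq_zero_of_lt h0 h1, zero_add]
  have h2 : a = a' := by rw [← key a k h0 h1, ← key a' k' h0' h1', h]
  subst h2
  exact ⟨rfl, by omega⟩

/-- The first memory cell of the bucket of the owner `o` with label `j`. -/
def cell (n : ℕ) (j : ℤ) (o : Fin n) : ℤ := j * (n * n) + (o : ℕ) * n

/-- Each bucket owns a block of `n` consecutive cells, so the address has the digits `j`, `o`, `k`,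
of which the last two are below `n`. Writing to one bucket therefore never disturbs another. -/
theorem cell_add_inj {n : ℕ} {j j' k k' : ℤ} {o o' : Fin n} (h0 : 0 ≤ k) (h1 : k < n)
    (h0' : 0 ≤ k') (h1' : k' < n) (h : cell n j o + k = cell n j' o' + k') :
    j = j' ∧ o = o' ∧ k = k' := by
  have e : ∀ (j : ℤ) (o : Fin n), cell n j o = (j * n + (o : ℕ)) * n := fun j o => by
    unfold cell; ring
  rw [e, e] at h
  obtain ⟨h2, h3⟩ := mul_add_inj h0 h1 h0' h1' h
  obtain ⟨h4, h5⟩ := mul_add_inj (by omega) (by omega) (by omega) (by omega) h2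
  exact ⟨h4, Fin.ext (by omega), h3⟩

theorem cell_inj {n : ℕ} {j j' : ℤ} {o o' : Fin n} (h : cell n j o = cell n j' o') :
    j = j' ∧ o = o' := by
  have hn : (0 : ℤ) < n := by have := o.isLt; omega
  obtain ⟨h1, h2, -⟩ := cell_add_inj (j := j) (j' := j') (o := o) (o' := o') le_rfl hn le_rfl hn
    (by rw [h])
  exact ⟨h1, h2⟩

/-- The row-major index of the matrix entry `(u, v)`. -/
def entry {n : ℕ} (u v : Fin n) : ℤ := (u : ℕ) * n + (v : ℕ)

theorem entry_inj {n : ℕ} {u v u' v' : Fin n} : entry u v = entry u' v' ↔ u = u' ∧ v = v' := by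
  constructor
  · intro h
    obtain ⟨h1, h2⟩ := mul_add_inj (by omega) (by omega) (by omega) (by omega) h
    exact ⟨Fin.ext (by omega), Fin.ext (by omega)⟩
  · rintro ⟨rfl, rfl⟩; rfl

/-- Change one value of a function of two arguments. -/
def upd {n : ℕ} {α : Type*} (f : Fin n → Fin n → α) (u v : Fin n) (z : α) : Fin n → Fin n → α :=
  fun a b => if a = u ∧ b = v then z else f a b

/-- The elements with label `j` that belong to `o`. -/
def bucket {n : ℕ} (f : Fin n → Fin n → Option ℤ) (o : Fin n) (j : ℤ) : Finset (Fin n) :=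
  {x | f o x = some j}

theorem mem_bucket {n : ℕ} {f : Fin n → Fin n → Option ℤ} {o x : Fin n} {j : ℤ} :
    x ∈ bucket f o j ↔ f o x = some j := by simp [bucket]

/-- The arrays `cnt`, `arr`, `pos` represent the buckets of `f`. -/
structure Buckets {n : ℕ} (cnt arr pos : ℤ → ℤ) (f : Fin n → Fin n → Option ℤ) : Prop where
  card : ∀ o j, cnt (cell n j o) = (bucket f o j).card
  get : ∀ o j k, 0 ≤ k → k < cnt (cell n j o) →
    ∃ x : Fin n, arr (cell n j o + k) = (x : ℕ) ∧ f o x = some j ∧ pos (entry o x) = k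
  loc : ∀ o j x, f o x = some j → 0 ≤ pos (entry o x) ∧ pos (entry o x) < cnt (cell n j o) ∧
    arr (cell n j o + pos (entry o x)) = (x : ℕ)

theorem bucket_upd {n : ℕ} (f : Fin n → Fin n → Option ℤ) (o x o' : Fin n) (z : Option ℤ) (j : ℤ) :
    bucket (upd f o x z) o' j = if o' = o then
      (if z = some j then insert x (bucket f o j) else (bucket f o j).erase x)
      else bucket f o' j := by
  ext y
  split_ifs with h1 h2 <;> simp only [mem_bucket, upd, Finset.mem_insert, Finset.mem_erase]
  · subst h1
    by_cases h : y = x <;> simp [h, h2]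
  · subst h1
    by_cases h : y = x <;> simp [h, h2]
  · simp [h1]

namespace Buckets

variable {n : ℕ} {cnt arr pos : ℤ → ℤ} {f : Fin n → Fin n → Option ℤ}

theorem cnt_le (h : Buckets cnt arr pos f) (o : Fin n) (j : ℤ) : cnt (cell n j o) ≤ n := by
  rw [h.card]
  exact_mod_cast (Finset.card_le_univ _).trans_eq (Fintype.card_fin n)

/-- The new element is appended at the end of its block; all other entries stay in place. -/
theorem insert (h : Buckets cnt arr pos f) {o x : Fin n} {j : ℤ} (hx : f o x = none) :
    Buckets (Function.update cnt (cell n j o) (cnt (cell n j o) + 1))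
      (Function.update arr (cell n j o + cnt (cell n j o)) (x : ℕ))
      (Function.update pos (entry o x) (cnt (cell n j o))) (upd f o x (some j)) := by
  have hxb : x ∉ bucket f o j := by simp [mem_bucket, hx]
  have hc0 : ∀ o j, 0 ≤ cnt (cell n j o) := fun o j => by rw [h.card]; omega
  -- Since `x` is missing from the bucket, the block is not full and the appended cell still belongs
  -- to it.
  have hlt : cnt (cell n j o) < n := by
    rw [h.card]
    have := Finset.card_lt_univ_of_notMem hxb
    rw [Fintype.card_fin] at this
    exact_mod_cast this
  constructor
  · intro o' j'
    rw [bucket_upd, Function.update_apply]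
    by_cases ho : o' = o
    · subst ho
      by_cases hj : j' = j
      · subst hj
        simp [Finset.card_insert_of_notMem hxb, h.card]
      · rw [if_neg (fun e => hj (cell_inj e).1), h.card, if_pos rfl,
          if_neg (by simpa using fun e => hj e.symm), Finset.erase_eq_of_notMem]
        simp [mem_bucket, hx]
    · rw [if_neg (fun e => ho (cell_inj e).2), h.card, if_neg ho]
  · intro o' j' k hk hk'
    by_cases hc : o' = o ∧ j' = j ∧ k = cnt (cell n j o)
    · obtain ⟨rfl, rfl, rfl⟩ := hc
      exact ⟨x, by simp, by simp [upd], by simp⟩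
    · have hk2 : k < cnt (cell n j' o') := by
        rw [Function.update_apply] at hk'
        split_ifs at hk' with e
        · obtain ⟨rfl, rfl⟩ := cell_inj e
          have : k ≠ cnt (cell n j' o') := fun h => hc ⟨rfl, rfl, h⟩
          omega
        · exact hk'
      obtain ⟨y, h1, h2, h3⟩ := h.get o' j' k hk hk2
      have hne : ¬ (o' = o ∧ y = x) := by
        rintro ⟨rfl, rfl⟩
        simp [hx] at h2
      refine ⟨y, ?_, by simp [upd, hne, h2], ?_⟩
      · rw [Function.update_of_ne, h1]
        intro e
        obtain ⟨r1, r2, r3⟩ := cell_add_inj hk (hk2.trans_le (h.cnt_le _ _)) (hc0 _ _) hlt e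
        exact hc ⟨r2, r1, r3⟩
      · rw [Function.update_of_ne, h3]
        rwa [Ne, entry_inj]
  · intro o' j' y hy
    by_cases hc : o' = o ∧ y = x
    · obtain ⟨rfl, rfl⟩ := hc
      have : j = j' := by simpa [upd] using hy
      subst this
      simp [hc0]
    · have hy' : f o' y = some j' := by simpa [upd, hc] using hy
      obtain ⟨h1, h2, h3⟩ := h.loc o' j' y hy'
      have hp : Function.update pos (entry o x) (cnt (cell n j o)) (entry o' y) =
          pos (entry o' y) := by
        rw [Function.update_of_ne]
        rwa [Ne, entry_inj]
      rw [hp]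
      refine ⟨h1, ?_, ?_⟩
      · rw [Function.update_apply]
        split_ifs with e
        · rw [e] at h2; omega
        · exact h2
      · rw [Function.update_of_ne, h3]
        intro e
        obtain ⟨r1, r2, r3⟩ := cell_add_inj h1 (h2.trans_le (h.cnt_le _ _)) (hc0 _ _) hlt e
        subst r1 r2
        omega

/-- The last element `l` of the block fills the gap, which takes constant time because the order
inside a bucket is irrelevant. The case `l = x` is allowed. -/
theorem remove (h : Buckets cnt arr pos f) {o x : Fin n} {j : ℤ} (hx : f o x = some j) :
    ∃ l : Fin n, arr (cell n j o + (cnt (cell n j o) - 1)) = (l : ℕ) ∧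
      Buckets (Function.update cnt (cell n j o) (cnt (cell n j o) - 1))
        (Function.update arr (cell n j o + pos (entry o x)) (l : ℕ))
        (Function.update pos (entry o l) (pos (entry o x))) (upd f o x none) := by
  obtain ⟨p0, p1, p2⟩ := h.loc o j x hx
  obtain ⟨l, l1, l2, l3⟩ := h.get o j (cnt (cell n j o) - 1) (by omega) (by omega)
  refine ⟨l, l1, ?_⟩
  have hpn := h.cnt_le o j
  constructor
  · intro o' j'
    rw [bucket_upd, Function.update_apply]
    by_cases ho : o' = o
    · subst ho
      by_cases hj : j' = j
      · subst hj
        have hm : x ∈ bucket f o' j' := mem_bucket.2 hx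
        have := Finset.card_pos.2 ⟨x, hm⟩
        simp only [if_true, reduceCtorEq, if_false, Finset.card_erase_of_mem hm, h.card]
        omega
      · rw [if_neg (fun e => hj (cell_inj e).1), h.card, if_pos rfl, if_neg (by simp),
          Finset.erase_eq_of_notMem]
        rw [mem_bucket, hx]
        simpa using fun e => hj e.symm
    · rw [if_neg (fun e => ho (cell_inj e).2), h.card, if_neg ho]
  · intro o' j' k hk hk'
    have hk2 : k < cnt (cell n j' o') := by
      rw [Function.update_apply] at hk'
      split_ifs at hk' with e
      · rw [e]; omega
      · exact hk'
    by_cases hc : o' = o ∧ j' = j ∧ k = pos (entry o x)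
    · obtain ⟨rfl, rfl, rfl⟩ := hc
      refine ⟨l, by simp, ?_, by simp⟩
      -- If `x` were the last element, the gap would lie just outside of the shortened block.
      have : l ≠ x := by
        rintro rfl
        simp at hk'
        omega
      simp [upd, this, l2]
    · obtain ⟨y, h1, h2, h3⟩ := h.get o' j' k hk hk2
      have hyx : ¬ (o' = o ∧ y = x) := by
        rintro ⟨rfl, rfl⟩
        rw [hx] at h2
        exact hc ⟨rfl, by simpa using h2.symm, h3.symm⟩
      have hyl : ¬ (o' = o ∧ y = l) := by
        rintro ⟨rfl, rfl⟩
        rw [l2] at h2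
        have : j = j' := by simpa using h2
        subst this
        simp at hk'
        omega
      refine ⟨y, ?_, by simp [upd, hyx, h2], ?_⟩
      · rw [Function.update_of_ne, h1]
        intro e
        obtain ⟨r1, r2, r3⟩ := cell_add_inj hk (hk2.trans_le (h.cnt_le _ _)) p0 (by omega) e
        exact hc ⟨r2, r1, r3⟩
      · rw [Function.update_of_ne, h3]
        rwa [Ne, entry_inj]
  · intro o' j' y hy
    have hyx : ¬ (o' = o ∧ y = x) := by
      rintro ⟨rfl, rfl⟩
      simp [upd] at hy
    have hy' : f o' y = some j' := by simpa [upd, hyx] using hy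
    obtain ⟨h1, h2, h3⟩ := h.loc o' j' y hy'
    by_cases hyl : o' = o ∧ y = l
    · obtain ⟨rfl, rfl⟩ := hyl
      have : j' = j := by rw [l2] at hy'; simpa using hy'.symm
      subst this
      have hne : pos (entry o' x) ≠ pos (entry o' y) := by
        intro e
        rw [e, h3] at p2
        exact hyx ⟨rfl, Fin.ext (by omega)⟩
      simp only [Function.update_self]
      exact ⟨p0, by omega, trivial⟩
    · have hp : Function.update pos (entry o l) (pos (entry o x)) (entry o' y) =
          pos (entry o' y) := by
        rw [Function.update_of_ne]
        rwa [Ne, entry_inj]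
      rw [hp]
      refine ⟨h1, ?_, ?_⟩
      · rw [Function.update_apply]
        split_ifs with e
        · obtain ⟨rfl, rfl⟩ := cell_inj e
          have : pos (entry o' y) ≠ cnt (cell n j' o') - 1 := by
            intro e
            rw [e, l1] at h3
            exact hyl ⟨rfl, Fin.ext (by omega)⟩
          omega
        · exact h2
      · rw [Function.update_of_ne, h3]
        intro e
        obtain ⟨rfl, rfl, r3⟩ := cell_add_inj h1 (h2.trans_le (h.cnt_le _ _)) p0 (by omega) e
        rw [r3, p2] at h3
        exact hyx ⟨rfl, Fin.ext (by omega)⟩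

end Buckets

end RealRAM

/-! ### Programs for buckets and for arcs -/

namespace RealRAM

/-- `s'` agrees with `s` on the real variables, the real arrays, the integer variables below `m`
and the integer arrays outside of `A`. -/
structure Unchanged (m : ℕ) (A : Finset ℕ) (s s' : State) : Prop where
  ivar : ∀ x < m, s'.ivar x = s.ivar x
  rvar : s'.rvar = s.rvar
  rarr : s'.rarr = s.rarr
  iarr : ∀ a ∉ A, s'.iarr a = s.iarr a

theorem Unchanged.trans {m m' : ℕ} {A A' B : Finset ℕ} {s s' s'' : State}
    (h : Unchanged m A s s') (h' : Unchanged m' A' s' s'') (hA : A ⊆ B) (hA' : A' ⊆ B)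
    {k : ℕ} (hk : k ≤ m) (hk' : k ≤ m') : Unchanged k B s s'' where
  ivar x hx := (h'.ivar x (by omega)).trans (h.ivar x (by omega))
  rvar := h'.rvar.trans h.rvar
  rarr := h'.rarr.trans h.rarr
  iarr a ha := (h'.iarr a fun h => ha (hA' h)).trans (h.iarr a fun h => ha (hA h))

/-- The multiplication tables in the integer arrays 4 and 5. -/
structure Tables (n : ℕ) (L : ℤ) (s : State) : Prop where
  row : ∀ v : Fin n, s.iarr 4 (v : ℕ) = (v : ℕ) * n
  lab : ∀ j, 0 ≤ j → j ≤ L + 2 → s.iarr 5 j = j * (n * n)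

theorem Tables.unchanged {n m : ℕ} {L : ℤ} {A : Finset ℕ} {s s' : State} (h : Tables n L s)
    (hs : Unchanged m A s s') (h4 : 4 ∉ A) (h5 : 5 ∉ A) : Tables n L s' where
  row v := by rw [hs.iarr 4 h4, h.row]
  lab j := by rw [hs.iarr 5 h5]; exact h.lab j

/-- Add the element in variable 31 with the label in variable 32 to the buckets of the owner in
variable 30. -/
def bucketInsert (c : ℕ) : Prog := block [
  .iassign 33 (.add (.get 5 (.var 32)) (.get 4 (.var 30))),
  .istore (c + 1) (.add (.var 33) (.get c (.var 33))) (.var 31),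
  .istore (c + 2) (.add (.get 4 (.var 30)) (.var 31)) (.get c (.var 33)),
  .istore c (.var 33) (.add (.get c (.var 33)) (.const 1))]

/-- Remove the element in variable 31 with the label in variable 32 from the buckets of the owner
in variable 30. -/
def bucketRemove (c : ℕ) : Prog := block [
  .iassign 33 (.add (.get 5 (.var 32)) (.get 4 (.var 30))),
  .istore c (.var 33) (.sub (.get c (.var 33)) (.const 1)),
  .iassign 34 (.get (c + 2) (.add (.get 4 (.var 30)) (.var 31))),
  .iassign 35 (.get (c + 1) (.add (.var 33) (.get c (.var 33)))),
  .istore (c + 1) (.add (.var 33) (.var 34)) (.var 35),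
  .istore (c + 2) (.add (.get 4 (.var 30)) (.var 35)) (.var 34)]

/-- The arrays from 9 on hold the incoming arcs of each head, those from 12 on the outgoing arcs of
each tail. The addresses come from tables because integers cannot be multiplied. -/
theorem wp_bucketInsert {n c : ℕ} {L j : ℤ} {s : State} {o x : Fin n}
    {f : Fin n → Fin n → Option ℤ} (hc : c = 9 ∨ c = 12) (hT : Tables n L s)
    (ho : s.ivar 30 = (o : ℕ)) (hx : s.ivar 31 = (x : ℕ)) (hj : s.ivar 32 = j)
    (hj0 : 0 ≤ j) (hj1 : j ≤ L + 2) (hf : f o x = none)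
    (hB : Buckets (s.iarr c) (s.iarr (c + 1)) (s.iarr (c + 2)) f) :
    Wp (bucketInsert c) (fun s' t => t ≤ 40 ∧
      Buckets (s'.iarr c) (s'.iarr (c + 1)) (s'.iarr (c + 2)) (upd f o x (some j)) ∧
      Unchanged 33 {c, c + 1, c + 2} s s') s := by
  have h := hB.insert (j := j) hf
  have e1 := hT.row o
  have e2 := hT.lab j hj0 hj1
  rcases hc with rfl | rfl <;>
  · simp only [bucketInsert, wp_block_cons, wp_block_nil, wp_iassign, wp_istore, IExpr.eval,
      IExpr.cost, State.setIvar_ivar, State.setIvar_iarr, State.setIarr_iarr, State.setIarr_ivar]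
    refine ⟨by norm_num, ?_, ⟨?_, rfl, rfl, ?_⟩⟩
    · simpa [ho, hx, hj, e1, e2, cell, entry] using h
    · intro y hy
      simp [show y ≠ 33 by omega]
    · intro a ha
      simp only [Finset.mem_insert, Finset.mem_singleton, not_or] at ha
      simp_all

theorem wp_bucketRemove {n c : ℕ} {L j : ℤ} {s : State} {o x : Fin n}
    {f : Fin n → Fin n → Option ℤ} (hc : c = 9 ∨ c = 12) (hT : Tables n L s)
    (ho : s.ivar 30 = (o : ℕ)) (hx : s.ivar 31 = (x : ℕ)) (hj : s.ivar 32 = j)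
    (hj0 : 0 ≤ j) (hj1 : j ≤ L + 2) (hf : f o x = some j)
    (hB : Buckets (s.iarr c) (s.iarr (c + 1)) (s.iarr (c + 2)) f) :
    Wp (bucketRemove c) (fun s' t => t ≤ 50 ∧
      Buckets (s'.iarr c) (s'.iarr (c + 1)) (s'.iarr (c + 2)) (upd f o x none) ∧
      Unchanged 33 {c, c + 1, c + 2} s s') s := by
  obtain ⟨l, hl, h⟩ := hB.remove hf
  have e1 := hT.row o
  have e2 := hT.lab j hj0 hj1
  rcases hc with rfl | rfl <;>
  · simp only [bucketRemove, wp_block_cons, wp_block_nil, wp_iassign, wp_istore, IExpr.eval,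
      IExpr.cost, State.setIvar_ivar, State.setIvar_iarr, State.setIarr_iarr, State.setIarr_ivar]
    refine ⟨by norm_num, ?_, ⟨?_, rfl, rfl, ?_⟩⟩
    · simp only [cell] at hl h
      simpa [ho, hx, hj, e1, e2, hl, entry] using h
    · intro y hy
      simp [show y ≠ 33 by omega, show y ≠ 34 by omega, show y ≠ 35 by omega]
    · intro a ha
      simp only [Finset.mem_insert, Finset.mem_singleton, not_or] at ha
      simp_all

/-! ### Arcs -/

/-- The memory represents the arcs `u → v` with labels `j`, where `f u v = some j`. -/
structure Arcs {n : ℕ} (s : State) (f : Fin n → Fin n → Option ℤ) : Prop where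
  mat : ∀ u v, s.iarr 0 (entry u v) = if (f u v).isSome then 1 else 0
  lab : ∀ u v j, f u v = some j → s.iarr 8 (entry u v) = j
  ins : Buckets (s.iarr 9) (s.iarr 10) (s.iarr 11) (fun v u => f u v)
  outs : Buckets (s.iarr 12) (s.iarr 13) (s.iarr 14) f

/-- The integer arrays that represent the arcs. -/
def arcArrays : Finset ℕ := {0, 8, 9, 10, 11, 12, 13, 14}

/-- Add an arc from the vertex in variable 20 to the one in variable 21, with the label in
variable 22. -/
def addArc : Prog := block [
  .istore 0 (.add (.get 4 (.var 20)) (.var 21)) (.const 1),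
  .istore 8 (.add (.get 4 (.var 20)) (.var 21)) (.var 22),
  .iassign 30 (.var 21), .iassign 31 (.var 20), .iassign 32 (.var 22), bucketInsert 9,
  .iassign 30 (.var 20), .iassign 31 (.var 21), bucketInsert 12]

/-- Remove the arc from the vertex in variable 20 to the one in variable 21. -/
def removeArc : Prog := block [
  .istore 0 (.add (.get 4 (.var 20)) (.var 21)) (.const 0),
  .iassign 32 (.get 8 (.add (.get 4 (.var 20)) (.var 21))),
  .iassign 30 (.var 21), .iassign 31 (.var 20), bucketRemove 9,
  .iassign 30 (.var 20), .iassign 31 (.var 21), bucketRemove 12]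

/-- The buckets of incoming arcs are the buckets of the transposed label function, so an update of
the labels has to be transposed as well. -/
theorem upd_swap {n : ℕ} {α : Type*} (f : Fin n → Fin n → α) (u v : Fin n) (z : α) :
    upd (fun v u => f u v) v u z = fun v' u' => upd f u v z u' v' := by
  funext a b
  simp only [upd, and_comm]

theorem upd_upd {n : ℕ} {α : Type*} (f : Fin n → Fin n → α) (u v : Fin n) (z z' : α) :
    upd (upd f u v z) u v z' = upd f u v z' := by
  funext a b
  simp only [upd]
  split_ifs <;> rfl

theorem wp_addArc {n : ℕ} {L j : ℤ} {s : State} {u v : Fin n} {f : Fin n → Fin n → Option ℤ}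
    (hT : Tables n L s) (hu : s.ivar 20 = (u : ℕ)) (hv : s.ivar 21 = (v : ℕ))
    (hj : s.ivar 22 = j) (hj0 : 0 ≤ j) (hj1 : j ≤ L + 2) (hf : f u v = none) (hA : Arcs s f) :
    Wp addArc (fun s' t => t ≤ 120 ∧ Arcs s' (upd f u v (some j)) ∧
      Unchanged 23 arcArrays s s') s := by
  simp only [addArc, wp_block_cons, wp_block_nil, wp_iassign, wp_istore, IExpr.cost, IExpr.eval,
    State.setIvar_ivar, State.setIarr_ivar, State.setIarr_iarr]
  set s₁ := State.setIvar (State.setIvar (State.setIvar _ 30 _) 31 _) 32 _ with hs₁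
  have e1 := hT.row u
  have u1 : Unchanged 23 {0, 8} s s₁ := by
    refine ⟨fun y hy => ?_, rfl, rfl, fun a ha => ?_⟩
    · simp [hs₁, show y ≠ 30 by omega, show y ≠ 31 by omega, show y ≠ 32 by omega]
    · simp only [Finset.mem_insert, Finset.mem_singleton, not_or] at ha
      simp [hs₁, ha]
  have hT1 := hT.unchanged u1 (by decide) (by decide)
  refine (wp_bucketInsert (n := n) (o := v) (x := u) (Or.inl rfl) hT1 (by simp [hs₁, hv])
    (by simp [hs₁, hu]) (by simp [hs₁, hj] : _ = j) hj0 hj1 (by exact hf)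
    (f := fun v u => f u v) (by simpa [hs₁] using hA.ins)).mono ?_
  rintro s₂ t₂ ⟨ht₂, hb₂, u2⟩
  set s₃ := State.setIvar (State.setIvar _ 30 _) 31 _ with hs₃
  have u3 : Unchanged 23 ∅ s₂ s₃ := by
    refine ⟨fun y hy => ?_, rfl, rfl, fun a ha => ?_⟩
    · simp [hs₃, show y ≠ 30 by omega, show y ≠ 31 by omega]
    · simp [hs₃]
  have u13 : Unchanged 23 {0, 8, 9, 10, 11} s s₃ :=
    (u1.trans u2 (B := {0, 8, 9, 10, 11}) (by decide) (by decide) (k := 23) le_rfl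
      (by norm_num)).trans u3 (by decide) (by decide) le_rfl le_rfl
  have hT3 := hT.unchanged u13 (by decide) (by decide)
  refine (wp_bucketInsert (n := n) (o := u) (x := v) (Or.inr rfl) hT3
    (by simp [hs₃, u2.ivar, hs₁, hu])
    (by simp [hs₃, u2.ivar, hs₁, hv])
    (by simp [hs₃, u2.ivar, hs₁, hj] : _ = j) hj0 hj1 hf
    (by simpa [u13.iarr] using hA.outs)).mono ?_
  rintro s₄ t₄ ⟨ht₄, hb₄, u4⟩
  have e : ∀ a b, entry a b = entry u v ↔ a = u ∧ b = v := fun a b => entry_inj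
  have ee : ((u : ℕ) * n + (v : ℕ) : ℤ) = entry u v := rfl
  refine ⟨by omega, ⟨?_, ?_, ?_, hb₄⟩, u13.trans u4 (by decide) (by decide) le_rfl
    (by norm_num)⟩
  · intro a b
    have := hA.mat a b
    simp only [u4.iarr 0 (by decide), hs₃, State.setIvar_iarr, u2.iarr 0 (by decide), hs₁]
    simp [hu, hv, e1, upd, Function.update_apply, ee, e]
    split_ifs <;> simp_all
  · intro a b k hk
    have := hA.lab a b k
    simp only [u4.iarr 8 (by decide), hs₃, State.setIvar_iarr, u2.iarr 8 (by decide), hs₁]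
    simp only [upd] at hk
    simp [hu, hv, e1, Function.update_apply, ee, e, hj]
    split_ifs at hk ⊢ <;> simp_all
  · rw [upd_swap] at hb₂
    simpa [u4.iarr, hs₃] using hb₂

theorem wp_removeArc {n : ℕ} {L j : ℤ} {s : State} {u v : Fin n} {f : Fin n → Fin n → Option ℤ}
    (hT : Tables n L s) (hu : s.ivar 20 = (u : ℕ)) (hv : s.ivar 21 = (v : ℕ))
    (hj0 : 0 ≤ j) (hj1 : j ≤ L + 2) (hf : f u v = some j) (hA : Arcs s f) :
    Wp removeArc (fun s' t => t ≤ 140 ∧ Arcs s' (upd f u v none) ∧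
      Unchanged 23 arcArrays s s') s := by
  simp only [removeArc, wp_block_cons, wp_block_nil, wp_iassign, wp_istore, IExpr.cost, IExpr.eval,
    State.setIvar_ivar, State.setIarr_ivar, State.setIarr_iarr]
  set s₁ := State.setIvar (State.setIvar (State.setIvar _ 32 _) 30 _) 31 _ with hs₁
  have e1 := hT.row u
  have u1 : Unchanged 23 {0} s s₁ := by
    refine ⟨fun y hy => ?_, rfl, rfl, fun a ha => ?_⟩
    · simp [hs₁, show y ≠ 30 by omega, show y ≠ 31 by omega, show y ≠ 32 by omega]
    · simp only [Finset.mem_singleton] at ha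
      simp [hs₁, ha]
  have hT1 := hT.unchanged u1 (by decide) (by decide)
  have ee : ((u : ℕ) * n + (v : ℕ) : ℤ) = entry u v := rfl
  have hj1' : s₁.ivar 32 = j := by
    simp [hs₁, hu, hv, e1, ee, hA.lab u v j hf]
  refine (wp_bucketRemove (n := n) (o := v) (x := u) (Or.inl rfl) hT1
    (by simp [hs₁, hv])
    (by simp [hs₁, hu]) hj1' hj0 hj1 (by exact hf)
    (f := fun v u => f u v) (by simpa [hs₁] using hA.ins)).mono ?_
  rintro s₂ t₂ ⟨ht₂, hb₂, u2⟩
  set s₃ := State.setIvar (State.setIvar _ 30 _) 31 _ with hs₃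
  have u3 : Unchanged 23 ∅ s₂ s₃ := by
    refine ⟨fun y hy => ?_, rfl, rfl, fun a ha => ?_⟩
    · simp [hs₃, show y ≠ 30 by omega, show y ≠ 31 by omega]
    · simp [hs₃]
  have u13 : Unchanged 23 {0, 9, 10, 11} s s₃ :=
    (u1.trans u2 (B := {0, 9, 10, 11}) (by decide) (by decide) (k := 23) le_rfl
      (by norm_num)).trans u3 (by decide) (by decide) le_rfl le_rfl
  have hT3 := hT.unchanged u13 (by decide) (by decide)
  refine (wp_bucketRemove (n := n) (o := u) (x := v) (Or.inr rfl) hT3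
    (by simp [hs₃, u2.ivar, hs₁, hu])
    (by simp [hs₃, u2.ivar, hs₁, hv])
    (by simpa [hs₃, u2.ivar, IExpr.eval] using hj1' : _ = j) hj0 hj1 hf
    (by simpa [u13.iarr] using hA.outs)).mono ?_
  rintro s₄ t₄ ⟨ht₄, hb₄, u4⟩
  have e : ∀ a b, entry a b = entry u v ↔ a = u ∧ b = v := fun a b => entry_inj
  refine ⟨by omega, ⟨?_, ?_, ?_, hb₄⟩, u13.trans u4 (by decide) (by decide) le_rfl
    (by norm_num)⟩
  · intro a b
    have := hA.mat a b
    simp only [u4.iarr 0 (by decide), hs₃, State.setIvar_iarr, u2.iarr 0 (by decide), hs₁]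
    simp [hu, hv, e1, upd, Function.update_apply, ee, e]
    split_ifs <;> simp_all
  · intro a b k hk
    have := hA.lab a b k
    rw [u4.iarr 8 (by decide), u13.iarr 8 (by decide)]
    simp only [upd] at hk
    split_ifs at hk
    exact this hk
  · rw [upd_swap] at hb₂
    simpa [u4.iarr, hs₃] using hb₂

/-! ### Vertices sorted by level -/

/-- The arrays `ord` and `pos` are mutually inverse. -/
structure Inverse (n : ℕ) (ord pos : ℤ → ℤ) : Prop where
  nonneg : ∀ v : Fin n, 0 ≤ pos (v : ℕ)
  lt : ∀ v : Fin n, pos (v : ℕ) < n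
  ord_pos : ∀ v : Fin n, ord (pos (v : ℕ)) = (v : ℕ)
  surj : ∀ p : ℤ, 0 ≤ p → p < n → ∃ v : Fin n, pos (v : ℕ) = p

/-- Exchanging two vertices composes the position map with a transposition, so everything follows
from the old permutation. The two vertices may coincide. -/
theorem Inverse.swap {n : ℕ} {ord pos : ℤ → ℤ} (h : Inverse n ord pos) (v x : Fin n) :
    Inverse n
      (Function.update (Function.update ord (pos (v : ℕ)) (x : ℕ)) (pos (x : ℕ)) (v : ℕ))
      (Function.update (Function.update pos (x : ℕ) (pos (v : ℕ))) (v : ℕ) (pos (x : ℕ))) ∧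
    ∀ u : Fin n, Function.update (Function.update pos (x : ℕ) (pos (v : ℕ))) (v : ℕ)
      (pos (x : ℕ)) (u : ℕ) = pos ((Equiv.swap v x u : Fin n) : ℕ) := by
  have hinj : ∀ a b : Fin n, pos (a : ℕ) = pos (b : ℕ) → a = b := fun a b e => by
    have := h.ord_pos a
    rw [e, h.ord_pos b] at this
    exact Fin.ext (by omega)
  have key : ∀ u : Fin n, Function.update (Function.update pos (x : ℕ) (pos (v : ℕ))) (v : ℕ)
      (pos (x : ℕ)) (u : ℕ) = pos ((Equiv.swap v x u : Fin n) : ℕ) := by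
    intro u
    simp only [Function.update_apply, Equiv.swap_apply_def, Nat.cast_inj, Fin.val_inj]
    split_ifs <;> rfl
  refine ⟨⟨fun u => ?_, fun u => ?_, fun u => ?_, fun p hp hp' => ?_⟩, key⟩
  · rw [key]; exact h.nonneg _
  · rw [key]; exact h.lt _
  · rw [key]
    simp only [Function.update_apply]
    by_cases h1 : u = v
    · subst h1; simp
    · by_cases h2 : u = x
      · subst h2
        have h3 : pos (v : ℕ) ≠ pos (u : ℕ) := fun e => h1 (hinj _ _ e.symm)
        simp [h3]
      · rw [Equiv.swap_apply_of_ne_of_ne h1 h2, if_neg fun e => h2 (hinj _ _ e),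
          if_neg fun e => h1 (hinj _ _ e), h.ord_pos]
  · obtain ⟨u, hu⟩ := h.surj p hp hp'
    exact ⟨Equiv.swap v x u, by rw [key]; simpa using hu⟩

/-- The vertices are sorted by their levels: the first `bnd i` of them are those of level at least
`i`, and `ws i` is their total weight. -/
structure SortedBy {n : ℕ} (w : Fin n → ℝ) (lev : Fin n → ℤ) (ord pos bnd : ℤ → ℤ)
    (ws : ℤ → ℝ) : Prop where
  inv : Inverse n ord pos
  bnd_eq : ∀ i, 0 ≤ i → bnd i = ({v | i ≤ lev v} : Finset (Fin n)).card
  below : ∀ v : Fin n, ∀ i, 0 ≤ i → (pos (v : ℕ) < bnd i ↔ i ≤ lev v)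
  ws_eq : ∀ i, 0 ≤ i → ws i = ∑ v with i ≤ lev v, w v

/-- The memory represents the levels of the vertices and the vertices sorted by level. -/
structure Sorted {n : ℕ} (w : Fin n → ℝ) (lev : Fin n → ℤ) (s : State) : Prop where
  by_lev : SortedBy w lev (s.iarr 1) (s.iarr 2) (s.iarr 3) (s.rarr 2)
  lev : ∀ v : Fin n, s.iarr 7 (v : ℕ) = lev v

/-- Move the vertex in variable 10 to the position in variable 31 of the sorted list. -/
def moveTo : List Prog := [
  .iassign 32 (.get 2 (.var 10)), .iassign 33 (.get 1 (.var 31)),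
  .istore 1 (.var 32) (.var 33), .istore 2 (.var 33) (.var 32),
  .istore 1 (.var 31) (.var 10), .istore 2 (.var 10) (.var 31)]

/-- Raise the level of the vertex in variable 10 by one. -/
def levelUp : Prog := block ([
  .iassign 30 (.add (.get 7 (.var 10)) (.const 1)), .iassign 31 (.get 3 (.var 30))] ++ moveTo ++ [
  .istore 3 (.var 30) (.add (.var 31) (.const 1)),
  .rstore 2 (.var 30) (.add (.get 2 (.var 30)) (.get 0 (.var 10))),
  .istore 7 (.var 10) (.var 30)])

/-- Lower the level of the vertex in variable 10 by one. -/
def levelDown : Prog := block ([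
  .iassign 30 (.get 7 (.var 10)), .iassign 31 (.sub (.get 3 (.var 30)) (.const 1))] ++ moveTo ++ [
  .istore 3 (.var 30) (.var 31),
  .rstore 2 (.var 30) (.sub (.get 2 (.var 30)) (.get 0 (.var 10))),
  .istore 7 (.var 10) (.sub (.var 30) (.const 1))])

/-- `s'` agrees with `s` outside of the representation of the levels. -/
structure LevelStep (s s' : State) : Prop where
  ivar : ∀ x < 20, s'.ivar x = s.ivar x
  rvar : s'.rvar = s.rvar
  rarr : ∀ a ≠ 2, s'.rarr a = s.rarr a
  iarr : ∀ a ∉ ({1, 2, 3, 7} : Finset ℕ), s'.iarr a = s.iarr a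

/-- Only one of the sets `{v | i ≤ lev v}` changes when one vertex moves by one level; this is why
the sorted list is updated in constant time. -/
theorem levelSet_up {n : ℕ} (lev : Fin n → ℤ) (y : Fin n) (i : ℤ) :
    ({v | i ≤ Function.update lev y (lev y + 1) v} : Finset (Fin n)) =
      if i = lev y + 1 then insert y ({v | i ≤ lev v} : Finset (Fin n)) else
        ({v | i ≤ lev v} : Finset (Fin n)) := by
  ext v
  split_ifs with h <;> by_cases hv : v = y <;> simp [hv, Function.update_apply] <;> omega

theorem levelSet_down {n : ℕ} (lev : Fin n → ℤ) (y : Fin n) (i : ℤ) :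
    ({v | i ≤ Function.update lev y (lev y - 1) v} : Finset (Fin n)) =
      if i = lev y then ({v | i ≤ lev v} : Finset (Fin n)).erase y else
        ({v | i ≤ lev v} : Finset (Fin n)) := by
  ext v
  split_ifs with h <;> by_cases hv : v = y <;> simp [hv, Function.update_apply] <;> omega

theorem SortedBy.bnd_anti {n : ℕ} {w : Fin n → ℝ} {lev : Fin n → ℤ} {ord pos bnd : ℤ → ℤ}
    {ws : ℤ → ℝ} (h : SortedBy w lev ord pos bnd ws) {i j : ℤ} (hi : 0 ≤ i) (hij : i ≤ j) :
    bnd j ≤ bnd i := by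
  rw [h.bnd_eq i hi, h.bnd_eq j (hi.trans hij)]
  exact_mod_cast Finset.card_le_card fun a ha => by
    simp only [Finset.mem_filter, Finset.mem_univ, true_and] at ha ⊢
    omega

theorem Inverse.injective {n : ℕ} {ord pos : ℤ → ℤ} (h : Inverse n ord pos) {a b : Fin n}
    (e : pos (a : ℕ) = pos (b : ℕ)) : a = b := by
  have := h.ord_pos a
  rw [e, h.ord_pos b] at this
  exact Fin.ext (by omega)

/-- The vertex `y` changes places with the first vertex behind the block of level at least `lev y +
1`, and then the end of this block advances by one. No other block changes as a set. -/
theorem SortedBy.up {n : ℕ} {w : Fin n → ℝ} {lev : Fin n → ℤ} {ord pos bnd : ℤ → ℤ}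
    {ws : ℤ → ℝ} (h : SortedBy w lev ord pos bnd ws) (y : Fin n) (hl : 0 ≤ lev y) :
    SortedBy w (Function.update lev y (lev y + 1))
      (Function.update (Function.update ord (pos (y : ℕ)) (ord (bnd (lev y + 1))))
        (bnd (lev y + 1)) (y : ℕ))
      (Function.update (Function.update pos (ord (bnd (lev y + 1))) (pos (y : ℕ))) (y : ℕ)
        (bnd (lev y + 1)))
      (Function.update bnd (lev y + 1) (bnd (lev y + 1) + 1))
      (Function.update ws (lev y + 1) (ws (lev y + 1) + w y)) := by
  have hb := h.below y (lev y + 1) (by omega)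
  have hb0 := h.bnd_eq (lev y + 1) (by omega)
  have hb1 := h.inv.lt y
  -- Such a position exists because `y` itself lies at or behind the end of the block.
  obtain ⟨x, hx⟩ : ∃ x : Fin n, pos (x : ℕ) = bnd (lev y + 1) :=
    h.inv.surj (bnd (lev y + 1)) (by omega) (by omega)
  obtain ⟨hi, hp⟩ := h.inv.swap y x
  have hox := h.inv.ord_pos x
  have hxl := h.below x (lev y + 1) (by omega)
  rw [hx] at hox hxl hi hp
  rw [hox]
  refine ⟨hi, fun i hi0 => ?_, fun v i hi0 => ?_, fun i hi0 => ?_⟩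
  · rw [levelSet_up, Function.update_apply]
    split_ifs with e
    · rw [Finset.card_insert_of_notMem (by simp [e]), Nat.cast_succ, ← h.bnd_eq i hi0, e]
    · exact h.bnd_eq i hi0
  · rw [hp]
    have hv1 := h.below (Equiv.swap y x v) i hi0
    have hyi := h.below y i hi0
    have up := fun h2 : i ≤ lev y + 1 => h.bnd_anti hi0 h2
    have down := fun h2 : lev y + 1 ≤ i => h.bnd_anti (by omega) h2
    by_cases h1 : v = y
    · subst h1
      rw [Equiv.swap_apply_left, hx, Function.update_self, Function.update_apply]
      split_ifs with e <;> omega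
    · rw [Function.update_of_ne h1, Function.update_apply]
      by_cases h2 : v = x
      · subst h2
        rw [Equiv.swap_apply_right]
        have hxi := h.below v i hi0
        have hne : pos (y : ℕ) ≠ bnd (lev y + 1) := fun e =>
          h1 (h.inv.injective (hx.trans e.symm))
        split_ifs with e
        · subst e; omega
        · omega
      · rw [Equiv.swap_apply_of_ne_of_ne h1 h2] at hv1 ⊢
        have hne : pos (v : ℕ) ≠ bnd (lev y + 1) := fun e =>
          h2 (h.inv.injective (e.trans hx.symm))
        split_ifs with e
        · subst e; omega
        · exact hv1
  · rw [levelSet_up, Function.update_apply]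
    split_ifs with e
    · rw [Finset.sum_insert (by simp [e]), ← h.ws_eq i hi0, e, add_comm]
    · exact h.ws_eq i hi0

/-- The mirror image: `y` changes places with the last vertex of the block of level at least `lev
y`, and the block loses its last position. -/
theorem SortedBy.down {n : ℕ} {w : Fin n → ℝ} {lev : Fin n → ℤ} {ord pos bnd : ℤ → ℤ}
    {ws : ℤ → ℝ} (h : SortedBy w lev ord pos bnd ws) (y : Fin n) (hl : 0 ≤ lev y) :
    SortedBy w (Function.update lev y (lev y - 1))
      (Function.update (Function.update ord (pos (y : ℕ)) (ord (bnd (lev y) - 1)))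
        (bnd (lev y) - 1) (y : ℕ))
      (Function.update (Function.update pos (ord (bnd (lev y) - 1)) (pos (y : ℕ))) (y : ℕ)
        (bnd (lev y) - 1))
      (Function.update bnd (lev y) (bnd (lev y) - 1))
      (Function.update ws (lev y) (ws (lev y) - w y)) := by
  have hb := h.below y (lev y) hl
  have hb0 := h.inv.nonneg y
  have hb1 : bnd (lev y) ≤ n := by
    rw [h.bnd_eq _ hl]
    exact_mod_cast (Finset.card_le_univ _).trans_eq (Fintype.card_fin n)
  obtain ⟨x, hx⟩ : ∃ x : Fin n, pos (x : ℕ) = bnd (lev y) - 1 :=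
    h.inv.surj (bnd (lev y) - 1) (by omega) (by omega)
  obtain ⟨hi, hp⟩ := h.inv.swap y x
  have hox := h.inv.ord_pos x
  have hxl := h.below x (lev y) hl
  rw [hx] at hox hxl hi hp
  rw [hox]
  refine ⟨hi, fun i hi0 => ?_, fun v i hi0 => ?_, fun i hi0 => ?_⟩
  · rw [levelSet_down, Function.update_apply]
    split_ifs with e
    · have hm : y ∈ ({v | i ≤ lev v} : Finset (Fin n)) := by simp [e]
      rw [Finset.card_erase_of_mem hm, Nat.cast_pred (Finset.card_pos.2 ⟨y, hm⟩), ← h.bnd_eq i hi0, e]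
    · exact h.bnd_eq i hi0
  · rw [hp]
    have hv1 := h.below (Equiv.swap y x v) i hi0
    have hyi := h.below y i hi0
    have up := fun h2 : i ≤ lev y => h.bnd_anti hi0 h2
    have down := fun h2 : lev y ≤ i => h.bnd_anti hl h2
    by_cases h1 : v = y
    · subst h1
      rw [Equiv.swap_apply_left, hx, Function.update_self, Function.update_apply]
      split_ifs with e <;> omega
    · rw [Function.update_of_ne h1, Function.update_apply]
      by_cases h2 : v = x
      · subst h2
        rw [Equiv.swap_apply_right]
        have hxi := h.below v i hi0
        have hne : pos (y : ℕ) ≠ bnd (lev y) - 1 := fun e =>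
          h1 (h.inv.injective (hx.trans e.symm))
        split_ifs with e
        · subst e; omega
        · omega
      · rw [Equiv.swap_apply_of_ne_of_ne h1 h2] at hv1 ⊢
        have hne : pos (v : ℕ) ≠ bnd (lev y) - 1 := fun e =>
          h2 (h.inv.injective (e.trans hx.symm))
        split_ifs with e
        · subst e; omega
        · exact hv1
  · rw [levelSet_down, Function.update_apply]
    split_ifs with e
    · rw [Finset.sum_erase_eq_sub (by simp [e]), ← h.ws_eq i hi0, e]
    · exact h.ws_eq i hi0

theorem wp_levelUp {n : ℕ} {w : Fin n → ℝ} {lev : Fin n → ℤ} {s : State} {y : Fin n}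
    (hy : s.ivar 10 = (y : ℕ)) (hw : ∀ v : Fin n, s.rarr 0 (v : ℕ) = w v) (h : Sorted w lev s)
    (hl : 0 ≤ lev y) :
    Wp levelUp (fun s' t => t ≤ 60 ∧ Sorted w (Function.update lev y (lev y + 1)) s' ∧
      LevelStep s s') s := by
  have hS := h.by_lev.up y hl
  simp only [levelUp, moveTo, List.cons_append, List.nil_append, wp_block_cons, wp_block_nil,
    wp_iassign, wp_istore, wp_rstore, IExpr.eval, RExpr.eval, IExpr.cost, RExpr.cost]
  refine ⟨by norm_num, ⟨?_, ?_⟩, ⟨?_, rfl, ?_, ?_⟩⟩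
  · simpa [hy, h.lev, hw] using hS
  · intro v
    by_cases e : v = y
    · simp [hy, h.lev, e]
    · simp [hy, h.lev, e, Fin.val_inj]
  · intro a ha
    simp [show a ≠ 30 by omega, show a ≠ 31 by omega, show a ≠ 32 by omega, show a ≠ 33 by omega]
  · intro a ha
    simp [ha]
  · intro a ha
    simp only [Finset.mem_insert, Finset.mem_singleton, not_or] at ha
    simp [ha]

theorem wp_levelDown {n : ℕ} {w : Fin n → ℝ} {lev : Fin n → ℤ} {s : State} {y : Fin n}
    (hy : s.ivar 10 = (y : ℕ)) (hw : ∀ v : Fin n, s.rarr 0 (v : ℕ) = w v) (h : Sorted w lev s)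
    (hl : 0 ≤ lev y) :
    Wp levelDown (fun s' t => t ≤ 60 ∧ Sorted w (Function.update lev y (lev y - 1)) s' ∧
      LevelStep s s') s := by
  have hS := h.by_lev.down y hl
  simp only [levelDown, moveTo, List.cons_append, List.nil_append, wp_block_cons, wp_block_nil,
    wp_iassign, wp_istore, wp_rstore, IExpr.eval, RExpr.eval, IExpr.cost, RExpr.cost]
  refine ⟨by norm_num, ⟨?_, ?_⟩, ⟨?_, rfl, ?_, ?_⟩⟩
  · simpa [hy, h.lev, hw] using hS
  · intro v
    by_cases e : v = y
    · simp [hy, h.lev, e]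
    · simp [hy, h.lev, e, Fin.val_inj]
  · intro a ha
    simp [show a ≠ 30 by omega, show a ≠ 31 by omega, show a ≠ 32 by omega, show a ≠ 33 by omega]
  · intro a ha
    simp [ha]
  · intro a ha
    simp only [Finset.mem_insert, Finset.mem_singleton, not_or] at ha
    simp [ha]

end RealRAM

/-! ### Thresholds -/

/-- The load thresholds between the levels, as a function of the number of levels above the
lowest one. -/
noncomputable def thresholdNat (η : ℝ) : ℕ → ℝ
  | 0 => 0
  | k + 1 => (1 + η) * thresholdNat η k + 2

/-- The load threshold of level `i`; the lowest level is 5. -/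
noncomputable def threshold (η : ℝ) (i : ℤ) : ℝ := thresholdNat η (i - 5).toNat

theorem thresholdNat_nonneg {η : ℝ} (hη : 0 ≤ η) (k : ℕ) : 0 ≤ thresholdNat η k := by
  induction k with
  | zero => simp [thresholdNat]
  | succ k ih => rw [thresholdNat]; positivity

theorem threshold_nonneg {η : ℝ} (hη : 0 ≤ η) (i : ℤ) : 0 ≤ threshold η i :=
  thresholdNat_nonneg hη _

theorem threshold_succ {η : ℝ} {i : ℤ} (hi : 5 ≤ i) :
    threshold η (i + 1) = (1 + η) * threshold η i + 2 := by
  rw [threshold, show (i + 1 - 5).toNat = (i - 5).toNat + 1 by omega, thresholdNat, threshold]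

theorem threshold_of_le {η : ℝ} {i : ℤ} (hi : i ≤ 5) : threshold η i = 0 := by
  rw [threshold, show (i - 5).toNat = 0 by omega, thresholdNat]

theorem threshold_mono {η : ℝ} (hη : 0 ≤ η) : Monotone (threshold η) := by
  have h : Monotone (thresholdNat η) := monotone_nat_of_le_succ fun k => by
    rw [thresholdNat]
    nlinarith [thresholdNat_nonneg hη k]
  intro i j hij
  exact h (by omega)

theorem threshold_ge_succ {η : ℝ} (hη : 0 ≤ η) (i : ℤ) :
    (1 - η) * threshold η (i + 1) - 2 ≤ threshold η i := by
  rcases le_or_gt 5 i with hi | hi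
  · rw [threshold_succ hi]
    nlinarith [threshold_nonneg hη i, mul_nonneg (mul_nonneg hη hη) (threshold_nonneg hη i)]
  · rw [threshold_of_le (by omega : i + 1 ≤ 5), threshold_of_le hi.le]
    norm_num

/-- A descent by `N` levels costs a factor `1 - N * η` and an additive `2 * N` only. This turns the
few levels between the cut and the top into a small error; the cross term in the induction is
handled by monotonicity. -/
theorem threshold_ge_add {η : ℝ} (hη : 0 ≤ η) (i : ℤ) (N : ℕ) :
    (1 - N * η) * threshold η (i + N) - 2 * N ≤ threshold η i := by
  induction N with
  | zero => simp
  | succ N ih =>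
    have h1 := threshold_ge_succ hη (i + N)
    have h2 := threshold_nonneg hη (i + N)
    have h3 := threshold_nonneg hη (i + N + 1)
    have h4 := threshold_mono hη (show i + N ≤ i + N + 1 by omega)
    push_cast
    rw [← add_assoc]
    have h5 : (0 : ℝ) ≤ N * η := by positivity
    have h6 := mul_le_mul_of_nonneg_left h4 h5
    nlinarith

/-! ### The abstract state of the algorithm -/

/-- The parameters of the algorithm: the vertex weights, `ε`, the growth rate `η` of the load
thresholds, the number `K` of arcs that are relabelled when an in-degree changes, and a bound `L`
on the levels. -/
structure Parameters (n : ℕ) where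
  w : Fin n → ℝ
  eps : ℝ
  eta : ℝ
  K : ℤ
  L : ℤ
  one_le_w : ∀ v, 1 ≤ w v
  eta_pos : 0 < eta
  eta_le : eta ≤ 1
  le_K : 2 ≤ K * eta
  lt_L : n + 1 < threshold eta L

namespace Parameters

variable {n : ℕ} (P : Parameters n)

theorem two_le_K : (2 : ℝ) ≤ P.K := by
  have := P.le_K
  have h1 := P.eta_le
  have h2 := P.eta_pos
  by_contra! h
  nlinarith

/-- The smallest in-degree that the level `i` of the vertex `v` allows. -/
noncomputable def low (v : Fin n) (i : ℤ) : ℝ := threshold P.eta i * P.w v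

theorem low_nonneg (v : Fin n) (i : ℤ) : 0 ≤ P.low v i :=
  mul_nonneg (threshold_nonneg P.eta_pos.le i) (zero_le_one.trans (P.one_le_w v))

theorem low_succ (v : Fin n) {i : ℤ} (hi : 5 ≤ i) :
    P.low v (i + 1) = (1 + P.eta) * P.low v i + 2 * P.w v := by
  rw [low, threshold_succ hi, low]; ring

/-- The in-degrees of one level span `η * low + 2 * w`. Because `K * η ≥ 2`, refreshing `K` arcs per
unit of in-degree handles twice the in-degree while a level is crossed. The additive 2 in the
thresholds keeps the span above one even where `low` vanishes. -/
theorem mul_low_succ_sub (v : Fin n) {i : ℤ} (hi : 5 ≤ i) :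
    2 * P.low v i + 4 * P.w v - 2 ≤ P.K * (P.low v (i + 1) - P.low v i - 1) := by
  have h0 := P.low_nonneg v i
  have h5 := P.one_le_w v
  have e : P.K * (P.low v (i + 1) - P.low v i - 1) =
      P.K * P.eta * P.low v i + P.K * (2 * P.w v - 1) := by rw [P.low_succ v hi]; ring
  rw [e]
  nlinarith [mul_le_mul_of_nonneg_right P.le_K h0,
    mul_le_mul_of_nonneg_right P.two_le_K (by linarith : 0 ≤ 2 * P.w v - 1)]

theorem low_add_one_le (v : Fin n) {i : ℤ} (hi : 5 ≤ i) :
    P.low v i + 1 ≤ P.K * (P.low v (i + 1) - P.low v i - 1) := by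
  linarith [P.mul_low_succ_sub v hi, P.one_le_w v, P.low_nonneg v i]

theorem low_succ_le (v : Fin n) {i : ℤ} (hi : 5 ≤ i) :
    P.low v (i + 1) ≤ P.K * (P.low v (i + 1) - P.low v i - 1) := by
  have h := P.low_succ v hi
  nlinarith [P.mul_low_succ_sub v hi, P.one_le_w v,
    mul_le_mul_of_nonneg_right P.eta_le (P.low_nonneg v i)]

/-- The threshold of `L` exceeds `n + 1` and weights are at least 1, so no attainable in-degree
reaches the level `L`. -/
theorem lt_L_of_low_le {v : Fin n} {i : ℤ} {d : ℝ} (h : P.low v i ≤ d) (hd : d ≤ n + 1) :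
    i < P.L := by
  by_contra! hL
  have h1 := threshold_mono P.eta_pos.le hL
  have h2 := P.lt_L
  have h3 := P.one_le_w v
  have h4 := threshold_nonneg P.eta_pos.le i
  unfold low at h
  nlinarith

end Parameters

/-! ### Labels of arcs and the invariant -/

open RealRAM

/-- The tails of the arcs into `v` with label `j`. -/
def inBucket {n : ℕ} (f : Fin n → Fin n → Option ℤ) (v : Fin n) (j : ℤ) : Finset (Fin n) :=
  {u | f u v = some j}

theorem mem_inBucket {n : ℕ} {f : Fin n → Fin n → Option ℤ} {u v : Fin n} {j : ℤ} :
    u ∈ inBucket f v j ↔ f u v = some j := by simp [inBucket]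

/-- The labels of the arcs, the in-degrees and the levels fit together, where the true in-degree
of `v` is `deg v + pend v`. -/
structure Consistent {n : ℕ} (P : Parameters n) (f : Fin n → Fin n → Option ℤ) (deg lev pend : Fin n → ℤ) :
    Prop where
  label_le : ∀ u v j, f u v = some j → j ≤ lev u + 2
  le_label : ∀ u v j, f u v = some j → lev v - 1 ≤ j
  label_le' : ∀ u v j, f u v = some j → j ≤ lev v + 1
  five_le : ∀ v, 5 ≤ lev v
  lt_L : ∀ v, lev v < P.L
  low_le : ∀ v, P.low v (lev v) ≤ deg v
  lt_low : ∀ v, deg v < P.low v (lev v + 1)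
  card : ∀ v, (({u | f u v ≠ none} : Finset (Fin n)).card : ℤ) = deg v + pend v
  old_low : ∀ v, ((inBucket f v (lev v - 1)).card : ℝ) ≤
    P.K * (P.low v (lev v + 1) - deg v)
  old_high : ∀ v, ((inBucket f v (lev v + 1)).card : ℝ) ≤
    P.K * (deg v - P.low v (lev v))

/-- The sum of the labels of all arcs. -/
def labelSum {n : ℕ} (f : Fin n → Fin n → Option ℤ) : ℤ := ∑ v, ∑ u, (f u v).getD 0

theorem labelSum_upd {n : ℕ} (f : Fin n → Fin n → Option ℤ) (a b : Fin n) (z : Option ℤ) :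
    labelSum (upd f a b z) = labelSum f - (f a b).getD 0 + z.getD 0 := by
  unfold labelSum
  rw [← Finset.add_sum_erase _ _ (Finset.mem_univ b),
    ← Finset.add_sum_erase _ (fun v => ∑ u, (f u v).getD 0) (Finset.mem_univ b),
    ← Finset.add_sum_erase _ _ (Finset.mem_univ a),
    ← Finset.add_sum_erase _ (fun u => (f u b).getD 0) (Finset.mem_univ a)]
  have h1 : ∑ u ∈ Finset.univ.erase a, (upd f a b z u b).getD 0 =
      ∑ u ∈ Finset.univ.erase a, (f u b).getD 0 := Finset.sum_congr rfl fun u hu => by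
    simp [upd, Finset.ne_of_mem_erase hu]
  have h2 : ∑ v ∈ Finset.univ.erase b, ∑ u, (upd f a b z u v).getD 0 =
      ∑ v ∈ Finset.univ.erase b, ∑ u, (f u v).getD 0 := Finset.sum_congr rfl fun v hv => by
    simp [upd, Finset.ne_of_mem_erase hv]
  rw [h1, h2]
  simp [upd]
  ring

/-! ### Preservation of the invariant -/

namespace Consistent

variable {n : ℕ} {P : Parameters n} {f : Fin n → Fin n → Option ℤ} {deg lev pend : Fin n → ℤ}

/-- In-degree and level of `b` are deliberately left alone and the discrepancy is recorded in
`pend`, so that it can travel to another vertex before it is settled. -/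
theorem remove (h : Consistent P f deg lev pend) {a b : Fin n} {j : ℤ} (hab : f a b = some j) :
    Consistent P (upd f a b none) deg lev (pend - Pi.single b 1) := by
  have key : ∀ u v j, upd f a b none u v = some j → f u v = some j := fun u v j e => by
    simp only [upd] at e
    split_ifs at e
    exact e
  have sub : ∀ v j, inBucket (upd f a b none) v j ⊆ inBucket f v j :=
    fun v j u hu => mem_inBucket.2 (key _ _ _ (mem_inBucket.1 hu))
  refine ⟨fun u v j e => h.label_le u v j (key _ _ _ e), fun u v j e => h.le_label u v j
    (key _ _ _ e), fun u v j e => h.label_le' u v j (key _ _ _ e), h.five_le, h.lt_L, h.low_le,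
    h.lt_low, fun v => ?_, fun v => le_trans ?_ (h.old_low v),
    fun v => le_trans ?_ (h.old_high v)⟩
  · have hc := h.card v
    by_cases hv : v = b
    · subst hv
      have e : ({u | upd f a v none u v ≠ none} : Finset (Fin n)) =
          ({u | f u v ≠ none} : Finset (Fin n)).erase a := by
        ext u
        by_cases hu : u = a <;> simp [upd, hu]
      have hm : a ∈ ({u | f u v ≠ none} : Finset (Fin n)) := by simp [hab]
      rw [e, Finset.card_erase_of_mem hm, Nat.cast_pred (Finset.card_pos.2 ⟨a, hm⟩), hc]
      simp
      ring
    · simpa [upd, hv] using hc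
  · exact_mod_cast Finset.card_le_card (sub _ _)
  · exact_mod_cast Finset.card_le_card (sub _ _)

/-- A fresh arc carries the exact level of its head, hence it enters neither of the two buckets
whose sizes are bounded. -/
theorem add (h : Consistent P f deg lev pend) {a b : Fin n} (hab : f a b = none)
    (hl : lev b ≤ lev a + 2) :
    Consistent P (upd f a b (some (lev b))) deg lev (pend + Pi.single b 1) := by
  have key : ∀ u v j, upd f a b (some (lev b)) u v = some j →
      f u v = some j ∨ (u = a ∧ v = b ∧ j = lev b) := fun u v j e => by
    simp only [upd] at e
    split_ifs at e with h
    · exact .inr ⟨h.1, h.2, by simpa using e.symm⟩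
    · exact .inl e
  have sub : ∀ v j, j ≠ lev v → inBucket (upd f a b (some (lev b))) v j ⊆
      inBucket f v j := fun v j hj u hu => by
    rcases key _ _ _ (mem_inBucket.1 hu) with h | ⟨-, rfl, h⟩
    · exact mem_inBucket.2 h
    · exact absurd h hj
  refine ⟨fun u v j e => ?_, fun u v j e => ?_, fun u v j e => ?_, h.five_le, h.lt_L, h.low_le,
    h.lt_low, fun v => ?_, fun v => le_trans ?_ (h.old_low v),
    fun v => le_trans ?_ (h.old_high v)⟩
  · rcases key _ _ _ e with h1 | ⟨rfl, rfl, rfl⟩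
    · exact h.label_le u v j h1
    · exact hl
  · rcases key _ _ _ e with h1 | ⟨rfl, rfl, rfl⟩
    · exact h.le_label u v j h1
    · omega
  · rcases key _ _ _ e with h1 | ⟨rfl, rfl, rfl⟩
    · exact h.label_le' u v j h1
    · omega
  · have hc := h.card v
    by_cases hv : v = b
    · subst hv
      have e : ({u | upd f a v (some (lev v)) u v ≠ none} : Finset (Fin n)) =
          insert a ({u | f u v ≠ none} : Finset (Fin n)) := by
        ext u
        by_cases hu : u = a <;> simp [upd, hu]
      have hm : a ∉ ({u | f u v ≠ none} : Finset (Fin n)) := by simp [hab]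
      rw [e, Finset.card_insert_of_notMem hm, Nat.cast_succ, hc]
      simp
      ring
    · simpa [upd, hv] using hc
  · exact_mod_cast Finset.card_le_card (sub _ _ (by omega))
  · exact_mod_cast Finset.card_le_card (sub _ _ (by omega))

theorem relabel (h : Consistent P f deg lev pend) {a b : Fin n} {j : ℤ} (hab : f a b = some j)
    (hl : lev b ≤ lev a + 2) : Consistent P (upd f a b (some (lev b))) deg lev pend := by
  have := (h.remove hab).add (a := a) (b := b) (by simp [upd]) hl
  rwa [upd_upd, sub_add_cancel] at this

theorem card_le (f : Fin n → Fin n → Option ℤ) (v : Fin n) (j : ℤ) :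
    (inBucket f v j).card ≤ ({u | f u v ≠ none} : Finset (Fin n)).card :=
  Finset.card_le_card fun u hu => by
    have := mem_inBucket.1 hu
    simp [this]

theorem card_bucket_eq_zero {v : Fin n} {j : ℤ} (h : ∀ u, f u v ≠ some j) :
    (inBucket f v j).card = 0 := by
  rw [Finset.card_eq_zero, Finset.eq_empty_iff_forall_notMem]
  exact fun u hu => h u (mem_inBucket.1 hu)

theorem ne_of_card_bucket {v : Fin n} {j : ℤ} (h : (inBucket f v j).card = 0)
    (u : Fin n) : f u v ≠ some j := fun e => by
  rw [Finset.card_eq_zero] at h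
  have : u ∈ inBucket f v j := mem_inBucket.2 e
  simp [h] at this


/-- Count the additional incoming arc of `y`; the level does not change. -/
theorem raise {y : Fin n} (h : Consistent P f deg lev (Pi.single y 1))
    (hlow : (inBucket f y (lev y - 1)).card = 0 ∨
      ((inBucket f y (lev y - 1)).card : ℝ) ≤ P.K * (P.low y (lev y + 1) - deg y - 1))
    (hd : deg y + 1 < P.low y (lev y + 1)) :
    Consistent P f (Function.update deg y (deg y + 1)) lev 0 := by
  have hK := P.two_le_K
  refine ⟨h.label_le, h.le_label, h.label_le', h.five_le, h.lt_L, fun v => ?_, fun v => ?_,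
    fun v => ?_, fun v => ?_, fun v => ?_⟩ <;> by_cases hv : v = y
  · subst hv
    rw [Function.update_self]
    push_cast
    linarith [h.low_le v]
  · rw [Function.update_of_ne hv]; exact h.low_le v
  · subst hv
    rw [Function.update_self]
    push_cast
    exact hd
  · rw [Function.update_of_ne hv]; exact h.lt_low v
  · subst hv
    simp [h.card v]
  · simp [hv, h.card v]
  · subst hv
    rw [Function.update_self]
    push_cast
    rcases hlow with h0 | h0
    · rw [h0, Nat.cast_zero]
      exact mul_nonneg (by linarith) (by linarith)
    · rwa [← sub_sub]
  · rw [Function.update_of_ne hv]; exact h.old_low v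
  · subst hv
    rw [Function.update_self]
    push_cast
    refine (h.old_high v).trans ?_
    nlinarith
  · rw [Function.update_of_ne hv]; exact h.old_high v

/-- Count the additional incoming arc of `y`, and raise the level of `y`. -/
theorem raise_up {y : Fin n} (h : Consistent P f deg lev (Pi.single y 1))
    (hlow : (inBucket f y (lev y - 1)).card = 0 ∨
      ((inBucket f y (lev y - 1)).card : ℝ) ≤ P.K * (P.low y (lev y + 1) - deg y - 1))
    (hd : P.low y (lev y + 1) ≤ deg y + 1) :
    Consistent P f (Function.update deg y (deg y + 1)) (Function.update lev y (lev y + 1)) 0 := by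
  have hK := P.two_le_K
  -- At the boundary the bound on the number of arcs with too low a label has dropped to at most
  -- zero. Labels left behind would be wrong by two after the change of level.
  have hlow0 : (inBucket f y (lev y - 1)).card = 0 := by
    rcases hlow with h0 | h0
    · exact h0
    · have : ((inBucket f y (lev y - 1)).card : ℝ) ≤ 0 := h0.trans (by nlinarith)
      exact Nat.le_zero.1 (by exact_mod_cast this)
  have hno := ne_of_card_bucket hlow0
  have hle : ∀ v, lev v ≤ Function.update lev y (lev y + 1) v := fun v => by
    rw [Function.update_apply]
    split_ifs with e
    · rw [e]; omega
    · rfl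
  have hcard : (({u | f u y ≠ none} : Finset (Fin n)).card : ℤ) = deg y + 1 := by
    simpa using h.card y
  have hcardn : ({u | f u y ≠ none} : Finset (Fin n)).card ≤ n :=
    (Finset.card_le_univ _).trans_eq (Fintype.card_fin n)
  have h5 := h.five_le y
  refine ⟨fun u v j e => (h.label_le u v j e).trans (by linarith [hle u]), fun u v j e => ?_,
    fun u v j e => (h.label_le' u v j e).trans (by linarith [hle v]),
    fun v => (h.five_le v).trans (hle v), fun v => ?_, fun v => ?_, fun v => ?_,
    fun v => ?_, fun v => ?_, fun v => ?_⟩ <;> by_cases hv : v = y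
  · subst hv
    rw [Function.update_self]
    have h1 := h.le_label u v j e
    have h2 : j ≠ lev v - 1 := by rintro rfl; exact hno u e
    omega
  · rw [Function.update_of_ne hv]; exact h.le_label u v j e
  · subst hv
    rw [Function.update_self]
    refine P.lt_L_of_low_le hd ?_
    have : (deg v + 1 : ℤ) ≤ n := by omega
    have : ((deg v + 1 : ℤ) : ℝ) ≤ n := by exact_mod_cast this
    push_cast at this
    linarith
  · rw [Function.update_of_ne hv]; exact h.lt_L v
  · subst hv
    simpa using hd
  · rw [Function.update_of_ne hv, Function.update_of_ne hv]; exact h.low_le v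
  · subst hv
    rw [Function.update_self, Function.update_self]
    push_cast
    -- One additional arc cannot skip a level, since a level spans at least two units of in-degree.
    have h1 := P.low_succ v (i := lev v + 1) (by omega)
    have h2 := h.lt_low v
    have h3 := P.low_nonneg v (lev v + 1)
    nlinarith [P.eta_pos, P.one_le_w v]
  · rw [Function.update_of_ne hv, Function.update_of_ne hv]; exact h.lt_low v
  · subst hv
    simp [h.card v]
  · simp [hv, h.card v]
  · subst hv
    rw [Function.update_self, Function.update_self, add_sub_cancel_right]
    push_cast
    -- All arcs labelled with the former level become outdated at once. There may be as many as the
    -- whole in-degree, but the full width of the new level lies ahead.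
    have h1 := P.low_add_one_le v (i := lev v + 1) (by omega)
    have h2 := h.lt_low v
    have h3 : ((inBucket f v (lev v)).card : ℝ) ≤ deg v + 1 := by
      have := card_le f v (lev v)
      have : ((inBucket f v (lev v)).card : ℤ) ≤ deg v + 1 := by omega
      exact_mod_cast this
    nlinarith
  · rw [Function.update_of_ne hv, Function.update_of_ne hv]; exact h.old_low v
  · subst hv
    rw [Function.update_self, Function.update_self, card_bucket_eq_zero, Nat.cast_zero]
    · push_cast
      exact mul_nonneg (by linarith) (by linarith)
    · intro u e
      have := h.label_le' u v _ e
      omega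
  · rw [Function.update_of_ne hv, Function.update_of_ne hv]; exact h.old_high v

/-- Count the missing incoming arc of `y`; the level does not change. -/
theorem lower {y : Fin n} (h : Consistent P f deg lev (Pi.single y (-1)))
    (hhigh : (inBucket f y (lev y + 1)).card = 0 ∨
      ((inBucket f y (lev y + 1)).card : ℝ) ≤ P.K * (deg y - P.low y (lev y) - 1))
    (hd : P.low y (lev y) ≤ deg y - 1) :
    Consistent P f (Function.update deg y (deg y - 1)) lev 0 := by
  have hK := P.two_le_K
  refine ⟨h.label_le, h.le_label, h.label_le', h.five_le, h.lt_L, fun v => ?_, fun v => ?_,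
    fun v => ?_, fun v => ?_, fun v => ?_⟩ <;> by_cases hv : v = y
  · subst hv
    rw [Function.update_self]
    push_cast
    exact hd
  · rw [Function.update_of_ne hv]; exact h.low_le v
  · subst hv
    rw [Function.update_self]
    push_cast
    linarith [h.lt_low v]
  · rw [Function.update_of_ne hv]; exact h.lt_low v
  · subst hv
    simp [h.card v, sub_eq_add_neg]
  · simp [hv, h.card v]
  · subst hv
    rw [Function.update_self]
    push_cast
    refine (h.old_low v).trans ?_
    nlinarith
  · rw [Function.update_of_ne hv]; exact h.old_low v
  · subst hv
    rw [Function.update_self]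
    push_cast
    rcases hhigh with h0 | h0
    · rw [h0, Nat.cast_zero]
      exact mul_nonneg (by linarith) (by linarith)
    · rwa [sub_right_comm]
  · rw [Function.update_of_ne hv]; exact h.old_high v

/-- Count the missing incoming arc of `y`, and lower the level of `y`. -/
theorem lower_down {y : Fin n} (h : Consistent P f deg lev (Pi.single y (-1)))
    (hhigh : (inBucket f y (lev y + 1)).card = 0 ∨
      ((inBucket f y (lev y + 1)).card : ℝ) ≤ P.K * (deg y - P.low y (lev y) - 1))
    (hout : ∀ v, f y v ≠ some (lev y + 2)) (hd : deg y - 1 < P.low y (lev y)) :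
    Consistent P f (Function.update deg y (deg y - 1)) (Function.update lev y (lev y - 1)) 0 := by
  have hK := P.two_le_K
  -- Below the boundary the second alternative would bound the size of the bucket by a negative
  -- number.
  have hhigh0 : (inBucket f y (lev y + 1)).card = 0 := by
    rcases hhigh with h0 | h0
    · exact h0
    · have : ((inBucket f y (lev y + 1)).card : ℝ) < 1 := h0.trans_lt (by nlinarith)
      have : (inBucket f y (lev y + 1)).card < 1 := by exact_mod_cast this
      omega
  have hno := ne_of_card_bucket hhigh0
  have hle : ∀ v, Function.update lev y (lev y - 1) v ≤ lev v := fun v => by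
    rw [Function.update_apply]
    split_ifs with e
    · rw [e]; omega
    · rfl
  have hcard : (({u | f u y ≠ none} : Finset (Fin n)).card : ℤ) = deg y - 1 := by
    simpa [sub_eq_add_neg] using h.card y
  have hdeg : (1 : ℝ) ≤ deg y := by
    have : 1 ≤ deg y := by omega
    exact_mod_cast this
  -- The lowest level has threshold 0, and the new in-degree `deg y - 1` is a cardinality, so it
  -- cannot fall below this level.
  have h6 : 6 ≤ lev y := by
    by_contra! h6
    have := threshold_of_le (η := P.eta) (by omega : lev y ≤ 5)
    rw [Parameters.low, this] at hd
    linarith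
  have hlow := P.low_succ_le y (i := lev y - 1) (by omega)
  rw [sub_add_cancel] at hlow
  have hlo := h.low_le y
  refine ⟨fun u v j e => ?_, fun u v j e => (by linarith [hle v, h.le_label u v j e]),
    fun u v j e => ?_,
    fun v => ?_, fun v => (hle v).trans_lt (h.lt_L v), fun v => ?_, fun v => ?_,
    fun v => ?_, fun v => ?_, fun v => ?_⟩
  · have h1 := h.label_le u v j e
    by_cases hu : u = y
    · subst hu
      rw [Function.update_self]
      -- The level of a tail falls here, which is the only danger to `label_le`. This is why the
      -- deficit must first be moved away from vertices with a tight outgoing arc.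
      have h2 : j ≠ lev u + 2 := by rintro rfl; exact hout v e
      omega
    · rwa [Function.update_of_ne hu]
  all_goals by_cases hv : v = y
  · subst hv
    rw [Function.update_self]
    have h1 := h.label_le' u v j e
    have h2 : j ≠ lev v + 1 := by rintro rfl; exact hno u e
    omega
  · rw [Function.update_of_ne hv]; exact h.label_le' u v j e
  · subst hv
    rw [Function.update_self]
    omega
  · rw [Function.update_of_ne hv]; exact h.five_le v
  · subst hv
    rw [Function.update_self, Function.update_self]
    push_cast
    have h1 := P.low_succ v (i := lev v - 1) (by omega)
    rw [sub_add_cancel] at h1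
    nlinarith [P.eta_pos, P.one_le_w v, P.low_nonneg v (lev v - 1)]
  · rw [Function.update_of_ne hv, Function.update_of_ne hv]; exact h.low_le v
  · subst hv
    simpa using hd
  · rw [Function.update_of_ne hv, Function.update_of_ne hv]; exact h.lt_low v
  · subst hv
    simp [h.card v, sub_eq_add_neg]
  · simp [hv, h.card v]
  · subst hv
    rw [Function.update_self, Function.update_self, card_bucket_eq_zero, Nat.cast_zero]
    · push_cast
      rw [sub_add_cancel]
      exact mul_nonneg (by linarith) (by linarith)
    · intro u e
      have := h.le_label u v _ e
      omega
  · rw [Function.update_of_ne hv, Function.update_of_ne hv]; exact h.old_low v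
  · subst hv
    rw [Function.update_self, Function.update_self, sub_add_cancel]
    push_cast
    -- Every arc labelled with the former level is now one too high; `hlow` shows that the width of
    -- the lower level leaves enough changes of the in-degree to refresh them all.
    have h3 : ((inBucket f v (lev v)).card : ℝ) ≤ deg v - 1 := by
      have := card_le f v (lev v)
      have : ((inBucket f v (lev v)).card : ℤ) ≤ deg v - 1 := by omega
      exact_mod_cast this
    nlinarith
  · rw [Function.update_of_ne hv, Function.update_of_ne hv]; exact h.old_high v

end Consistent

/-! ### The potential -/

/-- The part of the potential that belongs to a vertex. -/
noncomputable def Parameters.charge {n : ℕ} (P : Parameters n) (v : Fin n) (d i : ℤ) : ℝ :=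
  d * (i + 1) + min (P.K * (d - P.low v i)) d

theorem Parameters.charge_raise {n : ℕ} (P : Parameters n) (y : Fin n) (d i : ℤ) :
    P.charge y (d + 1) i ≤ P.charge y d i + (i + 2 + P.K) := by
  have hK := P.two_le_K
  unfold Parameters.charge
  push_cast
  have : min (P.K * ((d + 1 : ℝ) - P.low y i)) (d + 1) ≤
      min (P.K * ((d : ℝ) - P.low y i)) d + P.K := by
    rw [← min_add_add_right]
    exact min_le_min (by linarith) (by linarith)
  linarith

/-- The potential pays for the increase of labels. -/
noncomputable def Parameters.potential {n : ℕ} (P : Parameters n) (f : Fin n → Fin n → Option ℤ)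
    (deg lev : Fin n → ℤ) : ℝ := ∑ v, P.charge v (deg v) (lev v) - labelSum f

namespace Consistent

variable {n : ℕ} {P : Parameters n} {f : Fin n → Fin n → Option ℤ} {deg lev pend : Fin n → ℤ}

theorem deg_nonneg (h : Consistent P f deg lev pend) (v : Fin n) : (0 : ℝ) ≤ deg v :=
  (P.low_nonneg v _).trans (h.low_le v)

/-- The product `d * (i + 1)` grows by `d + i + 2`. The term `d` is paid by the minimum, which has
reached `d` just below the upper boundary and restarts at no more than `K` in the new level. -/
theorem charge_raise_up (h : Consistent P f deg lev pend) (y : Fin n)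
    (hd : P.low y (lev y + 1) ≤ deg y + 1) :
    P.charge y (deg y + 1) (lev y + 1) ≤ P.charge y (deg y) (lev y) + (lev y + 2 + P.K) := by
  have hK := P.two_le_K
  have h1 := P.low_succ_le y (h.five_le y)
  have h2 := h.lt_low y
  unfold Parameters.charge
  push_cast
  have h3 : min (P.K * ((deg y : ℝ) - P.low y (lev y))) (deg y) = deg y := by
    rw [min_eq_right]
    nlinarith
  have h4 : min (P.K * ((deg y + 1 : ℝ) - P.low y (lev y + 1))) (deg y + 1) ≤
      P.K := (min_le_left _ _).trans (by nlinarith)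
  rw [h3]
  linarith

theorem charge_lower (h : Consistent P f deg lev pend) (y : Fin n) :
    P.charge y (deg y - 1) (lev y) ≤ P.charge y (deg y) (lev y) := by
  have hK := P.two_le_K
  have h5 : (5 : ℝ) ≤ lev y := by exact_mod_cast h.five_le y
  unfold Parameters.charge
  push_cast
  have : min (P.K * ((deg y - 1 : ℝ) - P.low y (lev y))) (deg y - 1) ≤
      min (P.K * ((deg y : ℝ) - P.low y (lev y))) (deg y) :=
    min_le_min (by nlinarith) (by linarith)
  linarith

/-- With one level less the product shrinks enough to pay even for a minimum as large as `deg y -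
1`. -/
theorem charge_lower_down (h : Consistent P f deg lev pend) (y : Fin n) :
    P.charge y (deg y - 1) (lev y - 1) ≤ P.charge y (deg y) (lev y) := by
  have hK := P.two_le_K
  have h5 : (5 : ℝ) ≤ lev y := by exact_mod_cast h.five_le y
  have h1 := h.deg_nonneg y
  have h2 := h.low_le y
  unfold Parameters.charge
  push_cast
  have h3 : min (P.K * ((deg y - 1 : ℝ) - P.low y (lev y - 1))) (deg y - 1) ≤ deg y - 1 :=
    min_le_right _ _
  have h4 : 0 ≤ min (P.K * ((deg y : ℝ) - P.low y (lev y))) (deg y) :=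
    le_min (mul_nonneg (by linarith) (by linarith)) h1
  nlinarith

/-- The labels of the arcs into `v` are at most `lev v + 1`, so their sum is covered by the product
in the charge of `v`. -/
theorem potential_nonneg (h : Consistent P f deg lev 0) : 0 ≤ P.potential f deg lev := by
  have hK := P.two_le_K
  unfold Parameters.potential labelSum
  push_cast
  rw [← Finset.sum_sub_distrib]
  refine Finset.sum_nonneg fun v _ => ?_
  have h1 : (∑ u, (f u v).getD 0) ≤ deg v * (lev v + 1) := by
    have hc := h.card v
    simp only [Pi.zero_apply, add_zero] at hc
    rw [← hc, ← nsmul_eq_mul]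
    rw [← Finset.sum_filter_add_sum_filter_not _ (fun u => f u v ≠ none)]
    rw [Finset.sum_eq_zero (s := Finset.filter (fun u => ¬ f u v ≠ none) _), add_zero]
    · refine Finset.sum_le_card_nsmul _ _ _ fun u hu => ?_
      obtain ⟨j, hj⟩ := Option.ne_none_iff_exists'.1 (Finset.mem_filter.1 hu).2
      rw [hj]
      exact h.label_le' u v j hj
    · intro u hu
      have := (Finset.mem_filter.1 hu).2
      simp only [ne_eq, not_not] at this
      simp [this]
  have h2 : ((∑ u, (f u v).getD 0 : ℤ) : ℝ) ≤ deg v * (lev v + 1) := by exact_mod_cast h1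
  push_cast at h2
  have h3 := h.low_le v
  have h4 : 0 ≤ min (P.K * ((deg v : ℝ) - P.low v (lev v))) (deg v) :=
    le_min (mul_nonneg (by linarith) (by linarith)) (h.deg_nonneg v)
  unfold Parameters.charge
  linarith

end Consistent

theorem potential_update {n : ℕ} (P : Parameters n) (f : Fin n → Fin n → Option ℤ)
    (deg lev : Fin n → ℤ) (y : Fin n) (d i : ℤ) :
    P.potential f (Function.update deg y d) (Function.update lev y i) =
      P.potential f deg lev + P.charge y d i - P.charge y (deg y) (lev y) := by
  unfold Parameters.potential
  rw [← Finset.add_sum_erase _ _ (Finset.mem_univ y),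
    ← Finset.add_sum_erase _ (fun v => P.charge v (deg v) (lev v)) (Finset.mem_univ y),
    Finset.sum_congr rfl (s₁ := Finset.univ.erase y) (g := fun v => P.charge v (deg v) (lev v))
      fun v hv => by simp [Finset.ne_of_mem_erase hv]]
  simp
  ring

/-! ### The abstract state in memory, and the basic changes of an arc -/

namespace RealRAM

/-- The memory represents the parameters, the arcs with their labels, and the in-degrees and levels
of the vertices. -/
structure Mem {n : ℕ} (P : Parameters n) (f : Fin n → Fin n → Option ℤ) (deg lev : Fin n → ℤ)
    (s : State) : Prop where
  budget : s.ivar 5 = P.K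
  eps : s.rvar 0 = P.eps
  w : ∀ v : Fin n, s.rarr 0 (v : ℕ) = P.w v
  thr : ∀ i, 0 ≤ i → i ≤ P.L → s.rarr 1 i = threshold P.eta i
  tab : Tables n P.L s
  arcs : Arcs s f
  deg : ∀ v : Fin n, s.iarr 6 (v : ℕ) = deg v
  sorted : Sorted P.w lev s

section

variable {n : ℕ} {P : Parameters n} {f g : Fin n → Fin n → Option ℤ} {deg lev : Fin n → ℤ}
  {s s' : State}

theorem Mem.setIvar (h : Mem P f deg lev s) {x : ℕ} (hx : x ≠ 5) (k : ℤ) :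
    Mem P f deg lev (s.setIvar x k) where
  budget := by simp [hx.symm, h.budget]
  eps := h.eps
  w := h.w
  thr := h.thr
  tab := ⟨h.tab.row, h.tab.lab⟩
  arcs := ⟨h.arcs.mat, h.arcs.lab, h.arcs.ins, h.arcs.outs⟩
  deg := h.deg
  sorted := ⟨h.sorted.by_lev, h.sorted.lev⟩

theorem Mem.arcStep (h : Mem P f deg lev s) (ha : Arcs s' g) (hs : Unchanged 23 arcArrays s s') :
    Mem P g deg lev s' where
  budget := by rw [hs.ivar 5 (by norm_num), h.budget]
  eps := by rw [hs.rvar, h.eps]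
  w v := by rw [hs.rarr, h.w]
  thr i := by rw [hs.rarr]; exact h.thr i
  tab := h.tab.unchanged hs (by decide) (by decide)
  arcs := ha
  deg v := by rw [hs.iarr 6 (by decide), h.deg]
  sorted := ⟨by
    rw [hs.iarr 1 (by decide), hs.iarr 2 (by decide), hs.iarr 3 (by decide), hs.rarr]
    exact h.sorted.by_lev, fun v => by rw [hs.iarr 7 (by decide), h.sorted.lev]⟩

theorem Mem.setDeg (h : Mem P f deg lev s) (y : Fin n) (d : ℤ) :
    Mem P f (Function.update deg y d) lev (s.setIarr 6 (y : ℕ) d) where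
  budget := h.budget
  eps := h.eps
  w := h.w
  thr := h.thr
  tab := ⟨h.tab.row, h.tab.lab⟩
  arcs := ⟨h.arcs.mat, h.arcs.lab, h.arcs.ins, h.arcs.outs⟩
  deg v := by
    by_cases e : v = y
    · simp [e]
    · simp [e, h.deg, Fin.val_inj]
  sorted := ⟨h.sorted.by_lev, h.sorted.lev⟩

theorem Mem.levelStep {lev' : Fin n → ℤ} (h : Mem P f deg lev s) (ho : Sorted P.w lev' s')
    (hs : LevelStep s s') : Mem P f deg lev' s' where
  budget := by rw [hs.ivar 5 (by norm_num), h.budget]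
  eps := by rw [hs.rvar, h.eps]
  w v := by rw [hs.rarr 0 (by norm_num), h.w]
  thr i := by rw [hs.rarr 1 (by norm_num)]; exact h.thr i
  tab := ⟨fun v => by rw [hs.iarr 4 (by decide)]; exact h.tab.row v,
    fun j => by rw [hs.iarr 5 (by decide)]; exact h.tab.lab j⟩
  arcs := by
    constructor
    · rw [hs.iarr 0 (by decide)]; exact h.arcs.mat
    · rw [hs.iarr 8 (by decide)]; exact h.arcs.lab
    · rw [hs.iarr 9 (by decide), hs.iarr 10 (by decide), hs.iarr 11 (by decide)]
      exact h.arcs.ins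
    · rw [hs.iarr 12 (by decide), hs.iarr 13 (by decide), hs.iarr 14 (by decide)]
      exact h.arcs.outs
  deg v := by rw [hs.iarr 6 (by decide), h.deg]
  sorted := ho

/-- `f` is an orientation of `G`. -/
structure Orients (G : SimpleGraph (Fin n)) (f : Fin n → Fin n → Option ℤ) : Prop where
  adj : ∀ u v, G.Adj u v ↔ f u v ≠ none ∨ f v u ≠ none
  asymm : ∀ u v, f u v ≠ none → f v u = none

theorem Orients.relabel {G : SimpleGraph (Fin n)} (h : Orients G f) {a b : Fin n} {j k : ℤ}
    (hab : f a b = some j) : Orients G (upd f a b (some k)) := by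
  have key : ∀ u v, upd f a b (some k) u v ≠ none ↔ f u v ≠ none := fun u v => by
    simp only [upd]
    split_ifs with e
    · simp [e.1, e.2, hab]
    · rfl
  refine ⟨fun u v => by rw [key, key]; exact h.adj u v, fun u v e => ?_⟩
  by_contra e'
  exact (key _ _).1 e' (h.asymm u v ((key u v).1 e))

theorem Orients.flip {G : SimpleGraph (Fin n)} (h : Orients G f) {a b : Fin n} {j k : ℤ}
    (hab : f a b = some j) : Orients G (upd (upd f a b none) b a (some k)) := by
  have hba : f b a = none := h.asymm a b (by simp [hab])
  have hne : a ≠ b := by rintro rfl; simp [hab] at hba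
  constructor
  · intro u v
    rw [h.adj]
    simp only [upd]
    by_cases h1 : u = a <;> by_cases h2 : v = b <;> by_cases h3 : u = b <;>
      by_cases h4 : v = a <;> simp_all
  · intro u v
    have := h.asymm u v
    simp only [upd]
    by_cases h1 : u = a <;> by_cases h2 : v = b <;> by_cases h3 : u = b <;>
      by_cases h4 : v = a <;> simp_all

theorem wp_addArc_mem {u v : Fin n} {j : ℤ} (h : Mem P f deg lev s) (hu : s.ivar 20 = (u : ℕ))
    (hv : s.ivar 21 = (v : ℕ)) (hj : s.ivar 22 = j) (hj0 : 0 ≤ j) (hj1 : j ≤ P.L + 2)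
    (hf : f u v = none) :
    Wp addArc (fun s' t => t ≤ 120 ∧ Mem P (upd f u v (some j)) deg lev s' ∧
      ∀ x < 23, s'.ivar x = s.ivar x) s :=
  (wp_addArc h.tab hu hv hj hj0 hj1 hf h.arcs).mono fun _ _ ⟨ht, ha, hs⟩ =>
    ⟨ht, h.arcStep ha hs, hs.ivar⟩

theorem wp_removeArc_mem {u v : Fin n} {j : ℤ} (h : Mem P f deg lev s) (hu : s.ivar 20 = (u : ℕ))
    (hv : s.ivar 21 = (v : ℕ)) (hj0 : 0 ≤ j) (hj1 : j ≤ P.L + 2) (hf : f u v = some j) :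
    Wp removeArc (fun s' t => t ≤ 140 ∧ Mem P (upd f u v none) deg lev s' ∧
      ∀ x < 23, s'.ivar x = s.ivar x) s :=
  (wp_removeArc h.tab hu hv hj0 hj1 hf h.arcs).mono fun _ _ ⟨ht, ha, hs⟩ =>
    ⟨ht, h.arcStep ha hs, hs.ivar⟩

/-- The address of the bucket of the vertex in variable 10 whose label is the level in variable 12
plus `c`. -/
def cellExpr (c : ℤ) : IExpr := .add (.get 5 (.add (.var 12) (.const c))) (.get 4 (.var 10))

theorem cost_cellExpr (c : ℤ) : (cellExpr c).cost = 7 := rfl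

theorem eval_cellExpr {y : Fin n} {i c : ℤ} (h : Mem P f deg lev s) (hy : s.ivar 10 = (y : ℕ))
    (hi : s.ivar 12 = i) (h0 : 0 ≤ i + c) (h1 : i + c ≤ P.L + 2) :
    (cellExpr c).eval s = cell n (i + c) y := by
  simp only [cellExpr, IExpr.eval, hy, hi, h.tab.row, h.tab.lab _ h0 h1, cell]

/-- Remove the arc from the vertex in variable 20 to the one in variable 10 and insert it with the
label in variable 12. -/
def relabelArc : Prog := block [
  .iassign 21 (.var 10), removeArc, .iassign 22 (.var 12), addArc, .iassign 11 (.sub (.var 11) (.const 1))]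

theorem wp_relabelArc {u y : Fin n} {i j q : ℤ} (h : Mem P f deg lev s)
    (hu : s.ivar 20 = (u : ℕ)) (hy : s.ivar 10 = (y : ℕ)) (hi : s.ivar 12 = i)
    (hq : s.ivar 11 = q) (hf : f u y = some j) (hj0 : 0 ≤ j) (hj1 : j ≤ P.L + 2) (hi0 : 0 ≤ i)
    (hi1 : i ≤ P.L + 2) :
    Wp relabelArc (fun s' t => t ≤ 300 ∧ Mem P (upd f u y (some i)) deg lev s' ∧
      s'.ivar 10 = (y : ℕ) ∧ s'.ivar 12 = i ∧ s'.ivar 11 = q - 1) s := by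
  simp only [relabelArc, wp_block_cons, wp_block_nil, wp_iassign, IExpr.cost, IExpr.eval]
  refine (wp_removeArc_mem (u := u) (v := y) (h.setIvar (by norm_num) _) (by simp [hu])
    (by simp [hy]) hj0 hj1 hf).mono ?_
  rintro s₁ t₁ ⟨ht₁, h₁, e₁⟩
  refine (wp_addArc_mem (u := u) (v := y) (j := i) (h₁.setIvar (by norm_num) _)
    (by simp [e₁, hu]) (by simp [e₁, hy]) (by simp [e₁, hi]) hi0 hi1 (by simp [upd])).mono ?_
  rintro s₂ t₂ ⟨ht₂, h₂, e₂⟩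
  rw [upd_upd] at h₂
  exact ⟨by omega, h₂.setIvar (by norm_num) _, by simp [e₂, e₁, hy], by simp [e₂, e₁, hi],
    by simp [e₂, e₁, hq]⟩

/-- Reverse the arc from the vertex in variable 20 to the one in variable 21. The label of the new
arc is the level of its head. -/
def flipArc : Prog := block [
  removeArc, .iassign 14 (.var 20), .iassign 20 (.var 21), .iassign 21 (.var 14),
  .iassign 22 (.get 7 (.var 21)), addArc]

theorem wp_flipArc {a b : Fin n} {j : ℤ} (h : Mem P f deg lev s)
    (ha : s.ivar 20 = (a : ℕ)) (hb : s.ivar 21 = (b : ℕ)) (hf : f a b = some j)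
    (hf' : f b a = none) (hj0 : 0 ≤ j) (hj1 : j ≤ P.L + 2) (hl0 : 0 ≤ lev a)
    (hl1 : lev a ≤ P.L + 2) :
    Wp flipArc (fun s' t => t ≤ 300 ∧
      Mem P (upd (upd f a b none) b a (some (lev a))) deg lev s' ∧
      s'.ivar 20 = (b : ℕ) ∧ s'.ivar 21 = (a : ℕ) ∧ ∀ x < 14, s'.ivar x = s.ivar x) s := by
  simp only [flipArc, wp_block_cons, wp_block_nil, wp_iassign, IExpr.cost, IExpr.eval]
  refine (wp_removeArc_mem (u := a) (v := b) h ha hb hj0 hj1 hf).mono ?_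
  rintro s₁ t₁ ⟨ht₁, h₁, e₁⟩
  refine (wp_addArc_mem (u := b) (v := a) (j := lev a)
    ((((h₁.setIvar (by norm_num) _).setIvar (by norm_num) _).setIvar (by norm_num) _).setIvar
      (by norm_num) _) (by simp [e₁, hb]) (by simp [e₁, ha])
      (by simp [e₁, ha, h₁.sorted.lev]) hl0 hl1 (by simp [upd, hf'])).mono ?_
  rintro s₂ t₂ ⟨ht₂, h₂, e₂⟩
  refine ⟨by omega, h₂, by simp [e₂, e₁, hb], by simp [e₂, e₁, ha], fun x hx => ?_⟩
  rw [e₂ x (by omega)]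
  simp [show x ≠ 22 by omega, show x ≠ 21 by omega, show x ≠ 20 by omega, show x ≠ 14 by omega,
    e₁ x (by omega)]

end

end RealRAM

/-! ### Moving a surplus or a deficit to a vertex that can absorb it -/

namespace RealRAM

/-- One step of the search for arcs into the vertex in variable 10 whose label is too low: such an
arc is relabelled if the level of its tail allows this; otherwise it is reversed, and the search
continues at its tail. -/
def pushStep : Prog := block [
  .iassign 20 (.get 10 (cellExpr (-1))),
  .ite (.ile (.var 12) (.add (.get 7 (.var 20)) (.const 2))) relabelArc
    (block [.iassign 21 (.var 10), flipArc, .iassign 10 (.var 21), .iassign 12 (.get 7 (.var 10)),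
      .iassign 11 (.var 5)])]

/-- Move the additional incoming arc of the vertex in variable 10 to a vertex that can keep it. -/
def push : Prog := block [
  .iassign 12 (.get 7 (.var 10)), .iassign 11 (.var 5),
  .while (.and (.ile (.const 1) (.var 11)) (.ile (.const 1) (.get 9 (cellExpr (-1))))) pushStep]

section

variable {n : ℕ} {P : Parameters n} {f : Fin n → Fin n → Option ℤ} {deg lev pend : Fin n → ℤ}
  {s : State} {G : SimpleGraph (Fin n)}

theorem _root_.Parameters.two_le_K' (P : Parameters n) : 2 ≤ P.K := by
  exact_mod_cast P.two_le_K

theorem labelSum_flip {a b : Fin n} {j : ℤ} (k : ℤ) (hab : f a b = some j)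
    (hba : f b a = none) :
    labelSum (upd (upd f a b none) b a (some k)) = labelSum f - j + k := by
  rw [labelSum_upd, labelSum_upd, hab]
  simp [upd, hba]

theorem _root_.Consistent.flip (h : Consistent P f deg lev pend) {a b : Fin n} {j : ℤ}
    (hab : f a b = some j) (hba : f b a = none) (hl : lev a ≤ lev b + 2) :
    Consistent P (upd (upd f a b none) b a (some (lev a))) deg lev
      (pend - Pi.single b 1 + Pi.single a 1) :=
  (h.remove hab).add (by simp [upd, hba]) hl

theorem card_inBucket_relabel {a b : Fin n} {j k : ℤ} (hab : f a b = some j) (hjk : k ≠ j) :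
    ((inBucket (upd f a b (some k)) b j).card : ℤ) = (inBucket f b j).card - 1 := by
  have e : inBucket (upd f a b (some k)) b j = (inBucket f b j).erase a := by
    ext u
    by_cases hu : u = a <;> simp [mem_inBucket, upd, hu, hjk]
  have hm : a ∈ inBucket f b j := mem_inBucket.2 hab
  rw [e, Finset.card_erase_of_mem hm, Nat.cast_pred (Finset.card_pos.2 ⟨a, hm⟩)]

theorem cnt_inBucket (h : Mem P f deg lev s) (v : Fin n) (j : ℤ) :
    s.iarr 9 (cell n j v) = (inBucket f v j).card := h.arcs.ins.card v j

/-- Each step raises `labelSum` minus the level of the current vertex by exactly one: a refreshed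
label rises by one, and a reversal replaces the label `lev y - 1` by the level of the new current
vertex. This gives the first time bound, which the potential pays for. The second one is the worst
case: a reversal lowers the level, and at most `K` labels are refreshed at each vertex that is
visited. -/
theorem wp_push {y : Fin n} (hM : Mem P f deg lev s) (hC : Consistent P f deg lev (Pi.single y 1))
    (hG : Orients G f) (hy : s.ivar 10 = (y : ℕ)) :
    Wp push (fun s' t => ∃ f' y', Mem P f' deg lev s' ∧
      Consistent P f' deg lev (Pi.single y' 1) ∧ Orients G f' ∧ s'.ivar 10 = (y' : ℕ) ∧
      s'.ivar 12 = lev y' ∧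
      ((inBucket f' y' (lev y' - 1)).card = 0 ∨
        ((inBucket f' y' (lev y' - 1)).card : ℝ) ≤ P.K * (P.low y' (lev y' + 1) - deg y' - 1)) ∧
      (t : ℤ) ≤ 400 * ((labelSum f' - lev y') - (labelSum f - lev y)) + 50 ∧
      (t : ℤ) ≤ 400 * (lev y * (P.K + 1) + P.K) + 50) s := by
  have hK := P.two_le_K'
  simp only [push, wp_block_cons, wp_block_nil, wp_iassign, IExpr.cost, IExpr.eval]
  set s₁ := State.setIvar (State.setIvar _ 12 _) 11 _ with hs₁
  -- The variant is the lexicographic pair of level and remaining budget `q ≤ K`, written in base `K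
  -- + 1`.
  refine wp_while (fun k s t => ∃ f' y' q, Mem P f' deg lev s ∧
      Consistent P f' deg lev (Pi.single y' 1) ∧ Orients G f' ∧ s.ivar 10 = (y' : ℕ) ∧
      s.ivar 12 = lev y' ∧ s.ivar 11 = q ∧ 0 ≤ q ∧ q ≤ P.K ∧
      ((inBucket f' y' (lev y' - 1)).card + (P.K - q) : ℝ) ≤
        P.K * (P.low y' (lev y' + 1) - deg y') ∧
      (k : ℤ) = lev y' * (P.K + 1) + q ∧
      (t : ℤ) ≤ 400 * ((labelSum f' - lev y') - (labelSum f - lev y)) ∧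
      (t : ℤ) ≤ 400 * (lev y * (P.K + 1) + P.K - k)) ?_ ?_
    (k := (lev y * (P.K + 1) + P.K).toNat) ?_
  · rintro k s t ⟨f', y', q, hM, hC, hG, hy, hl, hq, hq0, hqK, hb, hk, ht, ht'⟩ hcond
    have h5 := hC.five_le y'
    have hL := hC.lt_L y'
    have hcell := eval_cellExpr (c := -1) hM hy hl (by omega) (by omega)
    simp only [BExpr.eval, IExpr.eval, hcell, hq] at hcond
    obtain ⟨hq1, hcnt⟩ := hcond
    obtain ⟨u, hu, hfu, -⟩ := hM.arcs.ins.get y' (lev y' + -1) 0 le_rfl (by omega)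
    rw [add_zero] at hu
    rw [← sub_eq_add_neg] at hfu
    simp only [pushStep, wp_block_cons, wp_block_nil, wp_iassign, IExpr.eval, hcell, hu, wp_ite,
      IExpr.cost, BExpr.cost, cost_cellExpr, BExpr.eval]
    have hM' := hM.setIvar (x := 20) (by norm_num) (u : ℕ)
    have h5u := hC.five_le u
    have hLu := hC.lt_L u
    have hk0 : 0 < k := by
      zify
      rw [hk]
      nlinarith
    refine ⟨fun hle => ?_, fun hle => ?_⟩
    · simp [hl, hM.sorted.lev] at hle
      refine (wp_relabelArc (u := u) (y := y') (i := lev y') (q := q) hM' (by simp) (by simp [hy])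
        (by simp [hl]) (by simp [hq]) hfu (by omega) (by omega) (by omega) (by omega)).mono ?_
      rintro s' t' ⟨ht1, h1, h2, h3, h4⟩
      refine ⟨k - 1, by omega, upd f' u y' (some (lev y')), y', q - 1, h1,
        hC.relabel hfu hle, hG.relabel hfu, h2, h3, h4, by omega, by omega, ?_, ?_, ?_, ?_⟩
      · have := card_inBucket_relabel (k := lev y') hfu (by omega)
        have : ((inBucket (upd f' u y' (some (lev y'))) y' (lev y' - 1)).card : ℝ) =
            (inBucket f' y' (lev y' - 1)).card - 1 := by exact_mod_cast this
        rw [this]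
        push_cast
        linarith
      · rw [Nat.cast_sub hk0]
        push_cast
        linarith
      · rw [labelSum_upd, hfu]
        push_cast
        simp only [Option.getD_some]
        omega
      · rw [Nat.cast_sub hk0]
        push_cast
        omega
    · simp [hl, hM.sorted.lev] at hle
      have hba := hG.asymm u y' (by simp [hfu])
      refine (wp_flipArc (a := u) (b := y') (hM'.setIvar (x := 21) (by norm_num) _) (by simp)
        (by simp [hy]) hfu hba (by omega) (by omega) (by omega) (by omega)).mono ?_
      rintro s' t' ⟨ht1, h1, -, h3, h4⟩
      -- By the failed test `u` is at least three levels below `y'`. Thus the reversed arc is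
      -- admissible, and the variant drops although the budget is reset to `K`.
      have hflip := hC.flip hfu hba (by omega)
      rw [sub_self, zero_add] at hflip
      refine ⟨(lev u * (P.K + 1) + P.K).toNat, ?_, _, u, P.K,
        ((h1.setIvar (by norm_num) _).setIvar (by norm_num) _).setIvar (by norm_num) _,
        hflip, hG.flip hfu, by simp [h3], by simp [h3, h1.sorted.lev], by simp [h1.budget],
        by omega, le_rfl, ?_, ?_, ?_, ?_⟩
      · zify
        rw [Int.toNat_of_nonneg (by nlinarith)]
        nlinarith
      · simpa using hflip.old_low u
      · rw [Int.toNat_of_nonneg (by nlinarith)]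
      · rw [labelSum_flip _ hfu hba]
        push_cast
        omega
      · rw [Int.toNat_of_nonneg (by nlinarith)]
        push_cast
        nlinarith
  · rintro k s t ⟨f', y', q, hM, hC, hG, hy, hl, hq, hq0, hqK, hb, hk, ht, ht'⟩ hcond
    have h5 := hC.five_le y'
    have hL := hC.lt_L y'
    have hcell := eval_cellExpr (c := -1) hM hy hl (by omega) (by omega)
    simp only [BExpr.eval, IExpr.eval, hcell, hq] at hcond
    rw [← sub_eq_add_neg, cnt_inBucket hM] at hcond
    refine ⟨f', y', hM, hC, hG, hy, hl, ?_, ?_, ?_⟩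
    · by_cases h1 : 1 ≤ q
      · left
        by_contra h0
        exact hcond ⟨h1, by omega⟩
      · right
        have : q = 0 := by omega
        subst this
        push_cast at hb
        linarith
    · simp only [BExpr.cost, IExpr.cost, cost_cellExpr]
      push_cast
      omega
    · simp only [BExpr.cost, IExpr.cost, cost_cellExpr]
      push_cast
      omega
  · have h5 := hC.five_le y
    have h0 : 0 ≤ lev y * (P.K + 1) + P.K := by nlinarith
    refine ⟨f, y, P.K, (hM.setIvar (by norm_num) _).setIvar (by norm_num) _, hC, hG,
      by simp [hs₁, hy], by simp [hs₁, hy, hM.sorted.lev], by simp [hs₁, hM.budget], by omega,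
      le_rfl, by simpa using hC.old_low y, by rw [Int.toNat_of_nonneg h0], by simp, ?_⟩
    rw [Int.toNat_of_nonneg h0]
    simp

/-- Count the additional incoming arc of the vertex in variable 10. -/
def raise : Prog := block [
  .istore 6 (.var 10) (.add (.get 6 (.var 10)) (.const 1)),
  .ite (.rle (.mul (.get 1 (.add (.var 12) (.const 1))) (.get 0 (.var 10)))
    (.cast (.get 6 (.var 10)))) levelUp .skip]

theorem wp_raise {y : Fin n} (hM : Mem P f deg lev s)
    (hC : Consistent P f deg lev (Pi.single y 1)) (hy : s.ivar 10 = (y : ℕ))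
    (hl : s.ivar 12 = lev y)
    (hlow : (inBucket f y (lev y - 1)).card = 0 ∨
      ((inBucket f y (lev y - 1)).card : ℝ) ≤ P.K * (P.low y (lev y + 1) - deg y - 1)) :
    Wp raise (fun s' t => t ≤ 100 ∧ ∃ deg' lev', Mem P f deg' lev' s' ∧
      Consistent P f deg' lev' 0 ∧
      P.potential f deg' lev' ≤ P.potential f deg lev + (P.L + 2 + P.K)) s := by
  have h5 := hC.five_le y
  have hL := hC.lt_L y
  have hL' : (lev y : ℝ) ≤ P.L := by exact_mod_cast hL.le
  have hM' := hM.setDeg y (deg y + 1)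
  have hthr := hM.thr (lev y + 1) (by omega) (by omega)
  simp only [raise, wp_block_cons, wp_block_nil, wp_istore, wp_ite, wp_skip, IExpr.cost,
    BExpr.cost, RExpr.cost, IExpr.eval, RExpr.eval, BExpr.eval, State.setIarr_iarr,
    State.setIarr_rarr, State.setIarr_ivar, hy, hl, hthr, hM.w, hM.deg, if_true,
    Function.update_self]
  refine ⟨fun hd => ?_, fun hd => ?_⟩
  · refine (wp_levelUp (y := y) (by simpa using hy) hM'.w hM'.sorted (by omega)).mono ?_
    rintro s' t ⟨ht, h1, h2⟩
    push_cast at hd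
    refine ⟨by omega, _, _, hM'.levelStep h1 h2, hC.raise_up hlow hd, ?_⟩
    rw [potential_update]
    linarith [hC.charge_raise_up y hd]
  · push_cast at hd
    refine ⟨by norm_num, _, _, hM', hC.raise hlow (not_le.1 hd), ?_⟩
    have := potential_update P f deg lev y (deg y + 1) (lev y)
    rw [Function.update_eq_self] at this
    rw [this]
    linarith [P.charge_raise y (deg y) (lev y)]

/-- One step of the search for arcs out of the vertex in variable 10 whose label is as high as
possible: the arc is reversed, and the search continues at its former head. -/
def pullStep : Prog := block [
  .iassign 20 (.var 10), .iassign 21 (.get 13 (cellExpr 2)), flipArc,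
  .iassign 10 (.var 20), .iassign 12 (.get 7 (.var 10))]

/-- Move the missing incoming arc of the vertex in variable 10 to a vertex that can do
without it. -/
def pull : Prog := block [
  .iassign 12 (.get 7 (.var 10)), .while (.ile (.const 1) (.get 12 (cellExpr 2))) pullStep]

/-- The head of an arc with label `lev y + 2` has level at least `lev y + 1`, because labels are
wrong by at most one. So the level rises with every reversal, which bounds their number by `L`. A
reversal replaces the label `lev y + 2` by `lev y` and costs 2 in the label sum. -/
theorem wp_pull {y : Fin n} (hM : Mem P f deg lev s)
    (hC : Consistent P f deg lev (Pi.single y (-1)))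
    (hG : Orients G f) (hy : s.ivar 10 = (y : ℕ)) :
    Wp pull (fun s' t => ∃ f' y', Mem P f' deg lev s' ∧
      Consistent P f' deg lev (Pi.single y' (-1)) ∧ Orients G f' ∧ s'.ivar 10 = (y' : ℕ) ∧
      s'.ivar 12 = lev y' ∧ (∀ v, f' y' v ≠ some (lev y' + 2)) ∧
      labelSum f - 2 * P.L ≤ labelSum f' ∧ (t : ℤ) ≤ 400 * P.L + 50) s := by
  simp only [pull, wp_block_cons, wp_block_nil, wp_iassign, IExpr.cost, IExpr.eval]
  set s₁ := State.setIvar _ 12 _ with hs₁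
  have h5 := hC.five_le y
  have hL := hC.lt_L y
  refine wp_while (fun k s t => ∃ f' y', Mem P f' deg lev s ∧
      Consistent P f' deg lev (Pi.single y' (-1)) ∧ Orients G f' ∧ s.ivar 10 = (y' : ℕ) ∧
      s.ivar 12 = lev y' ∧ (k : ℤ) = P.L - lev y' ∧
      labelSum f - 2 * (lev y' - lev y) ≤ labelSum f' ∧
      (t : ℤ) ≤ 400 * (lev y' - lev y)) ?_ ?_
    (k := (P.L - lev y).toNat) ?_
  · rintro k s t ⟨f', y', hM, hC, hG, hy, hl, hk, hs, ht⟩ hcond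
    have h5 := hC.five_le y'
    have hL := hC.lt_L y'
    have hcell := eval_cellExpr (c := 2) hM hy hl (by omega) (by omega)
    simp only [BExpr.eval, IExpr.eval, hcell] at hcond
    obtain ⟨x, hx, hfx, -⟩ := hM.arcs.outs.get y' (lev y' + 2) 0 le_rfl (by omega)
    rw [add_zero] at hx
    have hM' := hM.setIvar (x := 20) (by norm_num) (y' : ℕ)
    have hcell' := eval_cellExpr (y := y') (i := lev y') (c := 2) hM' (by simp [hy]) (by simp [hl]) (by omega) (by omega)
    have hba := hG.asymm y' x (by simp [hfx])
    have h5x := hC.five_le x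
    have hLx := hC.lt_L x
    have hlx := hC.label_le' y' x _ hfx
    simp only [pullStep, wp_block_cons, wp_block_nil, wp_iassign, IExpr.eval, hy, hcell',
      IExpr.cost, BExpr.cost, cost_cellExpr, State.setIvar_iarr, hx]
    refine (wp_flipArc (a := y') (b := x) (hM'.setIvar (x := 21) (by norm_num) _) (by simp)
      (by simp) hfx hba (by omega) (by omega) (by omega) (by omega)).mono ?_
    rintro s' t' ⟨ht1, h1, h2, -, h4⟩
    have hflip := hC.flip hfx hba (by omega)
    have hp : (Pi.single y' (-1) - Pi.single x 1 + Pi.single y' 1 : Fin n → ℤ) =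
        Pi.single x (-1) := by
      rw [Pi.single_neg, Pi.single_neg]; abel
    rw [hp] at hflip
    refine ⟨(P.L - lev x).toNat, by omega, _, x,
      (h1.setIvar (by norm_num) _).setIvar (by norm_num) _,
      hflip, hG.flip hfx, by simp [h2], by simp [h2, h1.sorted.lev],
      by omega, ?_, ?_⟩
    · rw [labelSum_flip _ hfx hba]
      omega
    · push_cast
      omega
  · rintro k s t ⟨f', y', hM, hC, hG, hy, hl, hk, hs, ht⟩ hcond
    have h5 := hC.five_le y'
    have hL := hC.lt_L y'
    have hcell := eval_cellExpr (c := 2) hM hy hl (by omega) (by omega)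
    simp only [BExpr.eval, IExpr.eval, hcell] at hcond
    refine ⟨f', y', hM, hC, hG, hy, hl, fun v hv => ?_, by omega, ?_⟩
    · have := hM.arcs.outs.loc y' _ v hv
      omega
    · simp only [BExpr.cost, IExpr.cost, cost_cellExpr]
      push_cast
      omega
  · exact ⟨f, y, hM.setIvar (by norm_num) _, hC, hG, by simp [hs₁, hy],
      by simp [hs₁, hy, hM.sorted.lev], by omega, by omega, by simp⟩

/-- Relabel some of the arcs into the vertex in variable 10 whose label is too high. -/
def relax : Prog := block [
  .iassign 11 (.var 5),
  .while (.and (.ile (.const 1) (.var 11)) (.ile (.const 1) (.get 9 (cellExpr 1))))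
    (block [.iassign 20 (.get 10 (cellExpr 1)), relabelArc])]

/-- Lowering a label never conflicts with the level of the tail, so in contrast to `push` no
reversal is needed and at most `K` steps suffice. No label `lev y + 2` arises, so the result of
`pull` is not spoiled. -/
theorem wp_relax {y : Fin n} (hM : Mem P f deg lev s) (hC : Consistent P f deg lev pend)
    (hG : Orients G f) (hy : s.ivar 10 = (y : ℕ)) (hl : s.ivar 12 = lev y)
    (hout : ∀ v, f y v ≠ some (lev y + 2)) :
    Wp relax (fun s' t => ∃ f', Mem P f' deg lev s' ∧
      Consistent P f' deg lev pend ∧ Orients G f' ∧ s'.ivar 10 = (y : ℕ) ∧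
      s'.ivar 12 = lev y ∧ (∀ v, f' y v ≠ some (lev y + 2)) ∧
      ((inBucket f' y (lev y + 1)).card = 0 ∨
        ((inBucket f' y (lev y + 1)).card : ℝ) ≤ P.K * (deg y - P.low y (lev y) - 1)) ∧
      labelSum f - P.K ≤ labelSum f' ∧ (t : ℤ) ≤ 400 * P.K + 50) s := by
  have hK := P.two_le_K'
  have h5 := hC.five_le y
  have hL := hC.lt_L y
  simp only [relax, wp_block_cons, wp_block_nil, wp_iassign, IExpr.cost, IExpr.eval]
  set s₁ := State.setIvar _ 11 _ with hs₁
  refine wp_while (fun k s t => ∃ f', Mem P f' deg lev s ∧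
      Consistent P f' deg lev pend ∧ Orients G f' ∧ s.ivar 10 = (y : ℕ) ∧
      s.ivar 12 = lev y ∧ (∀ v, f' y v ≠ some (lev y + 2)) ∧ s.ivar 11 = k ∧ (k : ℤ) ≤ P.K ∧
      ((inBucket f' y (lev y + 1)).card + (P.K - k) : ℝ) ≤ P.K * (deg y - P.low y (lev y)) ∧
      labelSum f - (P.K - k) ≤ labelSum f' ∧ (t : ℤ) ≤ 400 * (P.K - k)) ?_ ?_
    (k := P.K.toNat) ?_
  · rintro k s t ⟨f', hM, hC, hG, hy, hl, hout, hq, hqK, hb, hs, ht⟩ hcond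
    have hcell := eval_cellExpr (c := 1) hM hy hl (by omega) (by omega)
    simp only [BExpr.eval, IExpr.eval, hcell, hq] at hcond
    obtain ⟨hq1, hcnt⟩ := hcond
    obtain ⟨u, hu, hfu, -⟩ := hM.arcs.ins.get y (lev y + 1) 0 le_rfl (by omega)
    rw [add_zero] at hu
    simp only [wp_block_cons, wp_block_nil, wp_iassign, IExpr.eval, hcell, hu,
      IExpr.cost, BExpr.cost, cost_cellExpr]
    have hle := hC.label_le u y _ hfu
    refine (wp_relabelArc (u := u) (y := y) (i := lev y) (q := k)
      (hM.setIvar (x := 20) (by norm_num) (u : ℕ)) (by simp) (by simp [hy])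
      (by simp [hl]) (by simp [hq]) hfu (by omega) (by omega) (by omega) (by omega)).mono ?_
    rintro s' t' ⟨ht1, h1, h2, h3, h4⟩
    refine ⟨k - 1, by omega, upd f' u y (some (lev y)), h1, hC.relabel hfu (by omega),
      hG.relabel hfu, h2, h3, fun v hv => ?_, by omega, by omega, ?_, ?_, ?_⟩
    · simp only [upd] at hv
      split_ifs at hv
      · simp at hv
      · exact hout v hv
    · have := card_inBucket_relabel (k := lev y) hfu (by omega)
      have : ((inBucket (upd f' u y (some (lev y))) y (lev y + 1)).card : ℝ) =
          (inBucket f' y (lev y + 1)).card - 1 := by exact_mod_cast this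
      rw [this, Nat.cast_sub (by omega)]
      push_cast
      linarith
    · rw [labelSum_upd, hfu]
      simp only [Option.getD_some]
      omega
    · push_cast
      omega
  · rintro k s t ⟨f', hM, hC, hG, hy, hl, hout, hq, hqK, hb, hs, ht⟩ hcond
    have hcell := eval_cellExpr (c := 1) hM hy hl (by omega) (by omega)
    simp only [BExpr.eval, IExpr.eval, hcell, hq] at hcond
    rw [cnt_inBucket hM] at hcond
    refine ⟨f', hM, hC, hG, hy, hl, hout, ?_, by omega, ?_⟩
    · by_cases h1 : 1 ≤ k
      · left
        by_contra h0
        exact hcond ⟨by omega, by omega⟩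
      · right
        have : k = 0 := by omega
        subst this
        push_cast at hb
        linarith
    · simp only [BExpr.cost, IExpr.cost, cost_cellExpr]
      push_cast
      omega
  · refine ⟨f, hM.setIvar (by norm_num) _, hC, hG, by simp [hs₁, hy], by simp [hs₁, hl], hout,
      by simp [hs₁, hM.budget]; omega, by omega, ?_, by omega, by omega⟩
    have : ((P.K.toNat : ℤ) : ℝ) = P.K := by rw [Int.toNat_of_nonneg (by omega)]
    rw [Int.cast_natCast] at this
    rw [this]
    simpa using hC.old_high y

/-- Count the missing incoming arc of the vertex in variable 10. -/
def lower : Prog := block [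
  .istore 6 (.var 10) (.sub (.get 6 (.var 10)) (.const 1)),
  .ite (.rle (.mul (.get 1 (.var 12)) (.get 0 (.var 10)))
    (.cast (.get 6 (.var 10)))) .skip levelDown]

theorem wp_lower {y : Fin n} (hM : Mem P f deg lev s)
    (hC : Consistent P f deg lev (Pi.single y (-1))) (hy : s.ivar 10 = (y : ℕ))
    (hl : s.ivar 12 = lev y) (hout : ∀ v, f y v ≠ some (lev y + 2))
    (hhigh : (inBucket f y (lev y + 1)).card = 0 ∨
      ((inBucket f y (lev y + 1)).card : ℝ) ≤ P.K * (deg y - P.low y (lev y) - 1)) :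
    Wp lower (fun s' t => t ≤ 100 ∧ ∃ deg' lev', Mem P f deg' lev' s' ∧
      Consistent P f deg' lev' 0 ∧
      P.potential f deg' lev' ≤ P.potential f deg lev) s := by
  have h5 := hC.five_le y
  have hL := hC.lt_L y
  have hM' := hM.setDeg y (deg y - 1)
  have hthr := hM.thr (lev y) (by omega) (by omega)
  simp only [lower, wp_block_cons, wp_block_nil, wp_istore, wp_ite, wp_skip, IExpr.cost,
    BExpr.cost, RExpr.cost, IExpr.eval, RExpr.eval, BExpr.eval, State.setIarr_iarr,
    State.setIarr_rarr, State.setIarr_ivar, hy, hl, hthr, hM.w, hM.deg, if_true,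
    Function.update_self]
  refine ⟨fun hd => ?_, fun hd => ?_⟩
  · push_cast at hd
    refine ⟨by norm_num, _, _, hM', hC.lower hhigh hd, ?_⟩
    have := potential_update P f deg lev y (deg y - 1) (lev y)
    rw [Function.update_eq_self] at this
    rw [this]
    linarith [hC.charge_lower y]
  · refine (wp_levelDown (y := y) (by simpa using hy) hM'.w hM'.sorted (by omega)).mono ?_
    rintro s' t ⟨ht, h1, h2⟩
    push_cast at hd
    refine ⟨by omega, _, _, hM'.levelStep h1 h2, hC.lower_down hhigh hout (not_le.1 hd), ?_⟩
    rw [potential_update]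
    linarith [hC.charge_lower_down y]

end

end RealRAM

/-! ### Orientations under insertion and deletion of an edge -/

namespace RealRAM

section

variable {n : ℕ} {P : Parameters n} {f : Fin n → Fin n → Option ℤ} {deg lev pend : Fin n → ℤ}
  {s : State} {G G' : SimpleGraph (Fin n)}

theorem Orients.add (h : Orients G f) {a b : Fin n} {j : ℤ} (hab : a ≠ b) (hG : ¬ G.Adj a b)
    (hG' : ∀ x y, G'.Adj x y ↔ G.Adj x y ∨ (x = a ∧ y = b) ∨ (x = b ∧ y = a)) :
    Orients G' (upd f a b (some j)) := by
  rw [h.adj, not_or, not_not, not_not] at hG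
  constructor
  · intro u v
    rw [hG', h.adj]
    simp only [upd]
    by_cases h1 : u = a <;> by_cases h2 : v = b <;> by_cases h3 : u = b <;>
      by_cases h4 : v = a <;> simp_all
  · intro u v
    have := h.asymm u v
    simp only [upd]
    by_cases h1 : u = a <;> by_cases h2 : v = b <;> by_cases h3 : u = b <;>
      by_cases h4 : v = a <;> simp_all

theorem Orients.remove (h : Orients G f) {a b : Fin n} {j : ℤ} (hab : f a b = some j)
    (hG' : ∀ x y, G'.Adj x y ↔ G.Adj x y ∧ ¬ ((x = a ∧ y = b) ∨ (x = b ∧ y = a))) :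
    Orients G' (upd f a b none) := by
  have hba : f b a = none := h.asymm a b (by simp [hab])
  have hne : a ≠ b := by rintro rfl; simp [hab] at hba
  constructor
  · intro u v
    rw [hG', h.adj]
    simp only [upd]
    by_cases h1 : u = a <;> by_cases h2 : v = b <;> by_cases h3 : u = b <;>
      by_cases h4 : v = a <;> simp_all
  · intro u v
    have := h.asymm u v
    simp only [upd]
    by_cases h1 : u = a <;> by_cases h2 : v = b <;> by_cases h3 : u = b <;>
      by_cases h4 : v = a <;> simp_all

theorem sup_edge_adj {u v : Fin n} (huv : u ≠ v) (x y : Fin n) :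
    (G ⊔ SimpleGraph.edge u v).Adj x y ↔ G.Adj x y ∨ (x = u ∧ y = v) ∨ (x = v ∧ y = u) := by
  rw [SimpleGraph.sup_adj, SimpleGraph.edge_adj]
  grind

theorem deleteEdge_adj {u v : Fin n} (x y : Fin n) :
    (G.deleteEdges {s(u, v)}).Adj x y ↔
      G.Adj x y ∧ ¬ ((x = u ∧ y = v) ∨ (x = v ∧ y = u)) := by
  simp [SimpleGraph.deleteEdges_adj]

/-! ### The dense subgraph -/

/-- The list of the first `c` vertices in the order by level ends at a cut level: the `k` cuts at
the steps of three levels above are larger by a factor of `1 + ε / 4` each. -/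
def CutAt (P : Parameters n) (lev : Fin n → ℤ) (c : ℤ) : Prop :=
  ∃ (i : ℤ) (k : ℕ), 3 ≤ i ∧ c = ({v | i - 3 ≤ lev v} : Finset (Fin n)).card ∧
    (∀ v, lev v ≤ i + 3 * k) ∧ (∃ v, lev v = i + 3 * k) ∧
    (1 + P.eps / 4) ^ k ≤ ∑ v, P.w v ∧
    ∑ v with i - 3 ≤ lev v, P.w v ≤ (1 + P.eps / 4) * ∑ v with i ≤ lev v, P.w v

/-- Find the cut level. The number of vertices above it is stored in variable 4. -/
def cut : Prog := block [
  .iassign 10 (.get 7 (.get 1 (.const 0))),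
  .while (.not (.rle (.get 2 (.sub (.var 10) (.const 3)))
      (.mul (.add (.const 1) (.mul (.const (1 / 4)) (.var 0))) (.get 2 (.var 10)))))
    (.iassign 10 (.sub (.var 10) (.const 3))),
  .iassign 4 (.get 3 (.sub (.var 10) (.const 3)))]

/-- The first vertex of the sorted list has the top level. Each failed test gains a factor `1 + ε /
4` in weight, starting from at least 1. The steps have length three because this is how far the head
of an arc may be above its tail. -/
theorem wp_cut (hM : Mem P f deg lev s) (h5 : ∀ v, 5 ≤ lev v) (hL : ∀ v, lev v < P.L)
    (hn : 0 < n) (heps : 0 < P.eps) :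
    Wp cut (fun s' t => Mem P f deg lev s' ∧ CutAt P lev (s'.ivar 4) ∧
      (t : ℤ) ≤ 100 * P.L) s := by
  obtain ⟨v₀, hv₀⟩ := hM.sorted.by_lev.inv.surj 0 le_rfl (by exact_mod_cast hn)
  have hord : s.iarr 1 0 = (v₀ : ℕ) := by rw [← hv₀, hM.sorted.by_lev.inv.ord_pos]
  have hmax : ∀ v, lev v ≤ lev v₀ := fun v => by
    have h1 := (hM.sorted.by_lev.below v (lev v) (by linarith [h5 v])).2 le_rfl
    have h2 := hM.sorted.by_lev.inv.nonneg v
    exact (hM.sorted.by_lev.below v₀ (lev v) (by linarith [h5 v])).1 (by omega)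
  have hws := fun i h0 => hM.sorted.by_lev.ws_eq i h0
  have hbnd := fun i h0 => hM.sorted.by_lev.bnd_eq i h0
  have hw0 : ∀ v, 0 ≤ P.w v := fun v => zero_le_one.trans (P.one_le_w v)
  have hv5 := h5 v₀
  have hvL := hL v₀
  simp only [cut, wp_block_cons, wp_block_nil, wp_iassign, IExpr.cost, IExpr.eval, hord,
    hM.sorted.lev]
  refine wp_while (fun m s' t => ∃ (i : ℤ) (k : ℕ), Mem P f deg lev s' ∧ s'.ivar 10 = i ∧ 3 ≤ i ∧
    s'.rarr 2 = s.rarr 2 ∧ s'.iarr 3 = s.iarr 3 ∧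
    i + 3 * k = lev v₀ ∧ (m : ℤ) = i ∧ (t : ℤ) ≤ 30 * k ∧
    (1 + P.eps / 4) ^ k ≤ ∑ v with i ≤ lev v, P.w v) ?_ ?_ (k := (lev v₀).toNat) ?_
  · rintro m s' t ⟨i, k, hM', hi, hi3, hr, hb, hk, hm, ht, hpow⟩ hcond
    simp only [BExpr.eval, RExpr.eval, IExpr.eval, hi, hr, hM'.eps, hws i (by omega),
      hws (i - 3) (by omega), not_le] at hcond
    push_cast at hcond
    -- At a level of at most 5 both level sets consist of all vertices and the test succeeds. Hence
    -- the search stops at a level of at least 3, and the index `i - 3` is never negative.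
    have h6 : 6 ≤ i := by
      by_contra! h6
      have e : ∀ j ≤ 5, ({v | j ≤ lev v} : Finset (Fin n)) = Finset.univ := fun j hj => by
        ext v
        simpa using hj.trans (h5 v)
      rw [e i (by omega), e (i - 3) (by omega)] at hcond
      have : 0 ≤ ∑ v, P.w v := Finset.sum_nonneg fun v _ => hw0 v
      nlinarith
    simp only [wp_iassign, IExpr.eval, BExpr.cost, RExpr.cost, IExpr.cost, hi]
    refine ⟨m - 3, by omega, i - 3, k + 1, hM'.setIvar (by norm_num) _, by simp, by omega,
      by simp [hr], by simp [hb], by push_cast; omega, by omega, by push_cast; omega, ?_⟩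
    rw [pow_succ]
    calc (1 + P.eps / 4) ^ k * (1 + P.eps / 4)
        ≤ (∑ v with i ≤ lev v, P.w v) * (1 + P.eps / 4) := by gcongr
      _ ≤ _ := by linarith
  · rintro m s' t ⟨i, k, hM', hi, hi3, hr, hb, hk, hm, ht, hpow⟩ hcond
    simp only [BExpr.eval, RExpr.eval, IExpr.eval, hi, hr, hM'.eps, hws i (by omega),
      hws (i - 3) (by omega), not_not] at hcond
    push_cast at hcond
    simp only [BExpr.cost, RExpr.cost, IExpr.cost, hi, hb, hbnd (i - 3) (by omega)]
    refine ⟨hM'.setIvar (by norm_num) _, ⟨i, k, hi3, by simp, fun v => hk ▸ hmax v, ⟨v₀, hk.symm⟩,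
      hpow.trans (Finset.sum_le_sum_of_subset_of_nonneg (Finset.filter_subset _ _)
        fun v _ _ => hw0 v), by linarith⟩, ?_⟩
    push_cast
    omega
  · refine ⟨lev v₀, 0, hM.setIvar (by norm_num) _, by simp, by omega, by simp, by simp, by simp,
      by omega, by simp, ?_⟩
    rw [pow_zero]
    exact (P.one_le_w v₀).trans (Finset.single_le_sum (f := P.w) (fun v _ => hw0 v) (by simp))

/-! ### Updates -/

/-- The memory state between two operations, for the current graph `G`; `p` is the potential. -/
def Good (P : Parameters n) (G : SimpleGraph (Fin n)) (s : State) (p : ℝ) : Prop :=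
  ∃ f deg lev, Mem P f deg lev s ∧ Consistent P f deg lev 0 ∧ Orients G f ∧
    CutAt P lev (s.ivar 4) ∧ p = P.potential f deg lev

/-- Insert the edge between the vertices in the variables 2 and 3. -/
def insertEdge : Prog := block [
  .ite (.ile (.get 7 (.var 2)) (.get 7 (.var 3)))
    (block [.iassign 20 (.var 3), .iassign 21 (.var 2)])
    (block [.iassign 20 (.var 2), .iassign 21 (.var 3)]),
  .iassign 10 (.var 21), .iassign 22 (.get 7 (.var 21)), addArc, push, raise]

/-- Delete the edge between the vertices in the variables 2 and 3. -/
def deleteEdge : Prog := block [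
  .ite (.ieq (.get 0 (.add (.get 4 (.var 2)) (.var 3))) (.const 1))
    (block [.iassign 20 (.var 2), .iassign 21 (.var 3)])
    (block [.iassign 20 (.var 3), .iassign 21 (.var 2)]),
  .iassign 10 (.var 21), removeArc, pull, relax, lower]

/-- Process an edge update. -/
def update : Prog := block [.ite (.ieq (.var 1) (.const 1)) insertEdge deleteEdge, cut]

/-- The insertion after the choice of the orientation. -/
theorem wp_insertArc {a b : Fin n} (hM : Mem P f deg lev s) (hC : Consistent P f deg lev 0)
    (hG : Orients G f) (ha : s.ivar 20 = (a : ℕ)) (hb : s.ivar 21 = (b : ℕ)) (hab : a ≠ b)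
    (hadj : ¬ G.Adj a b) (hl : lev b ≤ lev a)
    (hG' : ∀ x y, G'.Adj x y ↔ G.Adj x y ∨ (x = a ∧ y = b) ∨ (x = b ∧ y = a)) :
    Wp (block [.iassign 10 (.var 21), .iassign 22 (.get 7 (.var 21)), addArc, push, raise])
      (fun s' t => ∃ f' deg' lev', Mem P f' deg' lev' s' ∧ Consistent P f' deg' lev' 0 ∧
        Orients G' f' ∧
        t + 400 * P.potential f' deg' lev' ≤ 400 * P.potential f deg lev + 600 * (P.L + P.K) ∧
        (t : ℤ) ≤ 700 * (P.L * P.K)) s := by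
  have hK := P.two_le_K'
  have hLb := hC.lt_L b
  have h5b := hC.five_le b
  have hfab : f a b = none := by
    rw [hG.adj, not_or, not_not] at hadj
    exact hadj.1
  simp only [wp_block_cons, wp_block_nil, wp_iassign, IExpr.cost, IExpr.eval]
  refine (wp_addArc_mem (u := a) (v := b) (j := lev b) ((hM.setIvar (by norm_num) _).setIvar
    (by norm_num) _) (by simp [ha]) (by simp [hb]) (by simp [hb, hM.sorted.lev]) (by omega)
    (by omega) hfab).mono ?_
  rintro s₁ t₁ ⟨ht₁, h₁, e₁⟩
  have hC₁ := hC.add hfab (by omega)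
  rw [zero_add] at hC₁
  refine (wp_push h₁ hC₁ (hG.add hab hadj hG') (by simp [e₁, hb])).mono ?_
  rintro s₂ t₂ ⟨f₂, y, h₂, hC₂, hG₂, hy, hly, hlow, ht₂, ht₂'⟩
  refine (wp_raise h₂ hC₂ hy hly hlow).mono ?_
  rintro s₃ t₃ ⟨ht₃, deg', lev', h₃, hC₃, hp⟩
  refine ⟨f₂, deg', lev', h₃, hC₃, hG₂, ?_, ?_⟩
  · rw [labelSum_upd, hfab] at ht₂
    simp only [Option.getD_some, Option.getD_none] at ht₂
    have h5y := hC₂.five_le y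
    -- The label `lev b` of the new arc cancels the level of the vertex where the search starts, and
    -- the level of the final vertex has a favourable sign.
    have ht : ((1 + 1 + (1 + 1 + 1 + (t₁ + (t₂ + (t₃ + 1))) ) : ℕ) : ℤ) ≤
        400 * (labelSum f₂ - labelSum f) + 300 := by push_cast; omega
    have ht' : ((1 + 1 + (1 + 1 + 1 + (t₁ + (t₂ + (t₃ + 1)))) : ℕ) : ℝ) ≤
        400 * (labelSum f₂ - labelSum f) + 300 := by exact_mod_cast ht
    have hpot : P.potential f₂ deg lev = P.potential f deg lev + labelSum f - labelSum f₂ := by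
      unfold Parameters.potential; ring
    have hL6 : (6 : ℝ) ≤ P.L := by exact_mod_cast (by omega : 6 ≤ P.L)
    have hK2 := P.two_le_K
    rw [hpot] at hp
    linarith
  · have h6 : 6 ≤ P.L := by omega
    have h7 : lev b * (P.K + 1) + P.K ≤ P.L * P.K + P.L := by nlinarith
    have h8 : 2 * P.L ≤ P.L * P.K := by nlinarith
    push_cast
    omega

/-- The deletion after the orientation of the edge has been found. -/
theorem wp_deleteArc {a b : Fin n} {j : ℤ} (hM : Mem P f deg lev s) (hC : Consistent P f deg lev 0)
    (hG : Orients G f) (ha : s.ivar 20 = (a : ℕ)) (hb : s.ivar 21 = (b : ℕ)) (hab : f a b = some j)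
    (hG' : ∀ x y, G'.Adj x y ↔ G.Adj x y ∧ ¬ ((x = a ∧ y = b) ∨ (x = b ∧ y = a))) :
    Wp (block [.iassign 10 (.var 21), removeArc, pull, relax, lower])
      (fun s' t => ∃ f' deg' lev', Mem P f' deg' lev' s' ∧ Consistent P f' deg' lev' 0 ∧
        Orients G' f' ∧
        t + 400 * P.potential f' deg' lev' ≤ 400 * P.potential f deg lev + 1700 * (P.L + P.K) ∧
        (t : ℤ) ≤ 700 * (P.L * P.K)) s := by
  have hK := P.two_le_K'
  have hLb := hC.lt_L b
  have h5b := hC.five_le b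
  have hj0 := hC.le_label a b j hab
  have hj1 := hC.label_le' a b j hab
  simp only [wp_block_cons, wp_block_nil, wp_iassign, IExpr.cost, IExpr.eval]
  refine (wp_removeArc_mem (u := a) (v := b) (j := j) (hM.setIvar (by norm_num) _) (by simp [ha])
    (by simp [hb]) (by omega) (by omega) hab).mono ?_
  rintro s₁ t₁ ⟨ht₁, h₁, e₁⟩
  have hC₁ := hC.remove hab
  rw [zero_sub, ← Pi.single_neg] at hC₁
  refine (wp_pull h₁ hC₁ (hG.remove hab hG') (by simp [e₁, hb])).mono ?_
  rintro s₂ t₂ ⟨f₂, y, h₂, hC₂, hG₂, hy, hly, hout, hs₂, ht₂⟩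
  refine (wp_relax h₂ hC₂ hG₂ hy hly hout).mono ?_
  rintro s₃ t₃ ⟨f₃, h₃, hC₃, hG₃, hy₃, hly₃, hout₃, hhigh, hs₃, ht₃⟩
  refine (wp_lower h₃ hC₃ hy₃ hly₃ hout₃ hhigh).mono ?_
  rintro s₄ t₄ ⟨ht₄, deg', lev', h₄, hC₄, hp⟩
  rw [labelSum_upd, hab] at hs₂
  simp only [Option.getD_some, Option.getD_none] at hs₂
  refine ⟨f₃, deg', lev', h₄, hC₄, hG₃, ?_, ?_⟩
  · have ht : ((1 + 1 + (t₁ + (t₂ + (t₃ + (t₄ + 1)))) : ℕ) : ℤ) ≤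
        400 * (P.L + P.K) + 400 := by push_cast; omega
    have ht' : ((1 + 1 + (t₁ + (t₂ + (t₃ + (t₄ + 1)))) : ℕ) : ℝ) ≤
        400 * (P.L + P.K) + 400 := by exact_mod_cast ht
    have hpot : P.potential f₃ deg lev = P.potential f deg lev + labelSum f - labelSum f₃ := by
      unfold Parameters.potential; ring
    -- The deleted arc accounts for one `L`, the reversals for two, and the lowered labels for `K`.
    have hsum : labelSum f - labelSum f₃ ≤ 3 * P.L + P.K := by omega
    have hsum' : (labelSum f - labelSum f₃ : ℝ) ≤ 3 * P.L + P.K := by exact_mod_cast hsum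
    have hL6 : (6 : ℝ) ≤ P.L := by exact_mod_cast (by omega : 6 ≤ P.L)
    have hK2 := P.two_le_K
    rw [hpot] at hp
    linarith
  · have h6 : 6 ≤ P.L := by omega
    have h8 : 2 * P.L ≤ P.L * P.K := by nlinarith
    have h9 : 6 * P.K ≤ P.L * P.K := by nlinarith
    push_cast
    omega

theorem Good.setIvar {p : ℝ} (h : Good P G s p) {x : ℕ} (hx : x ≠ 4 ∧ x ≠ 5) (k : ℤ) :
    Good P G (s.setIvar x k) p := by
  obtain ⟨f, deg, lev, hM, hC, hG, hc, hp⟩ := h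
  exact ⟨f, deg, lev, hM.setIvar hx.2 k, hC, hG, by simpa [hx.1.symm] using hc, hp⟩

/-- The effect of an update on the potential `p`, and its running time. -/
def UpdatePost (P : Parameters n) (G : SimpleGraph (Fin n)) (p : ℝ) (s : State) (t : ℕ) : Prop :=
  ∃ p', Good P G s p' ∧ t + 400 * p' ≤ 400 * p + 2000 * (P.L + P.K) ∧
    (t : ℤ) ≤ 800 * (P.L * P.K)

theorem wp_update (hn : 0 < n) (heps : 0 < P.eps) {p : ℝ} (h : Good P G s p) (x : EdgeUpdate n)
    (hx : x.Valid G) :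
    Wp update (UpdatePost P (x.apply G) p) (x.handOver s) := by
  obtain ⟨f, deg, lev, hM, hC, hG, -, rfl⟩ := h
  have hK := P.two_le_K'
  have hL6 : 6 ≤ P.L := by
    have := hC.five_le ⟨0, hn⟩
    have := hC.lt_L ⟨0, hn⟩
    omega
  have finish : ∀ (s₁ : State) (t₁ : ℕ), (∃ f' deg' lev', Mem P f' deg' lev' s₁ ∧
      Consistent P f' deg' lev' 0 ∧ Orients (x.apply G) f' ∧
      t₁ + 400 * P.potential f' deg' lev' ≤ 400 * P.potential f deg lev + 1800 * (P.L + P.K) ∧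
      (t₁ : ℤ) ≤ 740 * (P.L * P.K)) →
      Wp cut (fun s' t => UpdatePost P (x.apply G) (P.potential f deg lev) s' (t₁ + (t + 1)))
        s₁ := by
    rintro s₁ t₁ ⟨f', deg', lev', hM', hC', hG', hp, ht⟩
    refine (wp_cut hM' hC'.five_le hC'.lt_L hn heps).mono ?_
    rintro s₂ t₂ ⟨hM₂, hc, ht₂⟩
    refine ⟨_, ⟨f', deg', lev', hM₂, hC', hG', hc, rfl⟩, ?_, ?_⟩
    · have : (t₂ : ℝ) ≤ 100 * P.L := by exact_mod_cast ht₂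
      have h6 : (6 : ℝ) ≤ P.L := by exact_mod_cast hL6
      have := P.two_le_K
      push_cast
      linarith
    · have h8 : 2 * P.L ≤ P.L * P.K := by nlinarith
      push_cast
      omega
  -- The `c` steps that choose the orientation are absorbed by the gaps between 1700 and 1800 and
  -- between 700 and 740.
  have step : ∀ (q : Prog) (s₁ : State) (c : ℕ) (C : ℝ), c ≤ 30 → C ≤ 1700 →
      Wp q (fun s' t => ∃ f' deg' lev', Mem P f' deg' lev' s' ∧ Consistent P f' deg' lev' 0 ∧
        Orients (x.apply G) f' ∧
        t + 400 * P.potential f' deg' lev' ≤ 400 * P.potential f deg lev + C * (P.L + P.K) ∧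
        (t : ℤ) ≤ 700 * (P.L * P.K)) s₁ →
      Wp q (fun s' t => ∃ f' deg' lev', Mem P f' deg' lev' s' ∧ Consistent P f' deg' lev' 0 ∧
        Orients (x.apply G) f' ∧
        (c + t : ℕ) + 400 * P.potential f' deg' lev' ≤
          400 * P.potential f deg lev + 1800 * (P.L + P.K) ∧
        ((c + t : ℕ) : ℤ) ≤ 740 * (P.L * P.K)) s₁ := by
    intro q s₁ c C hc hC h
    refine h.mono ?_
    rintro s₂ t₂ ⟨f', deg', lev', hM', hC', hG', hp, ht⟩
    refine ⟨f', deg', lev', hM', hC', hG', ?_, ?_⟩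
    · have h6 : (6 : ℝ) ≤ P.L := by exact_mod_cast hL6
      have := P.two_le_K
      have hc' : (c : ℝ) ≤ 30 := by exact_mod_cast hc
      push_cast
      nlinarith
    · have h8 : 2 * P.L ≤ P.L * P.K := by nlinarith
      push_cast
      omega
  have ins : ∀ (s₁ : State) (c : ℕ) (a b : Fin n), c ≤ 30 → Mem P f deg lev s₁ →
      s₁.ivar 20 = (a : ℕ) → s₁.ivar 21 = (b : ℕ) → a ≠ b → ¬ G.Adj a b → lev b ≤ lev a →
      (∀ y z, (x.apply G).Adj y z ↔ G.Adj y z ∨ (y = a ∧ z = b) ∨ (y = b ∧ z = a)) →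
      Wp (block [.iassign 10 (.var 21), .iassign 22 (.get 7 (.var 21)), addArc, push, raise])
        (fun s' t => Wp cut (fun s'' t' => UpdatePost P (x.apply G) (P.potential f deg lev) s''
          (c + t + (t' + 1))) s') s₁ :=
    fun s₁ c a b hc hM₁ ha hb hab hadj hl hG' => (step _ s₁ c 600 hc (by norm_num)
      (wp_insertArc hM₁ hC hG ha hb hab hadj hl hG')).mono fun s' t h => finish s' (c + t) h
  have del : ∀ (s₁ : State) (c : ℕ) (a b : Fin n), c ≤ 30 → Mem P f deg lev s₁ →
      s₁.ivar 20 = (a : ℕ) → s₁.ivar 21 = (b : ℕ) → f a b ≠ none →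
      (∀ y z, (x.apply G).Adj y z ↔ G.Adj y z ∧ ¬ ((y = a ∧ z = b) ∨ (y = b ∧ z = a))) →
      Wp (block [.iassign 10 (.var 21), removeArc, pull, relax, lower])
        (fun s' t => Wp cut (fun s'' t' => UpdatePost P (x.apply G) (P.potential f deg lev) s''
          (c + t + (t' + 1))) s') s₁ := by
    intro s₁ c a b hc hM₁ ha hb hab hG'
    obtain ⟨j, hj⟩ := Option.ne_none_iff_exists'.1 hab
    exact (step _ s₁ c 1700 hc le_rfl (wp_deleteArc hM₁ hC hG ha hb hj hG')).mono
      fun s' t h => finish s' (c + t) h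
  rw [update, wp_block_cons]
  cases x with
  | insert u v =>
    obtain ⟨huv, hadj⟩ := hx
    have hM₀ : Mem P f deg lev ((EdgeUpdate.insert u v).handOver s) :=
      ((hM.setIvar (by norm_num) _).setIvar (by norm_num) _).setIvar (by norm_num) _
    have hadj' : ¬ G.Adj v u := fun h => hadj h.symm
    have hG' := sup_edge_adj (G := G) huv
    refine wp_ite.2 ⟨fun _ => ?_, fun h => absurd (by simp [BExpr.eval, IExpr.eval,
      EdgeUpdate.handOver]) h⟩
    rw [insertEdge, wp_block_cons]
    refine wp_ite.2 ⟨fun h => ?_, fun h => ?_⟩ <;>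
      simp [BExpr.eval, IExpr.eval, EdgeUpdate.handOver, hM.sorted.lev] at h <;>
      rw [wp_block_cons, wp_iassign, wp_block_cons, wp_iassign, wp_block_nil]
    -- Here 15 is 4 for the distinction between insertion and deletion plus 11 for comparing the
    -- levels and fixing the direction. The corresponding number for a deletion is 17, as a matrix
    -- entry is tested.
    · refine (ins _ 15 v u (by norm_num) ((hM₀.setIvar (by norm_num) _).setIvar (by norm_num) _)
        (by simp [EdgeUpdate.handOver, IExpr.eval]) (by simp [EdgeUpdate.handOver, IExpr.eval])
        huv.symm hadj' h fun y z => (hG' y z).trans (by tauto)).mono fun s' t h => ?_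
      rw [wp_block_cons]
      refine h.mono fun s'' t' h => ?_
      rw [wp_block_nil]
      convert h using 1
      simp only [BExpr.cost, IExpr.cost]
      omega
    · refine (ins _ 15 u v (by norm_num) ((hM₀.setIvar (by norm_num) _).setIvar (by norm_num) _)
        (by simp [EdgeUpdate.handOver, IExpr.eval]) (by simp [EdgeUpdate.handOver, IExpr.eval])
        huv hadj h.le hG').mono fun s' t h => ?_
      rw [wp_block_cons]
      refine h.mono fun s'' t' h => ?_
      rw [wp_block_nil]
      convert h using 1
      simp only [BExpr.cost, IExpr.cost]
      omega
  | delete u v =>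
    have hadj : G.Adj u v := hx
    have hM₀ : Mem P f deg lev ((EdgeUpdate.delete u v).handOver s) :=
      ((hM.setIvar (by norm_num) _).setIvar (by norm_num) _).setIvar (by norm_num) _
    have hG' := deleteEdge_adj (G := G) (u := u) (v := v)
    have hmat := hM.arcs.mat u v
    refine wp_ite.2 ⟨fun h => absurd h (by simp [BExpr.eval, IExpr.eval, EdgeUpdate.handOver]),
      fun _ => ?_⟩
    rw [deleteEdge, wp_block_cons]
    rw [entry] at hmat
    refine wp_ite.2 ⟨fun h => ?_, fun h => ?_⟩ <;>
      simp [BExpr.eval, IExpr.eval, EdgeUpdate.handOver, hM.tab.row, hmat] at h <;>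
      rw [wp_block_cons, wp_iassign, wp_block_cons, wp_iassign, wp_block_nil]
    · refine (del _ 17 u v (by norm_num) ((hM₀.setIvar (by norm_num) _).setIvar (by norm_num) _)
        (by simp [EdgeUpdate.handOver, IExpr.eval]) (by simp [EdgeUpdate.handOver, IExpr.eval])
        h hG').mono fun s' t h => ?_
      rw [wp_block_cons]
      refine h.mono fun s'' t' h => ?_
      rw [wp_block_nil]
      convert h using 1
      simp only [BExpr.cost, IExpr.cost]
      omega
    · refine (del _ 17 v u (by norm_num) ((hM₀.setIvar (by norm_num) _).setIvar (by norm_num) _)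
        (by simp [EdgeUpdate.handOver, IExpr.eval]) (by simp [EdgeUpdate.handOver, IExpr.eval])
        (((hG.adj u v).1 hadj).resolve_left (by simpa using h))
        fun y z => (hG' y z).trans (by tauto)).mono fun s' t h => ?_
      rw [wp_block_cons]
      refine h.mono fun s'' t' h => ?_
      rw [wp_block_nil]
      convert h using 1
      simp only [BExpr.cost, IExpr.cost]
      omega

end

end RealRAM

/-! ### Linear programming duality -/

section Duality

variable {V : Type*} [Fintype V] {G : SimpleGraph V} {w : V → ℝ}

/-- Weak duality: the minimum over an edge is at most the value at the head of its arc. Summed by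
heads, this is the sum of `load v * (w v * x v)`, which feasibility bounds by `c`. -/
theorem lpObjective_le {D : V → V → Prop} (hD : IsOrientation G D) (hw : ∀ v, 0 < w v) {c : ℝ}
    (hc : ∀ v, load w D v ≤ c) (hc0 : 0 ≤ c) {x : V → ℝ} (hx : LpFeasible w x) :
    lpObjective G x ≤ c := by
  classical
  have hsum : lpObjective G x = ∑ p : V × V with D p.1 p.2, ((s(p.1, p.2) : Sym2 V).map x).inf := by
    unfold lpObjective
    symm
    refine Finset.sum_bij (fun p _ => s(p.1, p.2)) (fun p hp => ?_) (fun p hp q hq e => ?_)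
      (fun e he => ?_) (fun _ _ => rfl)
    · simpa using hD.1 _ _ (Finset.mem_filter.1 hp).2
    · have h1 := (Finset.mem_filter.1 hp).2
      have h2 := (Finset.mem_filter.1 hq).2
      rcases Sym2.eq_iff.1 e with ⟨a, b⟩ | ⟨a, b⟩
      · exact Prod.ext a b
      · rw [← a, ← b] at h2
        rcases hD.2 _ _ (hD.1 _ _ h1) with h | h
        · exact absurd h2 h.2
        · exact absurd h1 h.2
    · induction e with
      | _ a b =>
        have hab : G.Adj a b := by simpa using he
        rcases hD.2 _ _ hab with h | h
        · exact ⟨(a, b), by simpa using h.1, rfl⟩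
        · exact ⟨(b, a), by simpa using h.1, Sym2.eq_swap⟩
  have hcol : ∀ v, ∑ u, (if D u v then x v else 0) = load w D v * (w v * x v) := fun v => by
    rw [← Finset.sum_filter, Finset.sum_const, nsmul_eq_mul, load, Set.ncard_eq_toFinset_card',
      Set.toFinset_ofPred]
    field_simp [(hw v).ne']
  calc lpObjective G x ≤ ∑ p : V × V with D p.1 p.2, x p.2 := by
        rw [hsum]
        exact Finset.sum_le_sum fun p _ => by simp
    _ = ∑ v, ∑ u, if D u v then x v else 0 := by
        rw [Finset.sum_filter, Fintype.sum_prod_type_right]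
    _ ≤ ∑ v, c * (w v * x v) := Finset.sum_le_sum fun v _ => by
        rw [hcol]
        exact mul_le_mul_of_nonneg_right (hc v) (mul_nonneg (hw v).le (hx.1 v))
    _ ≤ c := by
        rw [← Finset.mul_sum]
        exact mul_le_of_le_one_right hc0 hx.2

theorem optLP_le {D : V → V → Prop} (hD : IsOrientation G D) (hw : ∀ v, 0 < w v) {c : ℝ}
    (hc : ∀ v, load w D v ≤ c) (hc0 : 0 ≤ c) : optLP G w ≤ c := by
  refine csSup_le ⟨_, 0, ⟨fun _ => le_rfl, by simp⟩, rfl⟩ ?_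
  rintro _ ⟨x, hx, rfl⟩
  exact lpObjective_le hD hw hc hc0 hx

/-- The indicator function of `S` divided by the weight of `S` is feasible, and its objective value
is at least the density of `S`. -/
theorem density_le_optLP {D : V → V → Prop} (hD : IsOrientation G D) (hw : ∀ v, 0 < w v) {c : ℝ}
    (hc : ∀ v, load w D v ≤ c) (hc0 : 0 ≤ c) {S : Finset V} (hS : S.Nonempty) :
    density G w S ≤ optLP G w := by
  classical
  have hW : 0 < ∑ v ∈ S, w v := Finset.sum_pos (fun v _ => hw v) hS
  -- A supremum in `ℝ` bounds its set only if the set is bounded above; this is the sole purpose of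
  -- the orientation here.
  have hbdd : BddAbove (lpObjective G '' {x | LpFeasible w x}) := by
    refine ⟨c, ?_⟩
    rintro _ ⟨x, hx, rfl⟩
    exact lpObjective_le hD hw hc hc0 hx
  set x : V → ℝ := fun v => if v ∈ S then (∑ v ∈ S, w v)⁻¹ else 0 with hx
  have hx0 : ∀ v, 0 ≤ x v := fun v => by
    simp only [hx]
    split_ifs
    · exact inv_nonneg.2 hW.le
    · exact le_rfl
  refine le_trans ?_ (le_csSup hbdd ⟨x, ⟨hx0, ?_⟩, rfl⟩)
  · have hE : {e ∈ G.edgeSet | ∀ x ∈ e, x ∈ S} =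
        ({e ∈ G.edgeFinset | ∀ x ∈ e, x ∈ S} : Finset (Sym2 V)) := by
      ext e; simp
    rw [density, hE, Set.ncard_coe_finset, div_eq_mul_inv, ← nsmul_eq_mul, ← Finset.sum_const,
      Finset.sum_filter, lpObjective]
    refine Finset.sum_le_sum fun e _ => ?_
    induction e with
    | _ a b =>
      split_ifs with h
      · have ha : a ∈ S := h a (by simp)
        have hb : b ∈ S := h b (by simp)
        simp [hx, ha, hb]
      · simpa using ⟨hx0 a, hx0 b⟩
  · simp only [hx, mul_ite, mul_zero]
    rw [← Finset.sum_filter, ← Finset.sum_mul]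
    simp [hW.ne']

end Duality

/-! ### From the memory state to loads, densities and the listed set -/

namespace RealRAM

section

variable {n : ℕ} {P : Parameters n} {f : Fin n → Fin n → Option ℤ} {deg lev pend : Fin n → ℤ}
  {s : State} {G : SimpleGraph (Fin n)}

theorem storedArc_iff (hM : Mem P f deg lev s) (u v : Fin n) :
    DynAlg.storedArc s u v ↔ f u v ≠ none := by
  have h := hM.arcs.mat u v
  rw [entry] at h
  rw [DynAlg.storedArc]
  push_cast
  rw [h]
  cases f u v <;> simp

theorem isOrientation_storedArc (hM : Mem P f deg lev s) (hG : Orients G f) :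
    IsOrientation G (DynAlg.storedArc s) := by
  refine ⟨fun u v h => ?_, fun u v h => ?_⟩
  · rw [storedArc_iff hM] at h
    exact (hG.adj u v).2 (.inl h)
  · rw [storedArc_iff hM, storedArc_iff hM]
    have h1 := (hG.adj u v).1 h
    have h2 := hG.asymm u v
    have h3 := hG.asymm v u
    unfold Xor
    tauto

theorem load_storedArc (hM : Mem P f deg lev s) (hC : Consistent P f deg lev 0) (v : Fin n) :
    load P.w (DynAlg.storedArc s) v = deg v / P.w v := by
  have h := hC.card v
  rw [Pi.zero_apply, add_zero] at h
  have e : {u | DynAlg.storedArc s u v} = (({u | f u v ≠ none} : Finset (Fin n)) : Set (Fin n)) := by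
    ext u
    simp [storedArc_iff hM]
  rw [load, e, Set.ncard_coe_finset, ← h, Int.cast_natCast]

/-- Arcs with head in `S` are edges inside `T`, and distinct arcs are distinct edges because no edge
is oriented both ways. -/
theorem sum_deg_le (hC : Consistent P f deg lev 0) (hG : Orients G f) {S T : Finset (Fin n)}
    (hST : ∀ u v, f u v ≠ none → v ∈ S → u ∈ T ∧ v ∈ T) :
    ∑ v ∈ S, (deg v : ℝ) ≤ ({e ∈ G.edgeSet | ∀ x ∈ e, x ∈ T}.ncard : ℝ) := by
  classical
  set A : Finset ((_ : Fin n) × Fin n) := S.sigma fun v => {u | f u v ≠ none} with hA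
  have h1 : ∑ v ∈ S, (deg v : ℝ) = A.card := by
    rw [hA, Finset.card_sigma]
    push_cast
    refine Finset.sum_congr rfl fun v _ => ?_
    have h := hC.card v
    rw [Pi.zero_apply, add_zero] at h
    exact_mod_cast h.symm
  rw [h1]
  have h2 : A.card = (A.image fun p => s(p.2, p.1)).card := by
    rw [Finset.card_image_of_injOn]
    rintro ⟨v, u⟩ hp ⟨v', u'⟩ hq e
    have hp' : f u v ≠ none := by simpa using (Finset.mem_sigma.1 hp).2
    have hq' : f u' v' ≠ none := by simpa using (Finset.mem_sigma.1 hq).2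
    rcases Sym2.eq_iff.1 e with ⟨a, b⟩ | ⟨a, b⟩
    · simp only at a b
      rw [a, b]
    · simp only at a b
      rw [← a, ← b] at hq'
      exact absurd (hG.asymm u v hp') hq'
  rw [h2, ← Set.ncard_coe_finset]
  have h3 : ((A.image fun p => s(p.2, p.1) : Finset (Sym2 (Fin n))) : Set (Sym2 (Fin n))) ⊆
      {e ∈ G.edgeSet | ∀ x ∈ e, x ∈ T} := by
    intro e he
    obtain ⟨⟨v, u⟩, hp, rfl⟩ := Finset.mem_image.1 (Finset.mem_coe.1 he)
    have hp1 : v ∈ S := (Finset.mem_sigma.1 hp).1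
    have hp' : f u v ≠ none := by simpa using (Finset.mem_sigma.1 hp).2
    have := hST u v hp' hp1
    refine ⟨by simpa using (hG.adj u v).2 (.inl hp'), fun x hx => ?_⟩
    rcases Sym2.mem_iff.1 hx with rfl | rfl
    · exact this.1
    · exact this.2
  exact_mod_cast Set.ncard_le_ncard h3 (Set.toFinite _)

/-- An arc whose head has level at least `i` has label at least `i - 1`, so its tail has level at
least `i - 3`. The in-degrees of the upper set therefore count edges inside the lower set, and
`hcut` compares the two weights. -/
theorem le_density (hC : Consistent P f deg lev 0) (hG : Orients G f) {i : ℤ} {c : ℝ}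
    (hc : 0 < c) (hne : ∃ v, i ≤ lev v)
    (hcut : ∑ v with i - 3 ≤ lev v, P.w v ≤ c * ∑ v with i ≤ lev v, P.w v) :
    threshold P.eta i / c ≤ density G P.w ({v | i - 3 ≤ lev v} : Finset (Fin n)) := by
  have hw : ∀ v, 0 < P.w v := fun v => zero_lt_one.trans_le (P.one_le_w v)
  obtain ⟨v₀, hv₀⟩ := hne
  have hpos : 0 < ∑ v with i - 3 ≤ lev v, P.w v :=
    Finset.sum_pos (fun v _ => hw v) ⟨v₀, by simp; omega⟩
  have h1 := sum_deg_le (S := {v | i ≤ lev v}) (T := {v | i - 3 ≤ lev v}) hC hG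
    fun u v huv hv => by
      obtain ⟨j, hj⟩ := Option.ne_none_iff_exists'.1 huv
      have h1 := hC.label_le u v j hj
      have h2 := hC.le_label u v j hj
      simp only [Finset.mem_filter, Finset.mem_univ, true_and] at hv ⊢
      omega
  have h2 : threshold P.eta i * ∑ v with i ≤ lev v, P.w v ≤ ∑ v with i ≤ lev v, (deg v : ℝ) := by
    rw [Finset.mul_sum]
    refine Finset.sum_le_sum fun v hv => ?_
    refine le_trans ?_ (hC.low_le v)
    exact mul_le_mul_of_nonneg_right (threshold_mono P.eta_pos.le (Finset.mem_filter.1 hv).2)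
      (hw v).le
  rw [density, div_le_div_iff₀ hc hpos]
  calc threshold P.eta i * ∑ v with i - 3 ≤ lev v, P.w v
      ≤ threshold P.eta i * (c * ∑ v with i ≤ lev v, P.w v) :=
        mul_le_mul_of_nonneg_left hcut (threshold_nonneg P.eta_pos.le i)
    _ = (threshold P.eta i * ∑ v with i ≤ lev v, P.w v) * c := by ring
    _ ≤ _ := mul_le_mul_of_nonneg_right (h2.trans h1) hc.le

/-- List the vertices of the dense subgraph. -/
def query : Prog := .iassign 1 (.var 4)

/-- The vertices sorted by level are permanently stored in the array 1, so every level set is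
already an initial segment there and only its length is missing. A query thus takes constant time.
-/
theorem lists_of_sortedBy (hM : Mem P f deg lev s) {i : ℤ} (hi : 0 ≤ i)
    (h1 : s.ivar 1 = ({v | i ≤ lev v} : Finset (Fin n)).card) :
    DynAlg.Lists s ({v | i ≤ lev v} : Finset (Fin n)) := by
  have hS := hM.sorted.by_lev
  have hb := hS.bnd_eq i hi
  refine ⟨h1, fun j hj => ?_, fun j hj j' hj' e => ?_, ?_⟩
  · have hjn : j < n := (Set.mem_Iio.1 hj).trans_le
      ((Finset.card_le_univ _).trans_eq (Fintype.card_fin n))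
    obtain ⟨v, hv⟩ := hS.inv.surj j (by omega) (by omega)
    refine ⟨v, ?_, ?_⟩
    · have := (hS.below v i hi).1 (by rw [hv, hb]; exact_mod_cast hj)
      simpa using this
    · simp only [← hv, hS.inv.ord_pos]
  · have hjn : ∀ j, j ∈ Set.Iio ({v | i ≤ lev v} : Finset (Fin n)).card → j < n := fun j hj =>
      (Set.mem_Iio.1 hj).trans_le ((Finset.card_le_univ _).trans_eq (Fintype.card_fin n))
    obtain ⟨v, hv⟩ := hS.inv.surj j (by omega) (by have := hjn j hj; omega)
    obtain ⟨v', hv'⟩ := hS.inv.surj j' (by omega) (by have := hjn j' hj'; omega)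
    simp only [← hv, ← hv', hS.inv.ord_pos] at e
    have : v = v' := Fin.ext (by omega)
    subst this
    omega
  · rintro _ ⟨v, hv, rfl⟩
    have h2 := (hS.below v i hi).2 (by simpa using hv)
    have h0 := hS.inv.nonneg v
    refine ⟨(s.iarr 2 (v : ℕ)).toNat, ?_, ?_⟩
    · rw [Set.mem_Iio]
      zify
      rw [Int.toNat_of_nonneg h0, ← hb]
      exact h2
    · simp only [Int.toNat_of_nonneg h0, hS.inv.ord_pos]

end

end RealRAM

/-! ### Initialization -/

theorem le_thresholdNat {η : ℝ} (hη : 0 ≤ η) (hη1 : η ≤ 1) (k : ℕ) :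
    2 * (1 + η) ^ k - 2 ≤ thresholdNat η k := by
  induction k with
  | zero => simp [thresholdNat]
  | succ k ih =>
    rw [thresholdNat, pow_succ]
    nlinarith

/-- By Bernoulli `(1 + η) ^ K ≥ 3`, so after `K * b` levels the threshold is at least `2 * 3 ^ b - 2
≥ 3 * 2 ^ b - 2 ≥ 3 * n - 2`, which exceeds `n + 1`. -/
theorem lt_thresholdNat {η : ℝ} (hη : 0 ≤ η) (hη1 : η ≤ 1) {n K b : ℕ} (hn : 2 ≤ n)
    (hK : 2 ≤ K * η) (hb : 1 ≤ b) (hnb : (n : ℝ) ≤ 2 ^ b) :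
    n + 1 < thresholdNat η (K * b) := by
  have h1 := le_thresholdNat hη hη1 (K * b)
  have h2 : (3 : ℝ) ≤ (1 + η) ^ K := by
    have := one_add_mul_le_pow (by linarith : -2 ≤ η) K
    linarith
  have h3 : (3 / 2 : ℝ) ≤ (3 / 2) ^ b := le_self_pow₀ (by norm_num) (by omega)
  have h4 : (3 : ℝ) ^ b = (3 / 2) ^ b * 2 ^ b := by rw [← mul_pow]; norm_num
  have h5 : (3 : ℝ) ^ b ≤ ((1 + η) ^ K) ^ b := by gcongr
  rw [pow_mul] at h1
  have h6 : (2 : ℝ) ≤ n := by exact_mod_cast hn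
  nlinarith

namespace RealRAM

/-- `s'` agrees with `s` outside of the integer variables in `X`, the real variables in `Y`, the
integer arrays in `A` and the real arrays in `B`. -/
structure AgreeOff (X Y A B : Finset ℕ) (s s' : State) : Prop where
  ivar : ∀ x ∉ X, s'.ivar x = s.ivar x
  rvar : ∀ x ∉ Y, s'.rvar x = s.rvar x
  iarr : ∀ a ∉ A, s'.iarr a = s.iarr a
  rarr : ∀ a ∉ B, s'.rarr a = s.rarr a

/-- Initialize the multiplication table, the list of vertices and their levels, and compute the
total weight. -/
def initVertices : Prog :=
  .while (.not (.ile (.var 0) (.var 20))) (block [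
    .istore 4 (.add (.var 20) (.const 1)) (.add (.get 4 (.var 20)) (.var 0)),
    .istore 1 (.var 20) (.var 20), .istore 2 (.var 20) (.var 20), .istore 7 (.var 20) (.const 5),
    .rassign 1 (.add (.var 1) (.get 0 (.var 20))),
    .iassign 20 (.add (.var 20) (.const 1))])

/-- Initialize the number and the total weight of the vertices of level at least `j`, for
`j ≤ 5`. -/
def initLevels : Prog :=
  .while (.ile (.var 23) (.const 5)) (block [
    .istore 3 (.var 23) (.var 0), .rstore 2 (.var 23) (.var 1),
    .iassign 23 (.add (.var 23) (.const 1))])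

/-- Compute the binary logarithm of the total weight. -/
def initLog : Prog := block [
  .rassign 2 (.const 1),
  .while (.not (.rle (.var 1) (.var 2))) (block [
    .rassign 2 (.add (.var 2) (.var 2)), .iassign 6 (.add (.var 6) (.const 1))])]

/-- Compute the number of arcs that are relabelled when an in-degree changes. -/
def initBudget : Prog := block [
  .rassign 3 (.div (.mul (.var 0) (.var 0)) (.mul (.const 64) (.cast (.var 6)))),
  .while (.not (.rle (.const 2) (.mul (.cast (.var 5)) (.var 3))))
    (.iassign 5 (.add (.var 5) (.const 1)))]

/-- Compute the thresholds. -/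
def initThresholds : Prog := block [
  .iassign 21 (.const 5),
  .while (.rle (.get 1 (.var 21)) (.add (.cast (.var 0)) (.const 1))) (block [
    .rstore 1 (.add (.var 21) (.const 1))
      (.add (.mul (.add (.const 1) (.var 3)) (.get 1 (.var 21))) (.const 2)),
    .iassign 21 (.add (.var 21) (.const 1))])]

/-- Compute the positions of the buckets. -/
def initBuckets : Prog :=
  .while (.not (.ile (.add (.var 21) (.const 2)) (.var 22))) (block [
    .istore 5 (.add (.var 22) (.const 1)) (.add (.get 5 (.var 22)) (.get 4 (.var 0))),
    .iassign 22 (.add (.var 22) (.const 1))])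

/-- The initialization. -/
def init : Prog := block [initVertices, initLevels, initLog, initBudget, initThresholds,
  initBuckets, cut]

/-- The table of multiples of `n` includes the index `n` itself: its last entry `n * n` is the
increment of the second table. -/
theorem wp_initVertices {n : ℕ} {w : ℕ → ℝ} {s : State} (hn : s.ivar 0 = n)
    (h20 : s.ivar 20 = 0) (h4 : s.iarr 4 0 = 0) (h1 : s.rvar 1 = 0)
    (hw : ∀ i < n, s.rarr 0 (i : ℕ) = w i) :
    Wp initVertices (fun s' t => t ≤ 100 * n + 100 ∧ AgreeOff {20} {1} {1, 2, 4, 7} ∅ s s' ∧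
      (∀ i ≤ n, s'.iarr 4 (i : ℕ) = (i : ℕ) * n) ∧
      (∀ i < n, s'.iarr 1 (i : ℕ) = i ∧ s'.iarr 2 (i : ℕ) = i ∧ s'.iarr 7 (i : ℕ) = 5) ∧
      s'.rvar 1 = ∑ i ∈ Finset.range n, w i) s := by
  refine wp_while (fun k s' t => ∃ m : ℕ, m + k = n ∧ s'.ivar 20 = m ∧ t ≤ 100 * m ∧
      AgreeOff {20} {1} {1, 2, 4, 7} ∅ s s' ∧
      (∀ i ≤ m, s'.iarr 4 (i : ℕ) = (i : ℕ) * n) ∧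
      (∀ i < m, s'.iarr 1 (i : ℕ) = i ∧ s'.iarr 2 (i : ℕ) = i ∧ s'.iarr 7 (i : ℕ) = 5) ∧
      s'.rvar 1 = ∑ i ∈ Finset.range m, w i) ?_ ?_ (k := n) ?_
  · rintro k s' t ⟨m, hm, hi, ht, hA, hr, ho, hs⟩ hcond
    have e0 := hA.ivar 0 (by decide)
    have er := hA.rarr 0 (by decide)
    simp only [BExpr.eval, IExpr.eval, hi, e0, hn, not_le] at hcond
    norm_cast at hcond
    simp only [wp_block_cons, wp_block_nil, wp_iassign, wp_istore, wp_rassign, IExpr.eval,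
      RExpr.eval, IExpr.cost, RExpr.cost, BExpr.cost, State.setIvar_ivar, State.setIarr_ivar,
      State.setRvar_ivar, hi, e0, hn]
    refine ⟨k - 1, by omega, m + 1, by omega, by simp, by omega, ⟨?_, ?_, ?_, ?_⟩, ?_, ?_, ?_⟩
    · intro x hx
      rw [← hA.ivar x hx]
      simp only [Finset.mem_singleton] at hx
      simp [hx]
    · intro x hx
      rw [← hA.rvar x hx]
      simp only [Finset.mem_singleton] at hx
      simp [hx]
    · intro x hx
      rw [← hA.iarr x hx]
      simp only [Finset.mem_singleton, Finset.mem_insert, not_or] at hx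
      simp [hx]
    · intro x hx
      rw [← hA.rarr x hx]
      rfl
    · intro i hi'
      by_cases e : i = m + 1
      · subst e
        simp [hr m le_rfl]
        ring
      · have e' : (i : ℤ) ≠ m + 1 := by omega
        simp [e', hr i (by omega)]
    · intro i hi'
      by_cases e : i = m
      · subst e
        simp
      · have e' : (i : ℤ) ≠ m := by omega
        have := ho i (by omega)
        simp [e', this]
    · simp [Finset.sum_range_succ, hs, er, hw m hcond]
  · rintro k s' t ⟨m, hm, hi, ht, hA, hr, ho, hs⟩ hcond
    simp only [BExpr.eval, IExpr.eval, hi, hA.ivar 0 (by decide), hn, not_not] at hcond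
    obtain rfl : m = n := by omega
    exact ⟨by simp only [BExpr.cost, IExpr.cost]; omega, hA, hr, ho, hs⟩
  · exact ⟨0, by simp, by simpa using h20, by simp, ⟨by simp, by simp, by simp, by simp⟩,
      by simpa using h4, by simp, by simpa using h1⟩

theorem wp_initLevels {s : State} (h23 : s.ivar 23 = 0) :
    Wp initLevels (fun s' t => t ≤ 1000 ∧ AgreeOff {23} ∅ {3} {2} s s' ∧
      (∀ i, 0 ≤ i → i ≤ 5 → s'.iarr 3 i = s.ivar 0 ∧ s'.rarr 2 i = s.rvar 1) ∧
      (∀ i, 5 < i → s'.iarr 3 i = s.iarr 3 i ∧ s'.rarr 2 i = s.rarr 2 i)) s := by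
  refine wp_while (fun k s' t => ∃ m : ℤ, m + k = 6 ∧ 0 ≤ m ∧ s'.ivar 23 = m ∧ t ≤ 100 * m ∧
      AgreeOff {23} ∅ {3} {2} s s' ∧
      (∀ i, 0 ≤ i → i < m → s'.iarr 3 i = s.ivar 0 ∧ s'.rarr 2 i = s.rvar 1) ∧
      (∀ i, 5 < i → s'.iarr 3 i = s.iarr 3 i ∧ s'.rarr 2 i = s.rarr 2 i)) ?_ ?_ (k := 6) ?_
  · rintro k s' t ⟨m, hm, hm0, hi, ht, hA, hr, ho⟩ hcond
    have e0 := hA.ivar 0 (by decide)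
    have er := hA.rvar 1 (by decide)
    simp only [BExpr.eval, IExpr.eval, hi] at hcond
    simp only [wp_block_cons, wp_block_nil, wp_iassign, wp_istore, wp_rstore, IExpr.eval,
      RExpr.eval, IExpr.cost, RExpr.cost, BExpr.cost, State.setIvar_ivar, State.setIarr_ivar,
      State.setRarr_ivar, hi, e0]
    refine ⟨k - 1, by omega, m + 1, by omega, by omega, by simp, by push_cast; omega,
      ⟨?_, ?_, ?_, ?_⟩, ?_, ?_⟩
    · intro x hx
      rw [← hA.ivar x hx]
      simp only [Finset.mem_singleton] at hx
      simp [hx]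
    · intro x hx
      rw [← hA.rvar x hx]
      rfl
    · intro x hx
      rw [← hA.iarr x hx]
      simp only [Finset.mem_singleton] at hx
      simp [hx]
    · intro x hx
      rw [← hA.rarr x hx]
      simp only [Finset.mem_singleton] at hx
      simp [hx]
    · intro i hi0 hi'
      by_cases e : i = m
      · subst e
        simp [er]
      · have := hr i hi0 (by omega)
        simp [e, this]
    · intro i hi5
      have := ho i hi5
      simp [show i ≠ m by omega, this]
  · rintro k s' t ⟨m, hm, hm0, hi, ht, hA, hr, ho⟩ hcond
    simp only [BExpr.eval, IExpr.eval, hi] at hcond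
    exact ⟨by simp only [BExpr.cost, IExpr.cost]; omega, hA,
      fun i h0 h5 => hr i h0 (by omega), ho⟩
  · exact ⟨0, by simp, le_rfl, h23, by simp, ⟨by simp, by simp, by simp, by simp⟩,
      fun i h0 h1 => by omega, by simp⟩

theorem wp_initLog {s : State} (h6 : s.ivar 6 = 0) (h1 : 1 ≤ s.rvar 1) :
    Wp initLog (fun s' t => ∃ b : ℕ, t ≤ 100 * b + 100 ∧ AgreeOff {6} {2} ∅ ∅ s s' ∧
      s'.ivar 6 = b ∧ s.rvar 1 ≤ 2 ^ b ∧ 2 ^ b ≤ 2 * s.rvar 1) s := by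
  -- This `N` only serves as a variant for termination; the time is expressed by the final `b`.
  obtain ⟨N, hN⟩ := pow_unbounded_of_one_lt (s.rvar 1) (one_lt_two)
  simp only [initLog, wp_block_cons, wp_block_nil, wp_rassign, RExpr.eval, RExpr.cost]
  refine wp_while (fun k s' t => ∃ b : ℕ, b + k = N ∧ t ≤ 100 * b ∧
    AgreeOff {6} {2} ∅ ∅ s s' ∧ s'.ivar 6 = b ∧ s'.rvar 2 = 2 ^ b ∧ (2 : ℝ) ^ b ≤ 2 * s.rvar 1)
    ?_ ?_ (k := N) ?_
  · rintro k s' t ⟨b, hb, ht, hA, hi, hr, hp⟩ hcond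
    simp only [BExpr.eval, RExpr.eval, hA.rvar 1 (by decide), hr, not_le] at hcond
    have hbN : b < N := by
      by_contra! h
      exact absurd (hcond.trans hN) (not_lt.2 (pow_le_pow_right₀ one_le_two h))
    simp only [wp_block_cons, wp_block_nil, wp_iassign, wp_rassign, IExpr.eval,
      RExpr.eval, IExpr.cost, RExpr.cost, BExpr.cost, State.setRvar_ivar, hi, hr]
    refine ⟨k - 1, by omega, b + 1, by omega, by omega, ⟨?_, ?_, ?_, ?_⟩, by simp,
      by simp [pow_succ, mul_two], by rw [pow_succ]; linarith⟩
    · intro x hx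
      rw [← hA.ivar x hx]
      simp only [Finset.mem_singleton] at hx
      simp [hx]
    · intro x hx
      rw [← hA.rvar x hx]
      simp only [Finset.mem_singleton] at hx
      simp [hx]
    · intro x hx
      rw [← hA.iarr x hx]
      rfl
    · intro x hx
      rw [← hA.rarr x hx]
      rfl
  · rintro k s' t ⟨b, hb, ht, hA, hi, hr, hp⟩ hcond
    simp only [BExpr.eval, RExpr.eval, hA.rvar 1 (by decide), hr, not_not] at hcond
    exact ⟨b, by simp only [BExpr.cost, RExpr.cost]; omega, hA, hi, hcond, hp⟩
  · exact ⟨0, by simp, by simp, ⟨by simp, fun x hx => by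
      simp only [Finset.mem_singleton] at hx
      simp [hx], by simp, by simp⟩, by simp [h6], by simp, by simp; linarith⟩

theorem wp_initBudget {b : ℕ} {s : State} (h5 : s.ivar 5 = 0) (h6 : s.ivar 6 = b)
    (hη : 0 < s.rvar 0 ^ 2 / (64 * b)) :
    Wp initBudget (fun s' t => ∃ K : ℕ, t ≤ 100 * K + 100 ∧ AgreeOff {5} {3} ∅ ∅ s s' ∧
      s'.ivar 5 = K ∧ s'.rvar 3 = s.rvar 0 ^ 2 / (64 * b) ∧ 2 ≤ K * s'.rvar 3 ∧
      K * s'.rvar 3 ≤ 2 + s'.rvar 3) s := by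
  set η := s.rvar 0 ^ 2 / (64 * b) with hηdef
  obtain ⟨N, hN⟩ := exists_nat_gt (2 / η)
  rw [div_lt_iff₀ hη] at hN
  simp only [initBudget, wp_block_cons, wp_block_nil, wp_rassign, RExpr.eval, IExpr.eval, RExpr.cost,
    IExpr.cost, h6]
  refine wp_while (fun k s' t => ∃ K : ℕ, K + k = N ∧ t ≤ 100 * K ∧
    AgreeOff {5} {3} ∅ ∅ s s' ∧ s'.ivar 5 = K ∧ s'.rvar 3 = η ∧ K * η ≤ 2 + η)
    ?_ ?_ (k := N) ?_
  · rintro k s' t ⟨K, hK, ht, hA, hi, hr, hp⟩ hcond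
    simp only [BExpr.eval, RExpr.eval, IExpr.eval, hi, hr, not_le] at hcond
    push_cast at hcond
    have hbN : K < N := by
      by_contra! h
      have : (N : ℝ) ≤ K := by exact_mod_cast h
      nlinarith
    simp only [wp_iassign, IExpr.eval, RExpr.cost, IExpr.cost, BExpr.cost, hi]
    refine ⟨k - 1, by omega, K + 1, by omega, by omega, ⟨?_, ?_, ?_, ?_⟩, by simp,
      by simp [hr], by push_cast; linarith⟩
    · intro x hx
      rw [← hA.ivar x hx]
      simp only [Finset.mem_singleton] at hx
      simp [hx]
    · intro x hx
      rw [← hA.rvar x hx]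
      rfl
    · intro x hx
      rw [← hA.iarr x hx]
      rfl
    · intro x hx
      rw [← hA.rarr x hx]
      rfl
  · rintro k s' t ⟨K, hK, ht, hA, hi, hr, hp⟩ hcond
    simp only [BExpr.eval, RExpr.eval, IExpr.eval, hi, hr, not_not] at hcond
    push_cast at hcond
    exact ⟨K, by simp only [BExpr.cost, RExpr.cost, IExpr.cost]; omega, hA, hi, hr, hr ▸ hcond,
      hr ▸ hp⟩
  · refine ⟨0, by simp, by simp, ⟨by simp, fun x hx => ?_, by simp, by simp⟩, by simp [h5], ?_,
      by simp; linarith⟩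
    · simp only [Finset.mem_singleton] at hx
      simp [hx]
    · simp only [State.setRvar_rvar, if_true, hηdef]
      push_cast
      ring

theorem wp_initThresholds {n N : ℕ} {η : ℝ} {s : State} (hn : s.ivar 0 = n) (h3 : s.rvar 3 = η)
    (h1 : ∀ i, s.rarr 1 i = 0) (hN : n + 1 < thresholdNat η N) (hη : 0 ≤ η) :
    Wp initThresholds (fun s' t => ∃ L : ℕ, 5 ≤ L ∧ L ≤ 5 + N ∧ t ≤ 100 * L + 100 ∧
      AgreeOff {21} ∅ ∅ {1} s s' ∧ s'.ivar 21 = L ∧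
      (∀ i : ℤ, 0 ≤ i → i ≤ L → s'.rarr 1 i = threshold η i) ∧ n + 1 < threshold η L) s := by
  simp only [initThresholds, wp_block_cons, wp_block_nil, wp_iassign, IExpr.eval, IExpr.cost]
  refine wp_while (fun k s' t => ∃ L : ℕ, L + k = 5 + N ∧ 5 ≤ L ∧ t ≤ 100 * L ∧
    AgreeOff {21} ∅ ∅ {1} s s' ∧ s'.ivar 21 = L ∧
    (∀ i : ℤ, 0 ≤ i → i ≤ L → s'.rarr 1 i = threshold η i)) ?_ ?_ (k := N) ?_
  · rintro k s' t ⟨L, hL, hL5, ht, hA, hi, hr⟩ hcond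
    have hrL := hr L (by omega) le_rfl
    simp only [BExpr.eval, RExpr.eval, IExpr.eval, hi, hrL, hA.ivar 0 (by decide), hn] at hcond
    push_cast at hcond
    have hLN : L < 5 + N := by
      by_contra! h
      have h2 := threshold_mono hη (show ((5 + N : ℕ) : ℤ) ≤ L by exact_mod_cast h)
      rw [threshold, show (((5 + N : ℕ) : ℤ) - 5).toNat = N by omega] at h2
      linarith
    simp only [wp_block_cons, wp_block_nil, wp_iassign, wp_rstore, IExpr.eval,
      RExpr.eval, IExpr.cost, RExpr.cost, BExpr.cost, State.setRarr_ivar, hi, hrL]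
    refine ⟨k - 1, by omega, L + 1, by omega, by omega, by omega, ⟨?_, ?_, ?_, ?_⟩, by simp, ?_⟩
    · intro x hx
      rw [← hA.ivar x hx]
      simp only [Finset.mem_singleton] at hx
      simp [hx]
    · intro x hx
      rw [← hA.rvar x hx]
      rfl
    · intro x hx
      rw [← hA.iarr x hx]
      rfl
    · intro x hx
      rw [← hA.rarr x hx]
      simp only [Finset.mem_singleton] at hx
      simp [hx]
    · intro i h0 hi'
      by_cases e : i = L + 1
      · subst e
        simp [threshold_succ (show (5 : ℤ) ≤ L by omega), hA.rvar 3 (by decide), h3]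
      · simp [e, hr i h0 (by push_cast at hi'; omega)]
  · rintro k s' t ⟨L, hL, hL5, ht, hA, hi, hr⟩ hcond
    have hrL := hr L (by omega) le_rfl
    simp only [BExpr.eval, RExpr.eval, IExpr.eval, hi, hrL, hA.ivar 0 (by decide), hn] at hcond
    push_cast at hcond
    exact ⟨L, hL5, by omega, by simp only [BExpr.cost, RExpr.cost, IExpr.cost]; omega, hA, hi, hr,
      not_le.1 hcond⟩
  · refine ⟨5, rfl, le_rfl, by simp, ⟨fun x hx => ?_, by simp, by simp, by simp⟩, by simp,
      fun i h0 h5 => ?_⟩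
    · simp only [Finset.mem_singleton] at hx
      simp [hx]
    · rw [threshold_of_le (by exact_mod_cast h5)]
      exact h1 i

theorem wp_initBuckets {n L : ℕ} {s : State} (hn : s.ivar 0 = n) (h4 : s.iarr 4 (n : ℕ) = n * n)
    (hL : s.ivar 21 = L) (h22 : s.ivar 22 = 0) (h5 : s.iarr 5 0 = 0) :
    Wp initBuckets (fun s' t => t ≤ 100 * L + 300 ∧ AgreeOff {22} ∅ {5} ∅ s s' ∧
      ∀ j, 0 ≤ j → j ≤ (L : ℤ) + 2 → s'.iarr 5 j = j * (n * n)) s := by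
  refine wp_while (fun k s' t => ∃ m : ℕ, m + k = L + 2 ∧ s'.ivar 22 = m ∧ t ≤ 100 * m ∧
      AgreeOff {22} ∅ {5} ∅ s s' ∧
      ∀ j, 0 ≤ j → j ≤ (m : ℤ) → s'.iarr 5 j = j * (n * n)) ?_ ?_ (k := L + 2) ?_
  · rintro k s' t ⟨m, hm, hi, ht, hA, hr⟩ hcond
    have e0 := hA.ivar 0 (by decide)
    have e4 := hA.iarr 4 (by decide)
    have hrm := hr m (by omega) le_rfl
    simp only [BExpr.eval, IExpr.eval, hi, hA.ivar 21 (by decide), hL, not_le] at hcond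
    simp only [wp_block_cons, wp_block_nil, wp_iassign, wp_istore, IExpr.eval,
      IExpr.cost, BExpr.cost, State.setIarr_ivar, hi, e0, hn, e4, h4, hrm]
    refine ⟨k - 1, by omega, m + 1, by omega, by simp, by omega, ⟨?_, ?_, ?_, ?_⟩, ?_⟩
    · intro x hx
      rw [← hA.ivar x hx]
      simp only [Finset.mem_singleton] at hx
      simp [hx]
    · intro x hx
      rw [← hA.rvar x hx]
      rfl
    · intro x hx
      rw [← hA.iarr x hx]
      simp only [Finset.mem_singleton] at hx
      simp [hx]
    · intro x hx
      rw [← hA.rarr x hx]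
      rfl
    · intro j h0 hj
      by_cases e : j = m + 1
      · subst e
        simp
        ring
      · simp [e, hr j h0 (by push_cast at hj; omega)]
  · rintro k s' t ⟨m, hm, hi, ht, hA, hr⟩ hcond
    simp only [BExpr.eval, IExpr.eval, hi, hA.ivar 21 (by decide), hL, not_not] at hcond
    exact ⟨by simp only [BExpr.cost, IExpr.cost]; omega, hA,
      fun j h0 h1 => hr j h0 (by omega)⟩
  · exact ⟨0, by simp, h22, by simp, ⟨by simp, by simp, by simp, by simp⟩, fun j h0 h1 => by
      obtain rfl : j = 0 := by omega
      simpa using h5⟩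

/-- The parameters that the initialization chooses, where `b` is the binary logarithm of the total
weight. -/
structure Tuned {n : ℕ} (P : Parameters n) (w : Fin n → ℝ) (ε : ℝ) (b : ℕ) : Prop where
  w_eq : P.w = w
  eps_eq : P.eps = ε
  one_le : 1 ≤ b
  eta_eq : P.eta = ε ^ 2 / (64 * b)
  sum_le : ∑ v, w v ≤ 2 ^ b
  le_sum : 2 ^ b ≤ 2 * ∑ v, w v
  K_le : P.K * P.eta ≤ 3
  L_le : P.L ≤ P.K * b + 5

/-- Zeroed memory already represents the graph without arcs, so neither the matrix nor the buckets
need any initialization; otherwise time linear in `n` would be impossible. -/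
theorem arcs_empty {n : ℕ} {s : State} (h : ∀ a ∈ arcArrays, ∀ i, s.iarr a i = 0) :
    Arcs (n := n) s fun _ _ => none := by
  have hB : ∀ a ∈ arcArrays, ∀ arr pos : ℤ → ℤ,
      Buckets (n := n) (s.iarr a) arr pos fun _ _ => none := fun a ha arr pos =>
    ⟨fun o j => by simp [h a ha, bucket], fun o j k h0 h1 => by
      rw [h a ha] at h1
      omega, by simp⟩
  exact ⟨fun u v => by simp [h 0 (by decide)], by simp, hB 9 (by decide) _ _,
    hB 12 (by decide) _ _⟩

theorem sortedBy_const {n : ℕ} {w : Fin n → ℝ} {ord pos bnd : ℤ → ℤ} {ws : ℤ → ℝ}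
    (ho : ∀ i < n, ord (i : ℕ) = i ∧ pos (i : ℕ) = i)
    (h5 : ∀ i, 0 ≤ i → i ≤ 5 → bnd i = n ∧ ws i = ∑ v, w v)
    (h6 : ∀ i, 5 < i → bnd i = 0 ∧ ws i = 0) :
    SortedBy w (fun _ => 5) ord pos bnd ws := by
  refine ⟨⟨fun v => ?_, fun v => ?_, fun v => ?_, fun p h0 h1 => ?_⟩, fun i h0 => ?_,
    fun v i h0 => ?_, fun i h0 => ?_⟩
  · rw [(ho v v.isLt).2]; omega
  · rw [(ho v v.isLt).2]; omega
  · rw [(ho v v.isLt).2, (ho v v.isLt).1]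
  · lift p to ℕ using h0
    exact ⟨⟨p, by exact_mod_cast h1⟩, (ho p (by exact_mod_cast h1)).2⟩
  all_goals
    rcases le_or_gt i 5 with hi | hi
    · have := (ho · · |>.2)
      simp [h5 i h0 hi, *]
    · have := hi.not_ge
      simp [h6 i hi, *]

theorem potential_empty {n : ℕ} {P : Parameters n} :
    P.potential (fun _ _ => none) 0 (fun _ => 5) = 0 := by
  have hK := P.two_le_K
  simp [Parameters.potential, Parameters.charge, labelSum, Parameters.low, threshold_of_le]

theorem consistent_empty {n : ℕ} {P : Parameters n} (hL : 5 < P.L) :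
    Consistent P (fun _ _ => none) 0 (fun _ => 5) 0 := by
  have h6 : ∀ v, 0 < P.low v 6 := fun v => by
    have := P.low_succ v (le_refl 5)
    have := P.one_le_w v
    have := P.low_nonneg v 5
    have := mul_nonneg P.eta_pos.le this
    norm_num at *
    nlinarith
  have h5 : ∀ v, P.low v 5 = 0 := fun v => by
    rw [Parameters.low, threshold_of_le le_rfl, zero_mul]
  have hK := P.two_le_K
  refine ⟨by simp, by simp, by simp, fun _ => le_rfl, fun _ => hL, fun v => by simp [h5],
    fun v => by simpa using h6 v, by simp, fun v => ?_, fun v => by simp [h5, inBucket]⟩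
  have := mul_nonneg (by linarith : (0 : ℝ) ≤ P.K) (h6 v).le
  simpa [inBucket] using this

theorem wp_init {n : ℕ} {w : Fin n → ℝ} {ε : ℝ} (hn : 2 ≤ n) (hε : 0 < ε) (hε1 : ε < 1)
    (hw : ∀ v, 1 ≤ w v) :
    Wp init (fun s t => ∃ (P : Parameters n) (b : ℕ), Tuned P w ε b ∧ Good P ⊥ s 0 ∧
      t ≤ 1000 * (n + P.L + P.K + b)) (DynAlg.input ε w) := by
  have hsum : (n : ℝ) ≤ ∑ v, w v := by
    simpa using Finset.sum_le_sum (s := Finset.univ) fun v _ => hw v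
  have hn2 : (2 : ℝ) ≤ n := by exact_mod_cast hn
  let w' : ℕ → ℝ := fun i => if h : i < n then w ⟨i, h⟩ else 0
  have hw' : ∑ i ∈ Finset.range n, w' i = ∑ v, w v := by
    rw [Finset.sum_range]
    simp [w']
  rw [init, wp_block_cons]
  refine (wp_initVertices (n := n) (w := w') (by simp [DynAlg.input]) (by simp [DynAlg.input])
    (by simp [DynAlg.input]) (by simp [DynAlg.input])
    fun i hi => by simp [DynAlg.input, w']).mono ?_
  rintro s₁ t₁ ⟨ht₁, hA₁, hrow, hord, hws⟩
  rw [hw'] at hws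
  rw [wp_block_cons]
  refine (wp_initLevels (by rw [hA₁.ivar _ (by decide)]; simp [DynAlg.input])).mono ?_
  rintro s₂ t₂ ⟨ht₂, hA₂, hlow, hhigh⟩
  rw [wp_block_cons]
  refine (wp_initLog (by rw [hA₂.ivar _ (by decide), hA₁.ivar _ (by decide)]; simp [DynAlg.input])
    (by rw [hA₂.rvar _ (by decide), hws]; linarith)).mono ?_
  rintro s₃ t₃ ⟨b, ht₃, hA₃, hb6, hsb, hbs⟩
  rw [hA₂.rvar _ (by decide), hws] at hsb hbs
  -- The total weight is at least 2, and `b` has to be positive because `η` is defined by dividing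
  -- by it.
  have hb : 1 ≤ b := by
    by_contra! h
    rw [Nat.lt_one_iff.1 h] at hsb
    linarith
  have hb' : (1 : ℝ) ≤ b := by exact_mod_cast hb
  have hε3 : s₃.rvar 0 = ε := by
    rw [hA₃.rvar _ (by decide), hA₂.rvar _ (by decide), hA₁.rvar _ (by decide)]
    simp [DynAlg.input]
  rw [wp_block_cons]
  have hη : 0 < ε ^ 2 / (64 * b) := by positivity
  have hη1 : ε ^ 2 / (64 * b) ≤ 1 := by
    rw [div_le_one (by positivity)]
    nlinarith
  refine (wp_initBudget (b := b) (by
    rw [hA₃.ivar _ (by decide), hA₂.ivar _ (by decide), hA₁.ivar _ (by decide)]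
    simp [DynAlg.input]) hb6 (by rwa [hε3])).mono ?_
  rintro s₄ t₄ ⟨K, ht₄, hA₄, hK5, hη3, hK2, hK3⟩
  rw [hε3] at hη3
  rw [hη3] at hK2 hK3
  have hn4 : s₄.ivar 0 = n := by
    rw [hA₄.ivar _ (by decide), hA₃.ivar _ (by decide), hA₂.ivar _ (by decide),
      hA₁.ivar _ (by decide)]
    simp [DynAlg.input]
  rw [wp_block_cons]
  refine (wp_initThresholds hn4 hη3 (fun i => by
    rw [hA₄.rarr _ (by decide), hA₃.rarr _ (by decide), hA₂.rarr _ (by decide),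
      hA₁.rarr _ (by decide)]
    simp [DynAlg.input]) (lt_thresholdNat hη.le hη1 hn hK2 hb (hsum.trans hsb)) hη.le).mono ?_
  rintro s₅ t₅ ⟨L, hL5, hLK, ht₅, hA₅, hL21, hthr, hnL⟩
  let P : Parameters n := ⟨w, ε, ε ^ 2 / (64 * b), K, L, hw, hη, hη1, hK2, hnL⟩
  rw [wp_block_cons]
  refine (wp_initBuckets (n := n) (by rw [hA₅.ivar _ (by decide), hn4]) (by
    rw [hA₅.iarr _ (by decide), hA₄.iarr _ (by decide), hA₃.iarr _ (by decide),
      hA₂.iarr _ (by decide), hrow n le_rfl]) hL21 (by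
    rw [hA₅.ivar _ (by decide), hA₄.ivar _ (by decide), hA₃.ivar _ (by decide),
      hA₂.ivar _ (by decide), hA₁.ivar _ (by decide)]
    simp [DynAlg.input]) (by
    rw [hA₅.iarr _ (by decide), hA₄.iarr _ (by decide), hA₃.iarr _ (by decide),
      hA₂.iarr _ (by decide), hA₁.iarr _ (by decide)]
    simp [DynAlg.input])).mono ?_
  rintro s₆ t₆ ⟨ht₆, hA₆, hlab⟩
  have hL : 5 < L := by
    refine lt_of_le_of_ne hL5 fun h => ?_
    rw [← h, threshold_of_le (by simp)] at hnL
    linarith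
  have hI : ∀ a ∉ ({5} : Finset ℕ), s₆.iarr a = s₂.iarr a := fun a ha => by
    rw [hA₆.iarr _ ha, hA₅.iarr _ (by simp), hA₄.iarr _ (by simp), hA₃.iarr _ (by simp)]
  have hR : ∀ a ∉ ({1} : Finset ℕ), s₆.rarr a = s₂.rarr a := fun a ha => by
    rw [hA₆.rarr _ (by simp), hA₅.rarr _ ha, hA₄.rarr _ (by simp), hA₃.rarr _ (by simp)]
  have hM : Mem P (fun _ _ => none) 0 (fun _ => 5) s₆ := by
    refine ⟨?_, ?_, fun v => ?_, fun i h0 h1 => ?_, ⟨fun v => ?_, hlab⟩, arcs_empty fun a ha i => ?_,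
      fun v => ?_, ⟨sortedBy_const (fun i hi => ?_) (fun i h0 h5 => ?_) fun i hi => ?_, fun v => ?_⟩⟩
    · rw [hA₆.ivar _ (by decide), hA₅.ivar _ (by decide), hK5]
    · rw [hA₆.rvar _ (by decide), hA₅.rvar _ (by decide), hA₄.rvar _ (by decide), hε3]
    · rw [hR _ (by decide), hA₂.rarr _ (by decide), hA₁.rarr _ (by decide)]
      simp [DynAlg.input, P]
    · rw [hA₆.rarr _ (by decide)]
      exact hthr i h0 h1
    · rw [hI _ (by decide), hA₂.iarr _ (by decide)]
      exact hrow v v.isLt.le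
    · rw [hI a (by revert a; decide), hA₂.iarr a (by revert a; decide),
        hA₁.iarr a (by revert a; decide)]
      simp [DynAlg.input]
    · rw [hI _ (by decide), hA₂.iarr _ (by decide), hA₁.iarr _ (by decide)]
      simp [DynAlg.input]
    · rw [hI _ (by decide), hI _ (by decide), hA₂.iarr _ (by decide), hA₂.iarr _ (by decide)]
      exact ⟨(hord i hi).1, (hord i hi).2.1⟩
    · rw [hI _ (by decide), hR _ (by decide), (hlow i h0 h5).1, (hlow i h0 h5).2, hws,
        hA₁.ivar _ (by decide)]
      simp [DynAlg.input, P]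
    · rw [hI _ (by decide), hR _ (by decide), (hhigh i hi).1, (hhigh i hi).2,
        hA₁.iarr _ (by decide), hA₁.rarr _ (by decide)]
      simp [DynAlg.input]
    · rw [hI _ (by decide), hA₂.iarr _ (by decide)]
      exact (hord v v.isLt).2.2
  rw [wp_block_cons]
  refine (wp_cut hM (by simp) (fun _ => by simpa [P] using hL) (by omega) hε).mono ?_
  rintro s₇ t₇ ⟨hM₇, hcut, ht₇⟩
  rw [wp_block_nil]
  refine ⟨P, b, ⟨rfl, rfl, hb, rfl, hsb, hbs, ?_, ?_⟩, ⟨_, _, _, hM₇,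
    consistent_empty (by simpa [P] using hL), ⟨by simp, by simp⟩, hcut, potential_empty.symm⟩, ?_⟩
  · simp only [P]
    push_cast
    linarith
  · simp only [P]
    exact_mod_cast hLK.trans_eq (add_comm _ _)
  · simp only [P] at ht₇ ⊢
    push_cast
    omega

end RealRAM

/-! ### Bounds for the parameters -/

theorem log_two_le_log_mul {n : ℕ} {W : ℝ} (hn : 2 ≤ n) (hW : 1 ≤ W) :
    Real.log 2 ≤ Real.log (n * W) := by
  have : (2 : ℝ) ≤ n := by exact_mod_cast hn
  exact Real.log_le_log two_pos (by nlinarith)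

/-- The operation counts do not need the logarithmic factor of the time bounds; it is only used that
this factor is bounded below by `log 2`. -/
theorem le_log_two_add {n : ℕ} {W ε : ℝ} (hn : 2 ≤ n) (hW : 1 ≤ W) (hε : 0 < ε) :
    0.69 ≤ Real.log (2 + Real.log (n * W) / ε) := by
  have h1 := log_two_le_log_mul hn hW
  have h2 := Real.log_two_gt_d9
  have h3 : 0 ≤ Real.log (n * W) / ε := div_nonneg (by linarith) hε.le
  have h4 := Real.log_le_log two_pos (by linarith : 2 ≤ 2 + Real.log (n * W) / ε)
  linarith

/-- Logarithms are compared by `log (1 + x) ≥ x / (1 + x) ≥ 4 * x / 5`; the constant is an upper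
bound for `5 / 4 * log 2`. -/
theorem mul_le_two_mul_of_one_add_pow_le {x : ℝ} (hx : 0 < x) (hx1 : x ≤ 1 / 4) {k b : ℕ}
    (h : (1 + x) ^ k ≤ 2 ^ b) : k * x ≤ 0.87 * b := by
  have h1 : k * Real.log (1 + x) ≤ b * Real.log 2 := by
    rw [← Real.log_pow, ← Real.log_pow]
    exact Real.log_le_log (by positivity) h
  have h2 : x * (4 / 5) ≤ Real.log (1 + x) := by
    refine le_trans ?_ (Real.one_sub_inv_le_log_of_pos (by linarith))
    rw [show 1 - (1 + x)⁻¹ = x * (1 + x)⁻¹ by field_simp; ring]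
    refine mul_le_mul_of_nonneg_left ?_ hx.le
    rw [show (4 / 5 : ℝ) = (1 + 1 / 4)⁻¹ by norm_num]
    exact inv_anti₀ (by linarith) (by linarith)
  have h3 := mul_le_mul_of_nonneg_left h2 k.cast_nonneg
  have h4 := mul_le_mul_of_nonneg_left Real.log_two_lt_d9.le (b.cast_nonneg (α := ℝ))
  linarith

namespace RealRAM

section

variable {n : ℕ} {P : Parameters n} {w : Fin n → ℝ} {ε W : ℝ} {b : ℕ}

/-- From `2 ^ b ≤ 2 * n * W` and `log 2 ≤ log (n * W)` follows `b * log 2 ≤ 2 * log (n * W)`, and `2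
/ log 2 < 3`. -/
theorem Tuned.le_log (h : Tuned P w ε b) (hn : 2 ≤ n) (hW1 : 1 ≤ W) (hW : ∀ v, w v ≤ W) :
    (b : ℝ) ≤ 3 * Real.log (n * W) := by
  have h1 : ∑ v, w v ≤ n * W := by
    simpa using Finset.sum_le_sum (s := Finset.univ) fun v _ => hW v
  have h2 : (0 : ℝ) < n * W := mul_pos (by exact_mod_cast (by omega : 0 < n)) (by linarith)
  have h3 : b * Real.log 2 ≤ Real.log 2 + Real.log (n * W) := by
    rw [← Real.log_pow, ← Real.log_mul two_ne_zero h2.ne']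
    exact Real.log_le_log (by positivity) (h.le_sum.trans (by linarith))
  have h4 := log_two_le_log_mul hn hW1
  have h5 := Real.log_two_gt_d9
  have h6 : (0 : ℝ) ≤ b := b.cast_nonneg
  nlinarith

theorem Tuned.K_le_div (h : Tuned P w ε b) (hε : 0 < ε) : (P.K : ℝ) ≤ 192 * (b / ε ^ 2) := by
  have h1 := h.K_le
  have hb : (0 : ℝ) < b := by exact_mod_cast h.one_le
  rw [h.eta_eq, ← le_div_iff₀ (by positivity)] at h1
  refine h1.trans_eq ?_
  field_simp
  norm_num

theorem Tuned.L_le_div (h : Tuned P w ε b) (hε : 0 < ε) (hε1 : ε < 1) :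
    (P.L : ℝ) ≤ 197 * (b ^ 2 / ε ^ 2) := by
  have h1 : (P.L : ℝ) ≤ P.K * b + 5 := by exact_mod_cast h.L_le
  have h2 := mul_le_mul_of_nonneg_right (h.K_le_div hε) (b.cast_nonneg (α := ℝ))
  have hb : (1 : ℝ) ≤ b := by exact_mod_cast h.one_le
  have h3 : 1 ≤ (b : ℝ) ^ 2 / ε ^ 2 := by
    rw [one_le_div (by positivity)]
    nlinarith
  have h4 : 192 * (b / ε ^ 2) * b = 192 * ((b : ℝ) ^ 2 / ε ^ 2) := by ring
  linarith

/-- All three terms are at most multiples of `b² / ε²`, with coefficients 197, 192 and 1. The factor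
9 comes from `b ≤ 3 * log (n * W)`, and `390 * 9 / 0.69 < 6000`. -/
theorem Tuned.L_add_K_le (h : Tuned P w ε b) (hn : 2 ≤ n) (hε : 0 < ε) (hε1 : ε < 1)
    (hW1 : 1 ≤ W) (hW : ∀ v, w v ≤ W) :
    (P.L + P.K + b : ℝ) ≤ 6000 * amortizedTime n W ε := by
  have h1 := h.K_le_div hε
  have h2 := h.L_le_div hε hε1
  have h3 := h.le_log hn hW1 hW
  have hb : (1 : ℝ) ≤ b := by exact_mod_cast h.one_le
  have h4 : b / ε ^ 2 ≤ (b : ℝ) ^ 2 / ε ^ 2 := by gcongr; nlinarith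
  have h5 : (b : ℝ) ≤ (b : ℝ) ^ 2 / ε ^ 2 := by
    rw [le_div_iff₀ (by positivity)]
    have := pow_le_one₀ hε.le hε1.le (n := 2)
    nlinarith
  have h6 : (b : ℝ) ^ 2 / ε ^ 2 ≤ 9 * (Real.log (n * W) ^ 2 / ε ^ 2) := by
    rw [← mul_div_assoc]
    gcongr
    nlinarith
  have h7 := mul_le_mul_of_nonneg_left (le_log_two_add (ε := ε) hn hW1 hε)
    (by positivity : 0 ≤ Real.log (n * W) ^ 2 / ε ^ 2)
  have h8 : amortizedTime n W ε =
      Real.log (n * W) ^ 2 / ε ^ 2 * Real.log (2 + Real.log (n * W) / ε) := by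
    rw [amortizedTime]; ring
  rw [h8]
  linarith

theorem Tuned.L_mul_K_le (h : Tuned P w ε b) (hn : 2 ≤ n) (hε : 0 < ε) (hε1 : ε < 1)
    (hW1 : 1 ≤ W) (hW : ∀ v, w v ≤ W) :
    (P.L * P.K : ℝ) ≤ 2000000 * worstCaseTime n W ε := by
  have h1 := h.K_le_div hε
  have h2 := h.L_le_div hε hε1
  have h3 := h.le_log hn hW1 hW
  have hb : (1 : ℝ) ≤ b := by exact_mod_cast h.one_le
  have hl : 0 ≤ Real.log (n * W) := by linarith
  have hK := P.two_le_K
  have h6 : 192 * (b / ε ^ 2) * (197 * ((b : ℝ) ^ 2 / ε ^ 2)) ≤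
      192 * 197 * 27 * (Real.log (n * W) ^ 3 / ε ^ 4) := by
    have h5 : (b : ℝ) ^ 3 ≤ (3 * Real.log (n * W)) ^ 3 := by gcongr
    calc 192 * (b / ε ^ 2) * (197 * ((b : ℝ) ^ 2 / ε ^ 2)) = 192 * 197 * (b ^ 3 / ε ^ 4) := by
          field_simp
      _ ≤ 192 * 197 * ((3 * Real.log (n * W)) ^ 3 / ε ^ 4) := by gcongr
      _ = _ := by ring
  have h7 := mul_le_mul_of_nonneg_left (le_log_two_add (ε := ε) hn hW1 hε)
    (by positivity : 0 ≤ Real.log (n * W) ^ 3 / ε ^ 4)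
  have h8 : worstCaseTime n W ε =
      Real.log (n * W) ^ 3 / ε ^ 4 * Real.log (2 + Real.log (n * W) / ε) := by
    rw [worstCaseTime]; ring
  have h9 : (P.L * P.K : ℝ) ≤ 197 * ((b : ℝ) ^ 2 / ε ^ 2) * (192 * (b / ε ^ 2)) :=
    mul_le_mul h2 h1 (by linarith) (by positivity)
  have h10 : 0 ≤ Real.log (n * W) ^ 3 / ε ^ 4 := by positivity
  rw [h8]
  linarith

/-! ### Quality of the orientation and of the subgraph -/

/-- A sandwich: the density `ρ` of the cut set is at most `optLP`, which is at most the load bound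
`lam`, while `lam` in turn exceeds `ρ` by little. So both quantities approximate the optimum. -/
theorem Good.quality {G : SimpleGraph (Fin n)} {s : State} {p : ℝ} (h : Good P G s p)
    (hT : Tuned P w ε b) (hε : 0 < ε) (hε1 : ε < 1) :
    IsOrientation G (DynAlg.storedArc s) ∧
    (∀ v, load w (DynAlg.storedArc s) v ≤ (1 + ε) * optLP G w + 48 * (b / ε)) ∧
    ∃ S : Finset (Fin n), S.Nonempty ∧ DynAlg.Lists (s.setIvar 1 (s.ivar 4)) S ∧
      (1 - ε) * optLP G w - 48 * (b / ε) ≤ density G w S := by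
  obtain ⟨f, deg, lev, hM, hC, hG, ⟨i, k, hi, hc, hle, ⟨v₀, hv₀⟩, hk, hcut⟩, -⟩ := h
  have hη := P.eta_pos.le
  have hw : ∀ v, 0 < w v := fun v => hT.w_eq ▸ zero_lt_one.trans_le (P.one_le_w v)
  have hD := isOrientation_storedArc hM hG
  have hb : (1 : ℝ) ≤ b := by exact_mod_cast hT.one_le
  have hne : (({v | i - 3 ≤ lev v} : Finset (Fin n))).Nonempty := ⟨v₀, by simp; omega⟩
  rw [hT.eps_eq] at hk hcut
  -- The top level is `i + 3 * k`, and loads stay below the threshold of the next level.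
  set lam := threshold P.eta (i + (3 * k + 1 : ℕ)) with hlam
  have hlam0 : 0 ≤ lam := threshold_nonneg hη _
  have hload : ∀ v, load w (DynAlg.storedArc s) v ≤ lam := fun v => by
    rw [← hT.w_eq, load_storedArc hM hC, div_le_iff₀ (hT.w_eq ▸ hw v)]
    refine (hC.lt_low v).le.trans (mul_le_mul_of_nonneg_right (threshold_mono hη ?_)
      (hT.w_eq ▸ hw v).le)
    have := hle v
    push_cast
    omega
  have hopt : optLP G w ≤ lam := optLP_le hD hw hload hlam0
  have hdens := density_le_optLP hD hw hload hlam0 hne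
  have hkb := mul_le_two_mul_of_one_add_pow_le (x := ε / 4) (by linarith) (by linarith)
    (hk.trans (hT.w_eq ▸ hT.sum_le))
  -- By `hkb`, `3 * k * ε` is at most `12 * 0.87 * b = 10.44 * b`, and the remaining `ε` is less
  -- than `b`.
  have hN : (3 * k + 1) * ε ≤ 12 * b := by linarith
  -- This is where the choice of `η` enters: `12 / 64` is less than `1 / 4`.
  have hNη : (3 * k + 1) * P.eta ≤ ε / 4 := by
    rw [hT.eta_eq, ← mul_div_assoc, div_le_iff₀ (by positivity)]
    nlinarith
  have hNb : (3 * k + 1 : ℝ) ≤ 12 * (b / ε) := by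
    rw [← mul_div_assoc, le_div_iff₀ hε]
    exact hN
  have hthr := threshold_ge_add hη i (3 * k + 1)
  rw [← hlam] at hthr
  push_cast at hthr
  have h1 : (1 - ε / 4) * lam ≤ threshold P.eta i + 24 * (b / ε) := by
    have := mul_le_mul_of_nonneg_right hNη hlam0
    linarith
  have h2 := le_density hC hG (c := 1 + ε / 4) (by linarith) ⟨v₀, by omega⟩ hcut
  rw [hT.w_eq, div_le_iff₀ (by linarith)] at h2
  set ρ := density G w ({v | i - 3 ≤ lev v} : Finset (Fin n)) with hρ
  have hbe : 0 ≤ b / ε := by positivity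
  -- One factor `1 - ε / 4` stems from the thresholds, the other one undoes the factor `1 + ε / 4`
  -- of the cut; their product is at least `1 - ε / 2`.
  have h3 : (1 - ε / 2) * lam ≤ ρ + 24 * (b / ε) := by
    have h4 : (1 - ε / 4) * ((1 - ε / 4) * lam) ≤
        (1 - ε / 4) * (ρ * (1 + ε / 4) + 24 * (b / ε)) :=
      mul_le_mul_of_nonneg_left (by linarith) (by linarith)
    have hρ0 : 0 ≤ ρ := by
      refine div_nonneg (Nat.cast_nonneg _) (Finset.sum_nonneg fun v _ => (hw v).le)
    nlinarith [mul_nonneg (sq_nonneg ε) hρ0, mul_nonneg (sq_nonneg ε) hlam0, mul_nonneg hε.le hbe]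
  refine ⟨hD, fun v => (hload v).trans ?_, _, hne, lists_of_sortedBy
    (hM.setIvar (by norm_num) _) (by omega) (by simpa using hc), ?_⟩
  -- For `ε < 1` the product `(1 + ε) * (1 - ε / 2)` is at least 1, and `1 + ε ≤ 2` doubles the
  -- additive error from 24 to 48.
  · have h4 : (1 + ε) * ((1 - ε / 2) * lam) ≤ (1 + ε) * (optLP G w + 24 * (b / ε)) :=
      mul_le_mul_of_nonneg_left (by linarith) (by linarith)
    nlinarith [mul_nonneg (mul_nonneg hε.le (by linarith : 0 ≤ 1 - ε)) hlam0]
  · nlinarith [mul_le_mul_of_nonneg_left hopt (by linarith : 0 ≤ 1 - ε), mul_nonneg hε.le hlam0]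

theorem Good.nonneg {G : SimpleGraph (Fin n)} {s : State} {p : ℝ} (h : Good P G s p) : 0 ≤ p := by
  obtain ⟨f, deg, lev, -, hC, -, -, rfl⟩ := h
  exact hC.potential_nonneg

end

/-! ### The algorithm and the proof of the theorem -/

/-- The dynamic algorithm. -/
def algorithm : DynAlg := ⟨init, update, query⟩

/-- The potential starts at 0 and the changes telescope over the updates. Determinism identifies a
given run with the one whose existence was proved, and a query changes nothing but the variable 1.
-/
theorem good_of_reach {n : ℕ} {P : Parameters n} {w : Fin n → ℝ} {ε : ℝ} {s₀ : State} {t₀ : ℕ}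
    (hn : 0 < n) (hP : 0 < P.eps) (h₀ : Exec init (DynAlg.input ε w) s₀ t₀) (hs₀ : Good P ⊥ s₀ 0)
    {G : SimpleGraph (Fin n)} {s : State} {m T : ℕ} (hr : algorithm.Reach ε w G s m T) :
    ∃ p, Good P G s p ∧ T + 400 * p ≤ 2000 * (P.L + P.K) * m := by
  induction hr with
  | init h =>
    obtain ⟨rfl, -⟩ := h.deterministic h₀
    exact ⟨0, hs₀, by simp⟩
  | update _ x hx h ih =>
    obtain ⟨p, hp, hT⟩ := ih
    obtain ⟨s', t, h', p', hg, ht, -⟩ := wp_update hn hP hp x hx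
    obtain ⟨rfl, rfl⟩ := h.deterministic h'
    refine ⟨p', hg, ?_⟩
    push_cast
    linarith
  | query _ h ih =>
    obtain ⟨p, hp, hT⟩ := ih
    obtain ⟨rfl, -⟩ := h.deterministic (.iassign 1 (.var 4) _)
    exact ⟨p, hp.setIvar (by norm_num) _, hT⟩

end RealRAM

theorem mainTheorem2 :
    ∃ (A : DynAlg) (C : ℝ), 0 < C ∧
      ∀ (n : ℕ) (ε W : ℝ) (w : Fin n → ℝ), 2 ≤ n → 0 < ε → ε < 1 →
        (∀ v, 1 ≤ w v) → (∀ v, w v ≤ W) →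
        -- the initialization terminates
        (∃ s t, RealRAM.Exec A.init (DynAlg.input ε w) s t ∧
          (t : ℝ) ≤ C * n * amortizedTime n W ε) ∧
        -- at any time, after `m` updates that took `T` steps
        ∀ (G : SimpleGraph (Fin n)) (s : RealRAM.State) (m T : ℕ), A.Reach ε w G s m T →
          -- an orientation is stored explicitly, and its maximum load is small
          IsOrientation G (DynAlg.storedArc s) ∧
          (∀ v, load w (DynAlg.storedArc s) v ≤
            (1 + ε) * optLP G w + C * (Real.log (n * W) / ε)) ∧
          -- a dense subgraph is represented implicitly: it can be listed in constant time per vertex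
          (∃ (S : Finset (Fin n)) (s' : RealRAM.State) (t : ℕ), S.Nonempty ∧
            RealRAM.Exec A.query s s' t ∧ DynAlg.Lists s' S ∧ (t : ℝ) ≤ C * S.card ∧
            (1 - ε) * optLP G w - C * (Real.log (n * W) / ε) ≤ density G w S) ∧
          -- amortized time per update
          (T : ℝ) ≤ C * amortizedTime n W ε * m ∧
          -- worst-case time per update
          (∀ x : EdgeUpdate n, x.Valid G →
            ∃ (s' : RealRAM.State) (t : ℕ), RealRAM.Exec A.update (x.handOver s) s' t ∧
              (t : ℝ) ≤ C * worstCaseTime n W ε) := by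
  -- The largest requirement on the constant is `800 * 2000000`, from the worst-case time.
  refine ⟨RealRAM.algorithm, 10 ^ 10, by norm_num, fun n ε W w hn hε hε1 hw hW => ?_⟩
  have hn0 : 0 < n := by omega
  have hn2 : (2 : ℝ) ≤ n := by exact_mod_cast hn
  have hW1 : 1 ≤ W := (hw ⟨0, hn0⟩).trans (hW _)
  obtain ⟨s₀, t₀, h₀, P, b, hT, hs₀, ht₀⟩ := RealRAM.wp_init hn hε hε1 hw
  have hK := P.two_le_K
  have hb := hT.le_log hn hW1 hW
  have hb1 : (1 : ℝ) ≤ b := by exact_mod_cast hT.one_le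
  have hLK := hT.L_add_K_le hn hε hε1 hW1 hW
  have hLK' := hT.L_mul_K_le hn hε hε1 hW1 hW
  have hL : (5 : ℝ) ≤ P.L := by
    obtain ⟨f, deg, lev, -, hC, -⟩ := hs₀
    have h1 := hC.five_le ⟨0, hn0⟩
    have h2 := hC.lt_L ⟨0, hn0⟩
    exact_mod_cast (by omega : 5 ≤ P.L)
  have hA : 0 ≤ amortizedTime n W ε := by linarith
  have hB : 0 ≤ worstCaseTime n W ε := by nlinarith
  have hbε : 48 * (b / ε) ≤ 10 ^ 10 * (Real.log (n * W) / ε) := by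
    rw [← mul_div_assoc, ← mul_div_assoc]
    exact div_le_div_of_nonneg_right (by linarith) hε.le
  refine ⟨⟨s₀, t₀, h₀, ?_⟩, fun G s m T hr => ?_⟩
  · have h1 : (t₀ : ℝ) ≤ 1000 * (n + P.L + P.K + b) := by exact_mod_cast ht₀
    -- The amortized time is bounded away from 0, as 6000 times it dominates `L + K + b`. So it
    -- absorbs the part of the initialization that is linear in `n`, and `n ≥ 2` absorbs the rest.
    have h2 : n * 1 ≤ n * (6000 * amortizedTime n W ε) :=
      mul_le_mul_of_nonneg_left (by linarith) (by linarith)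
    have h3 := mul_le_mul_of_nonneg_right hn2 hA
    linarith
  · obtain ⟨p, hp, hTp⟩ := RealRAM.good_of_reach hn0 (hT.eps_eq ▸ hε) h₀ hs₀ hr
    obtain ⟨hD, hload, S, hS, hlist, hdens⟩ := hp.quality hT hε hε1
    have hSc : (1 : ℝ) ≤ S.card := by exact_mod_cast hS.card_pos
    refine ⟨hD, fun v => (hload v).trans (by linarith), ⟨S, _, _, hS, .iassign 1 (.var 4) s, hlist,
      ?_, by linarith⟩, ?_, fun x hx => ?_⟩
    · simp only [RealRAM.IExpr.cost]
      push_cast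
      linarith
    · have h1 := hp.nonneg
      have h2 : 2000 * (P.L + P.K) * m ≤ 10 ^ 10 * amortizedTime n W ε * (m : ℝ) :=
        mul_le_mul_of_nonneg_right (by linarith) (Nat.cast_nonneg _)
      linarith
    · obtain ⟨s', t, h, -, -, -, ht⟩ := RealRAM.wp_update hn0 (hT.eps_eq ▸ hε) hp x hx
      refine ⟨s', t, h, ?_⟩
      have : (t : ℝ) ≤ 800 * (P.L * P.K) := by exact_mod_cast ht
      linarith
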